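/- Let $\mu>0$ and $\alpha,\beta\in\mathbb R$ with $1+\alpha\beta<0$ (Benjamin–Feir–Newell unstable regime; then $\alpha\ne\beta$), and consider the complex Ginzburg–Landau equation (CGLe) $$A_t=\mu A+(1+i\alpha)A_{xx}-(1+i\beta)|A|^2A .$$ For $\omega\in\mathbb R$ put $$a=\tfrac{(1+\alpha^2)^2}{4(\beta-\alpha)},\quad b=\tfrac{1+\alpha^2}{2}\Big(\tfrac{2(\alpha\omega+\mu)}{\beta-\alpha}-\tfrac{3(1+\alpha\beta)(\omega-\mu\alpha)}{(\beta-\alpha)^2}\Big),\quad c=-\tfrac{3(1+\alpha\beta)(1+\alpha^2)}{2(\beta-\alpha)^2},$$ $$d=\tfrac1{\beta-\alpha},\quad e=\tfrac{\omega-\mu\alpha}{\beta-\alpha}.$$ Let $\lambda$ be either root of $\lambda^2+c\lambda-2ad=0$, and put $\tilde e=\lambda b/a$, $k=\frac{\lambda}{a}(e-\tilde e)$, $\omega_1^2=\tilde e/\lambda$. Consider the 4-D system $$\dot{\tilde M}=\tilde NP,\quad \dot{\tilde N}=\tfrac{\lambda}{a}\tilde M+kP,\quad \dot P=Q,\quad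 \dot Q=\tfrac1\lambda(\tilde M-dP^2-\tilde eP) \qquad(1)$$ and the consistency condition $$(1+\alpha^2)M=\big(\tfrac a\lambda\tilde N-\lambda Q\big)^2, \qquad(2)$$ $$M=\tfrac{d(1+\alpha^2)}{2\lambda}(dP+e)(\tilde M-dP^2-\tilde eP)-\tfrac{d^2(1+\alpha^2)}4Q^2+(\alpha\omega+\mu)(dP+e)^2-(1+\alpha\beta)(dP+e)^3 .$$ For $\rho,\gamma\in\mathbb R$ let $\Omega=\sqrt{\omega_1^2+\rho^2\gamma}$ and, with $\epsilon=\rho^2$, write $$\tilde M=\epsilon\tilde e\tilde y,\quad \tilde N=\epsilon\big(\tilde x-\tfrac{k}{\omega_1^{2}}\tilde w\big),\quad P=\epsilon(\tilde y+\tilde z),\quad Q=\epsilon\tilde w,$$ $$\tilde x=x_1,\quad \tilde y=\rho x_2,\quad \tilde z=z_1\sin\Omega\tau+z_2\cos\Omega\tau,\quad \tilde w=\Omega z_1\cos\Omega\tau-\Omega z_2\sin\Omega\tau .$$ In the variables $X=(x_1,x_2,z_1,z_2)$, with $z=\rho x_2+\tilde z$ and $y=x_1-\frac{k\lambda}{\tilde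 e}\tilde w$, system (1) becomes the rescaled system $$\dot x_1=\tfrac{\rho\lambda e}{a}x_2-\rho^2\tfrac{kd}{\tilde e}z^2,\qquad \dot x_2=\tfrac{\rho}{\tilde e}yz,\qquad(3)$$ $$\dot z_1=\tfrac{\rho^2}{\Omega}\big[-\tfrac d\lambda z^2\cos\Omega\tau+\gamma\tilde z\cos\Omega\tau-\tfrac{\Omega}{\tilde e}yz\sin\Omega\tau\big],\qquad \dot z_2=\tfrac{\rho^2}{\Omega}\big[\tfrac d\lambda z^2\sin\Omega\tau-\gamma\tilde z\sin\Omega\tau-\tfrac{\Omega}{\tilde e}yz\cos\Omega\tau\big].$$ Let $a_4\ne0$. Then the following hold. (i) At $\omega=\mu\beta$ one has $\omega_1^2>0$, the linear part of (1) at the origin has characteristic polynomial $X^2(X^2+\omega_1^2)$, and its eigenvalue $0$ has a one-dimensional eigenspace. (ii) For $(a_{22},\gamma,\omega_3)\in\mathbb R^3$ choose $\omega$ by $$e=\tfrac{\alpha\omega+\mu}{1+\alpha\beta}+\rho^2(\rho^2\omega_3-\rho\,d\,a_2),\qquad a_2=\rho a_{22}, \qquad(4)$$ and evaluate on the starting vector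 $X_0=(0,a_2,0,a_4)$ the mean over one period $2\pi/\Omega$ of the right-hand side of $\dot x_1$ (times $\rho^{-2}$), of the right-hand side of $\dot z_1$ (times $2\Omega a_4^{-1}\rho^{-2}$), and of the difference of the two sides of (2), left minus right (times $-\frac{4(1+\alpha\beta)\lambda}{(1+\alpha^2)\mu}\rho^{-4}$). As $\rho\to0$ these tend to the left-hand sides of the determining equations $$a_{22}\tfrac{\lambda e}{a}-\tfrac{k d a_4^2}{2\tilde e}=0,\qquad \gamma=0,\qquad a_4^2\big(-\lambda+d^2(1+\alpha\beta)(1+\alpha^2+\lambda+\lambda\alpha\beta)\big)+4(1+\alpha\beta)^2\lambda\mu\,\omega_3=0,$$ in which $e,\tilde e,k$ are taken at $\omega=\mu\beta$ (so $e=\mu$). These equations have exactly one solution, and their Jacobian determinant with respect to $(a_{22},\gamma,\omega_3)$ is $4(1+\alpha\beta)^2\lambda^2\mu e/a\neq0$. (iii) There are $\rho_0>0$, continuous functions $a_{22},\gamma,\omega_3$ on $(-\rho_0,\rho_0)$ whose values at $\rho=0$ solve the determining equations, and functions $X^\rho:\mathbb R\to\mathbb R^4$ depending continuously on $(\rho,\tau)$,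 such that for every $|\rho|<\rho_0$, with $\omega=\omega(\rho)$ given by (4) and $\Omega=\Omega(\rho)$: - $\omega_1^2>0$, $\Omega>0$, and the eigenvalue $0$ of the linear part of (1) has a one-dimensional eigenspace; - $X^\rho$ is a $2\pi/\Omega$-periodic solution of (3) with mean $(0,\rho a_{22},0,a_4)$, with $x_1,z_1$ odd and $x_2,z_2$ even; - the corresponding $(\tilde M,\tilde N,P,Q)$ is a $2\pi/\Omega$-periodic solution of (1), with $\tilde M,P$ even and $\tilde N,Q$ odd, and it satisfies (2) exactly; - $dP+e>0$, and $R=\sqrt{dP+e}$, $\phi(x)=\int_0^x\frac{G}{R^2}$ with $G=\frac{(a/\lambda)\tilde N-\lambda Q}{1+\alpha^2}$, are smooth, even, $2\pi/\Omega$-periodic, and satisfy (with $G=\phi_xR^2$) $$(1+\alpha^2)G_x=(\beta-\alpha)R^4-(\omega-\mu\alpha)R^2,\quad (1+\alpha^2)G^2=(1+\alpha^2)R^3R_{xx}+(\alpha\omega+\mu)R^4-(1+\alpha\beta)R^6;$$ - if $\rho\ne0$, then $R$ is not constant and $A(x,t)=R(x)e^{i\phi(x)-i\omega t}$ is a stationary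 modulated amplitude wave: a classical solution of the CGLe, $2\pi/\Omega$-periodic in $x$. (iv) The waves bifurcate from the homogeneously oscillating state $\sqrt\mu\,e^{-i\mu\beta t}$: as $\rho\to0$, uniformly in space, $X^\rho\to(0,0,0,a_4)$, $R\to\sqrt\mu$, $\phi\to0$ and $\phi_x\to0$, while $\omega\to\mu\beta$, $e\to\mu$ and $\Omega\to\sqrt{-2\mu(1+\alpha\beta)/(1+\alpha^2)}$. -/

import Mathlib

namespace CGL

noncomputable section

/-! ### The complex Ginzburg-Landau equation and stationary modulated amplitude waves -/

/-- `A` (arguments: space `x`, time `t`) is a classical solution on the line of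
`A_t = μ A + (1 + iα) A_xx - (1 + iβ) |A|² A`. -/
def SolvesCGL (μ α β : ℝ) (A : ℝ → ℝ → ℂ) : Prop :=
  ContDiff ℝ 2 (fun p : ℝ × ℝ => A p.1 p.2) ∧
  ∀ x t : ℝ, deriv (fun s => A x s) t =
    (μ : ℂ) * A x t
      + (1 + Complex.I * (α : ℂ)) * iteratedDeriv 2 (fun y => A y t) x
      - (1 + Complex.I * (β : ℂ)) * ((‖A x t‖ ^ 2 : ℝ) : ℂ) * A x t

/-- The coherent field `A(x,t) = R(x) exp(iφ(x) - iωt)`. -/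
def field (ω : ℝ) (R φ : ℝ → ℝ) (x t : ℝ) : ℂ :=
  (R x : ℂ) * Complex.exp (Complex.I * (φ x : ℂ) - Complex.I * (ω : ℂ) * (t : ℂ))

/-- The "angular momentum" `G = φ_x R²`. -/
def angMom (R φ : ℝ → ℝ) (x : ℝ) : ℝ := deriv φ x * R x ^ 2

/-- The stationary equations for amplitude and phase:
`(1+α²) G_x = (β-α) R⁴ - (ω-μα) R²` and
`(1+α²) G² = (1+α²) R³ R_xx + (αω+μ) R⁴ - (1+αβ) R⁶`. -/
def SolvesAmplitudePhase (μ α β ω : ℝ) (R φ : ℝ → ℝ) : Prop :=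
  ContDiff ℝ ((⊤ : ℕ∞) : WithTop ℕ∞) R ∧ ContDiff ℝ ((⊤ : ℕ∞) : WithTop ℕ∞) φ ∧
  ∀ x : ℝ,
    (1 + α ^ 2) * deriv (angMom R φ) x = (β - α) * R x ^ 4 - (ω - μ * α) * R x ^ 2 ∧
    (1 + α ^ 2) * angMom R φ x ^ 2 =
      (1 + α ^ 2) * R x ^ 3 * iteratedDeriv 2 R x + (α * ω + μ) * R x ^ 4
        - (1 + α * β) * R x ^ 6

/-- A stationary modulated amplitude wave of the CGLe in the periodic box of length `L`: a field
`R(x) exp(iφ(x) - iωt)` with smooth `L`-periodic positive non-constant amplitude and smooth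
phase, `L`-periodic in `x` and solving the CGLe. -/
structure IsStationaryMAW (μ α β L ω : ℝ) (R φ : ℝ → ℝ) : Prop where
  L_pos : 0 < L
  smooth_R : ContDiff ℝ ((⊤ : ℕ∞) : WithTop ℕ∞) R
  smooth_φ : ContDiff ℝ ((⊤ : ℕ∞) : WithTop ℕ∞) φ
  R_pos : ∀ x, 0 < R x
  R_periodic : Function.Periodic R L
  R_modulated : ¬ ∃ r : ℝ, ∀ x, R x = r
  field_periodic : ∀ t, Function.Periodic (fun x => field ω R φ x t) L
  solves : SolvesCGL μ α β (field ω R φ)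

/-! ### Coefficients -/

def coefA (α β : ℝ) : ℝ := (1 + α ^ 2) ^ 2 / (4 * (β - α))

def coefB (μ α β ω : ℝ) : ℝ :=
  (1 + α ^ 2) / 2 *
    (2 * (α * ω + μ) / (β - α) - 3 * (1 + α * β) * (ω - μ * α) / (β - α) ^ 2)

def coefC (α β : ℝ) : ℝ := -(3 * (1 + α * β) * (1 + α ^ 2) / (2 * (β - α) ^ 2))

def coefD (α β : ℝ) : ℝ := 1 / (β - α)

/-- `e = (ω - μα)/(β - α)`, the squared amplitude of the Stokes wave of frequency `ω`. -/
def coefE (μ α β ω : ℝ) : ℝ := (ω - μ * α) / (β - α)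

/-- `ẽ`, fixed by `a / lam = b / ẽ`. -/
def eTilde (μ α β lam ω : ℝ) : ℝ := lam * coefB μ α β ω / coefA α β

/-- `k`, fixed by `ẽ + (a / lam) k = e`. -/
def coefK (μ α β lam ω : ℝ) : ℝ :=
  lam / coefA α β * (coefE μ α β ω - eTilde μ α β lam ω)

/-! ### The 4-D system in the variables `(M̃, Ñ, P, Q)` -/

/-- The vector field of the 4-D system
`M̃' = ÑP`, `Ñ' = (lam/a) M̃ + kP`, `P' = Q`, `Q' = (M̃ - dP² - ẽP)/lam`. -/
def vf4 (μ α β lam ω : ℝ) (Y : Fin 4 → ℝ) : Fin 4 → ℝ :=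
  ![Y 1 * Y 2,
    lam / coefA α β * Y 0 + coefK μ α β lam ω * Y 2,
    Y 3,
    1 / lam * (Y 0 - coefD α β * Y 2 ^ 2 - eTilde μ α β lam ω * Y 2)]

/-- The linear part of the 4-D system at the fixed point `0`. -/
def linPart (μ α β lam ω : ℝ) : Matrix (Fin 4) (Fin 4) ℝ :=
  !![0, 0, 0, 0;
     lam / coefA α β, 0, coefK μ α β lam ω, 0;
     0, 0, 0, 1;
     1 / lam, 0, -(eTilde μ α β lam ω) / lam, 0]

/-- The function `M = (1+α²) R³ R_xx + (αω+μ) R⁴ - (1+αβ) R⁶` in the variables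
`(M̃, Ñ, P, Q)`, with `R² = dP + e`. -/
def bigM (μ α β lam ω : ℝ) (Y : Fin 4 → ℝ) : ℝ :=
  coefD α β * (1 + α ^ 2) / (2 * lam) * (coefD α β * Y 2 + coefE μ α β ω)
      * (Y 0 - coefD α β * Y 2 ^ 2 - eTilde μ α β lam ω * Y 2)
    - coefD α β ^ 2 * (1 + α ^ 2) / 4 * Y 3 ^ 2
    + (α * ω + μ) * (coefD α β * Y 2 + coefE μ α β ω) ^ 2
    - (1 + α * β) * (coefD α β * Y 2 + coefE μ α β ω) ^ 3

/-- The defect `(1+α²) M - ((a/lam) Ñ - lam Q)²` of the consistency condition. -/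
def consistencyDefect (μ α β lam ω : ℝ) (Y : Fin 4 → ℝ) : ℝ :=
  (1 + α ^ 2) * bigM μ α β lam ω Y - (coefA α β / lam * Y 1 - lam * Y 3) ^ 2

/-- The amplitude `R = √(dP + e)`. -/
def amplitude (μ α β ω : ℝ) (Y : ℝ → Fin 4 → ℝ) (x : ℝ) : ℝ :=
  Real.sqrt (coefD α β * Y x 2 + coefE μ α β ω)

/-- The phase, with `φ_x = G / R²`, `G = ((a/lam) Ñ - lam Q)/(1+α²)` and `φ(0) = 0`. -/
def phase (μ α β lam ω : ℝ) (Y : ℝ → Fin 4 → ℝ) (x : ℝ) : ℝ :=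
  ∫ s in (0 : ℝ)..x,
    (coefA α β / lam * Y s 1 - lam * Y s 3) / (1 + α ^ 2)
      / (coefD α β * Y s 2 + coefE μ α β ω)

/-! ### The rescaled system, `ε = ρ²` -/

/-- `Ω = √(ẽ/lam + ρ² γ)`, that is, `Ω² = ω₁² + εγ` with `ω₁² = ẽ/lam`. -/
def spatialFreq (μ α β lam ω ρ γ : ℝ) : ℝ :=
  Real.sqrt (eTilde μ α β lam ω / lam + ρ ^ 2 * γ)

/-- The carrier frequency `ω` for which
`e = (αω+μ)/(1+αβ) + ρ² (ρ² ω₃ - ρ d a₂)` with `a₂ = ρ a₂₂`; see `coefE_eq_iff`. -/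
def carrierFreq (μ α β ρ a₂₂ ω₃ : ℝ) : ℝ :=
  μ * β + ρ ^ 4 * (ω₃ - coefD α β * a₂₂) * ((1 + α * β) * (β - α) / (1 + α ^ 2))

theorem coefE_eq_iff {μ α β ρ a₂₂ ω₃ ω : ℝ} (hαβ : β - α ≠ 0) (hs : 1 + α * β ≠ 0) :
    coefE μ α β ω = (α * ω + μ) / (1 + α * β)
        + ρ ^ 2 * (ρ ^ 2 * ω₃ - ρ * coefD α β * (ρ * a₂₂))
      ↔ ω = carrierFreq μ α β ρ a₂₂ ω₃ := by
  have hm : (1 + α ^ 2) ≠ 0 := by positivity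
  unfold carrierFreq coefE coefD
  rw [div_eq_iff hαβ]
  have key : ω - μ * α - ((α * ω + μ) / (1 + α * β)
        + ρ ^ 2 * (ρ ^ 2 * ω₃ - ρ * (1 / (β - α)) * (ρ * a₂₂))) * (β - α)
      = (1 + α ^ 2) / (1 + α * β) * (ω - (μ * β + ρ ^ 4 * (ω₃ - 1 / (β - α) * a₂₂)
        * ((1 + α * β) * (β - α) / (1 + α ^ 2)))) := by
    field_simp
    ring
  rw [← sub_eq_zero, key, mul_eq_zero, sub_eq_zero]
  have : (1 + α ^ 2) / (1 + α * β) ≠ 0 := div_ne_zero hm hs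
  tauto

/-- The vector `(x̃, ỹ, z̃, w̃)` built from `v = (x₁, x₂, z₁, z₂)` at the point `τ`:
`x̃ = x₁`, `ỹ = ρ x₂`, `z̃ = z₁ sin Ωτ + z₂ cos Ωτ`, `w̃ = Ω z₁ cos Ωτ - Ω z₂ sin Ωτ`. -/
def rotate (ρ Ω τ : ℝ) (v : Fin 4 → ℝ) : Fin 4 → ℝ :=
  ![v 0,
    ρ * v 1,
    v 2 * Real.sin (Ω * τ) + v 3 * Real.cos (Ω * τ),
    Ω * v 2 * Real.cos (Ω * τ) - Ω * v 3 * Real.sin (Ω * τ)]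

/-- The linear change of variables `D`, with `ω₁⁻² = lam / ẽ`. -/
def changeD (μ α β lam ω : ℝ) : Matrix (Fin 4) (Fin 4) ℝ :=
  !![0, eTilde μ α β lam ω, 0, 0;
     1, 0, 0, -(coefK μ α β lam ω * (lam / eTilde μ α β lam ω));
     0, 1, 1, 0;
     0, 0, 0, 1]

/-- `(M̃, Ñ, P, Q) = ε D (x̃, ỹ, z̃, w̃)` with `ε = ρ²`. -/
def physical (μ α β lam ω ρ Ω τ : ℝ) (v : Fin 4 → ℝ) : Fin 4 → ℝ :=
  ρ ^ 2 • (changeD μ α β lam ω).mulVec (rotate ρ Ω τ v)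

/-- The right-hand side of the rescaled (standard form) system for `v = (x₁, x₂, z₁, z₂)`. -/
def rescaledVF (μ α β lam ω ρ γ Ω τ : ℝ) (v : Fin 4 → ℝ) : Fin 4 → ℝ :=
  let e := coefE μ α β ω
  let et := eTilde μ α β lam ω
  let k := coefK μ α β lam ω
  let d := coefD α β
  let S := Real.sin (Ω * τ)
  let C := Real.cos (Ω * τ)
  let zt := v 2 * S + v 3 * C
  let z := ρ * v 1 + zt
  let y := v 0 - k * (Ω * lam / et) * (v 2 * C - v 3 * S)
  ![ρ * lam * e / coefA α β * v 1 - ρ ^ 2 * k * (d / et) * z ^ 2,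
    ρ / et * y * z,
    ρ ^ 2 / Ω * (-d / lam * z ^ 2 * C + γ * zt * C - Ω / et * y * z * S),
    ρ ^ 2 / Ω * (d / lam * z ^ 2 * S - γ * zt * S - Ω / et * y * z * C)]

/-- The reflection `diag(-1, 1, -1, 1)`. -/
def reflQ : Matrix (Fin 4) (Fin 4) ℝ := Matrix.diagonal ![-1, 1, -1, 1]

/-- Mean value over `[0, T]`. -/
def mean (T : ℝ) (f : ℝ → ℝ) : ℝ := T⁻¹ * ∫ τ in (0 : ℝ)..T, f τ

/-! ### Determining equations -/

/-- The leading-order determining equations, as a map of `p = (a₂₂, γ, ω₃)`; here `e`, `ẽ`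
and `k` have their values at `ω = μβ`. -/
def determiningMap (μ α β lam a₄ : ℝ) (p : Fin 3 → ℝ) : Fin 3 → ℝ :=
  ![p 0 * (lam * coefE μ α β (μ * β) / coefA α β)
      - coefK μ α β lam (μ * β) * coefD α β * a₄ ^ 2 / (2 * eTilde μ α β lam (μ * β)),
    p 1,
    a₄ ^ 2 * (-lam + coefD α β ^ 2 * (1 + α * β) * (1 + α ^ 2 + lam + lam * α * β))
      + 4 * (1 + α * β) ^ 2 * lam * μ * p 2]

/-- The exact determining functions evaluated on the starting vector `X₀ = (0, ρ a₂₂, 0, a₄)`,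
normalized: the means over a period `2π/Ω` of the first and third components of the rescaled
vector field, and the mean defect of the consistency condition. -/
def startingMap (μ α β lam a₄ ρ : ℝ) (p : Fin 3 → ℝ) : Fin 3 → ℝ :=
  let ω := carrierFreq μ α β ρ (p 0) (p 2)
  let Ω := spatialFreq μ α β lam ω ρ (p 1)
  let T := 2 * Real.pi / Ω
  let X₀ : Fin 4 → ℝ := ![0, ρ * p 0, 0, a₄]
  ![(ρ ^ 2)⁻¹ * mean T (fun τ => rescaledVF μ α β lam ω ρ (p 1) Ω τ X₀ 0),
    2 * Ω / a₄ * (ρ ^ 2)⁻¹ * mean T (fun τ => rescaledVF μ α β lam ω ρ (p 1) Ω τ X₀ 2),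
    -(4 * (1 + α * β) * lam / ((1 + α ^ 2) * μ)) * (ρ ^ 4)⁻¹
      * mean T (fun τ => consistencyDefect μ α β lam ω (physical μ α β lam ω ρ Ω τ X₀))]

end

end CGL

namespace CGL
noncomputable section

/-! ### Continuous `2π`-periodic functions -/

/-! The existence part is a Lyapunov–Schmidt argument written as one fixed-point equation in the
Banach algebra `PerFun`. In the angle θ = Ωτ the unknown period becomes a coefficient. With ε = ρ²,
P = ε p, p = a₄ cos θ + ε r, M̃ = ε² h, Ñ = ε n / Ω, W = ω₁² and V = Ω² = W + εγ, system (1) reads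
r'' + r = V⁻¹((h - d p²)/λ + γ p), h' = V⁻¹ n p, n' = ε(λ/a) h + k p. For even p, h and odd n the
remaining obstructions are scalar. The cos-component of the forcing is removed by γ, the mean of n'
by the mean of h, and condition (2) by the frequency shift σ = ω₃ - d a₂₂; the free multiple of cos
in r is spent on giving z₂ the mean a₄. Each equation is solved by a bounded operator (`primEven`,
`primOdd`, `osc`), which gives a C¹ map Φ(ε, u). At ε = 0 every occurrence of u disappears
(`Φ_zero`), so id - Φ has identity derivative in u and the implicit function theorem gives the
branch (`exists_fixedPoint_branch`).

Condition (2) costs only one scalar because its defect is a first integral of (1); this is where the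
quadratic equation for λ enters (`hasDerivAt_consistencyDefect`). It suffices to impose (2) at θ =
0, where Ñ and Q vanish by oddness and M contains the factor R² (`bigM_freq`).

A solution of (1) and (2) yields the amplitude and phase equations by differentiation
(`solvesAmplitudePhase`), and these are the real and imaginary parts of the CGLe multiplied by 1 -
iα (`solvesCGL_field`). The phase is periodic because its gradient is odd. The wave is modulated
because p stays close to a₄ cos. The uniform limits are continuity of the branch at ε = 0 in the sup
norm.

The limits in (ii) are a separate computation: on the starting vector all integrands are
trigonometric polynomials, their means are computed exactly (`mean_trig`), and the limiting map is
affine with diagonal linear part. -/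

instance fact_two_pi_pos : Fact (0 < 2 * Real.pi) := ⟨Real.two_pi_pos⟩

/-- The Banach algebra of continuous `2π`-periodic functions. -/
abbrev PerFun : Type := C(AddCircle (2 * Real.pi), ℝ)

namespace PerFun

/-- The element of `PerFun` given by a continuous `2π`-periodic function on the line. -/
def ofPeriodic (f : ℝ → ℝ) (hf : Continuous f) (hp : Function.Periodic f (2 * Real.pi)) : PerFun :=
  ⟨hp.lift, continuous_coinduced_dom.mpr hf⟩

@[simp] theorem ofPeriodic_coe (f : ℝ → ℝ) (hf : Continuous f)
    (hp : Function.Periodic f (2 * Real.pi)) (θ : ℝ) : ofPeriodic f hf hp (θ : AddCircle (2 * Real.pi)) = f θ :=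
  rfl

theorem ext_coe {f g : PerFun} (h : ∀ θ : ℝ, f (θ : AddCircle (2 * Real.pi)) = g (θ : AddCircle (2 * Real.pi))) :
    f = g := by
  ext x
  induction x using QuotientAddGroup.induction_on with
  | H θ => exact h θ

theorem continuous_coe (f : PerFun) : Continuous (fun θ : ℝ => f (θ : AddCircle (2 * Real.pi))) :=
  f.continuous.comp (AddCircle.continuous_mk' _)

theorem periodic_coe (f : PerFun) :
    Function.Periodic (fun θ : ℝ => f (θ : AddCircle (2 * Real.pi))) (2 * Real.pi) := by
  intro θ
  simp

theorem coe_two_pi (f : PerFun) : f ((2 * Real.pi : ℝ) : AddCircle (2 * Real.pi)) = f 0 := by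
  rw [AddCircle.coe_period]

theorem norm_le_of_Icc {f : PerFun} {K : ℝ} (hK : 0 ≤ K)
    (h : ∀ θ ∈ Set.Icc (0 : ℝ) (2 * Real.pi), |f (θ : AddCircle (2 * Real.pi))| ≤ K) : ‖f‖ ≤ K := by
  rw [ContinuousMap.norm_le _ hK]
  intro x
  obtain ⟨θ, hθ, rfl⟩ := AddCircle.eq_coe_Ico x
  exact h θ ⟨hθ.1, hθ.2.le⟩

def cosC : PerFun := ofPeriodic Real.cos Real.continuous_cos Real.cos_periodic

def sinC : PerFun := ofPeriodic Real.sin Real.continuous_sin Real.sin_periodic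

@[simp] theorem cosC_coe (θ : ℝ) : cosC (θ : AddCircle (2 * Real.pi)) = Real.cos θ := rfl

@[simp] theorem sinC_coe (θ : ℝ) : sinC (θ : AddCircle (2 * Real.pi)) = Real.sin θ := rfl

@[simp] theorem cosC_zero : cosC 0 = 1 := by
  rw [← AddCircle.coe_zero, cosC_coe, Real.cos_zero]

@[simp] theorem sinC_zero : sinC 0 = 0 := by
  rw [← AddCircle.coe_zero, sinC_coe, Real.sin_zero]

theorem intervalIntegrable_coe (f : PerFun) (a b : ℝ) :
    IntervalIntegrable (fun θ : ℝ => f (θ : AddCircle (2 * Real.pi))) MeasureTheory.volume a b :=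
  f.continuous_coe.intervalIntegrable a b

/-- The mean value. -/
def avg : PerFun →L[ℝ] ℝ :=
  LinearMap.mkContinuous
    { toFun := fun f => (2 * Real.pi)⁻¹ * ∫ θ in (0 : ℝ)..(2 * Real.pi), f (θ : AddCircle (2 * Real.pi))
      map_add' := fun f g => by
        simp only [ContinuousMap.add_apply]
        rw [intervalIntegral.integral_add (intervalIntegrable_coe f _ _)
          (intervalIntegrable_coe g _ _), mul_add]
      map_smul' := fun c f => by
        simp only [ContinuousMap.smul_apply, smul_eq_mul, RingHom.id_apply]
        rw [intervalIntegral.integral_const_mul]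
        ring } 1
    (fun f => by
      have h := intervalIntegral.norm_integral_le_of_norm_le_const (a := 0) (b := 2 * Real.pi)
        (f := fun θ : ℝ => f (θ : AddCircle (2 * Real.pi))) (C := ‖f‖)
        (fun θ _ => f.norm_coe_le_norm _)
      have hpi := Real.two_pi_pos
      simp only [LinearMap.coe_mk, AddHom.coe_mk, norm_mul, norm_inv, Real.norm_eq_abs,
        sub_zero] at h ⊢
      rw [abs_of_pos hpi] at h
      rw [← abs_mul, abs_of_pos hpi, inv_mul_le_iff₀ hpi]
      linarith)

theorem avg_apply (f : PerFun) :
    avg f = (2 * Real.pi)⁻¹ * ∫ θ in (0 : ℝ)..(2 * Real.pi), f (θ : AddCircle (2 * Real.pi)) := rfl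

theorem integral_eq_avg (f : PerFun) :
    ∫ θ in (0 : ℝ)..(2 * Real.pi), f (θ : AddCircle (2 * Real.pi)) = 2 * Real.pi * avg f := by
  rw [avg_apply, mul_inv_cancel_left₀ Real.two_pi_pos.ne']

theorem norm_avg_le (f : PerFun) : |avg f| ≤ ‖f‖ := by
  have := avg.le_of_opNorm_le (LinearMap.mkContinuous_norm_le _ zero_le_one _) f
  simpa using this

@[simp] theorem avg_one : avg 1 = 1 := by
  have := Real.pi_ne_zero
  simp [avg_apply]
  field_simp

/-- If `g` is the derivative of a periodic function, its mean value vanishes. -/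
theorem avg_eq_zero_of_hasDerivAt {f g : PerFun}
    (h : ∀ θ : ℝ, HasDerivAt (fun θ : ℝ => f (θ : AddCircle (2 * Real.pi))) (g (θ : AddCircle (2 * Real.pi))) θ) :
    avg g = 0 := by
  rw [avg_apply, intervalIntegral.integral_eq_sub_of_hasDerivAt (fun θ _ => h θ)
    (g.intervalIntegrable_coe _ _), coe_two_pi, AddCircle.coe_zero, sub_self, mul_zero]

/-- The primitive of `f - avg f` that vanishes at `0`, as a function on the line. -/
def primFun (f : PerFun) (θ : ℝ) : ℝ := ∫ t in (0 : ℝ)..θ, (f - avg f • (1 : PerFun)) (t : AddCircle (2 * Real.pi))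

theorem hasDerivAt_primFun (f : PerFun) (θ : ℝ) :
    HasDerivAt (primFun f) (f (θ : AddCircle (2 * Real.pi)) - avg f) θ := by
  have := ((f - avg f • (1 : PerFun)).continuous_coe).integral_hasStrictDerivAt 0 θ
  exact this.hasDerivAt.congr_deriv (by simp)

theorem periodic_primFun (f : PerFun) : Function.Periodic (primFun f) (2 * Real.pi) := by
  intro θ
  have h : ∫ t in (0 : ℝ)..(2 * Real.pi), (f - avg f • (1 : PerFun)) (t : AddCircle (2 * Real.pi)) = 0 := by
    rw [integral_eq_avg]; simp
  have h2 := (periodic_coe (f - avg f • (1 : PerFun))).intervalIntegral_add_eq_add 0 θ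
    (fun a b => intervalIntegrable_coe _ a b)
  simp only [zero_add] at h2
  rw [h, add_zero] at h2
  unfold primFun
  rw [add_comm θ]
  rw [add_comm] at h2
  exact h2

/-- The primitive of `f - avg f` that vanishes at `0`. -/
def prim : PerFun →L[ℝ] PerFun :=
  LinearMap.mkContinuous
    { toFun := fun f => ofPeriodic (primFun f)
        (continuous_iff_continuousAt.mpr fun θ => (hasDerivAt_primFun f θ).continuousAt)
        (periodic_primFun f)
      map_add' := fun f g => by
        refine ext_coe fun θ => ?_
        simp only [ofPeriodic_coe, ContinuousMap.add_apply, primFun]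
        rw [← intervalIntegral.integral_add (intervalIntegrable_coe _ _ _)
          (intervalIntegrable_coe _ _ _)]
        congr 1
        ext t
        simp
        ring
      map_smul' := fun c f => by
        refine ext_coe fun θ => ?_
        simp only [ofPeriodic_coe, ContinuousMap.smul_apply, primFun, RingHom.id_apply, smul_eq_mul]
        rw [← intervalIntegral.integral_const_mul]
        congr 1
        ext t
        simp
        ring } (2 * Real.pi * 2)
    (fun f => by
      have hpi := Real.two_pi_pos
      -- The constant is the length 2π of a period times the bound 2‖f‖ for f minus its mean.
      refine norm_le_of_Icc (by positivity) fun θ hθ => ?_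
      have h := intervalIntegral.norm_integral_le_of_norm_le_const (a := 0) (b := θ)
        (f := fun t : ℝ => (f - avg f • (1 : PerFun)) (t : AddCircle (2 * Real.pi))) (C := 2 * ‖f‖)
        (fun t _ => by
          have h1 := f.norm_coe_le_norm (t : AddCircle (2 * Real.pi))
          have h2 := norm_avg_le f
          have h3 := abs_sub (f (t : AddCircle (2 * Real.pi))) (avg f)
          simp only [ContinuousMap.sub_apply, ContinuousMap.smul_apply, ContinuousMap.one_apply,
            smul_eq_mul, mul_one, Real.norm_eq_abs] at h1 h3 ⊢
          linarith)
      simp only [LinearMap.coe_mk, AddHom.coe_mk, ofPeriodic_coe]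
      rw [sub_zero, abs_of_nonneg hθ.1] at h
      refine h.trans ?_
      nlinarith [hθ.2, norm_nonneg f])

@[simp] theorem prim_coe (f : PerFun) (θ : ℝ) : prim f (θ : AddCircle (2 * Real.pi)) = primFun f θ := rfl

@[simp] theorem prim_zero_apply (f : PerFun) : prim f 0 = 0 := by
  rw [← AddCircle.coe_zero, prim_coe, primFun, intervalIntegral.integral_same]

theorem hasDerivAt_prim (f : PerFun) (θ : ℝ) :
    HasDerivAt (fun θ : ℝ => prim f (θ : AddCircle (2 * Real.pi)))
      (f (θ : AddCircle (2 * Real.pi)) - avg f) θ :=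
  hasDerivAt_primFun f θ

/-- Two elements with the same derivative and the same value at `0` agree. -/
theorem eq_of_hasDerivAt {f g h : PerFun}
    (hf : ∀ θ : ℝ, HasDerivAt (fun θ : ℝ => f (θ : AddCircle (2 * Real.pi))) (h (θ : AddCircle (2 * Real.pi))) θ)
    (hg : ∀ θ : ℝ, HasDerivAt (fun θ : ℝ => g (θ : AddCircle (2 * Real.pi))) (h (θ : AddCircle (2 * Real.pi))) θ)
    (h0 : f 0 = g 0) : f = g := by
  refine ext_coe fun θ => ?_
  have := is_const_of_deriv_eq_zero (𝕜 := ℝ)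
    (f := fun θ : ℝ => f (θ : AddCircle (2 * Real.pi)) - g (θ : AddCircle (2 * Real.pi)))
    (fun θ => ((hf θ).sub (hg θ)).differentiableAt)
    (fun θ => ((hf θ).sub (hg θ)).deriv.trans (sub_self _)) θ 0
  simp only [AddCircle.coe_zero, h0, sub_self] at this
  linarith

/-! #### Parity -/

def IsEven (f : PerFun) : Prop := ∀ x, f (-x) = f x

def IsOdd (f : PerFun) : Prop := ∀ x, f (-x) = -f x

/-- `f ∘ neg`. -/
def reflect : PerFun →L[ℝ] PerFun where
  toFun f := f.comp ⟨fun x => -x, continuous_neg⟩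
  map_add' _ _ := rfl
  map_smul' _ _ := rfl
  cont := ContinuousMap.continuous_precomp _

@[simp] theorem reflect_apply (f : PerFun) (x : AddCircle (2 * Real.pi)) : reflect f x = f (-x) := rfl

/-- The even part. -/
def evenPart : PerFun →L[ℝ] PerFun := (2⁻¹ : ℝ) • (ContinuousLinearMap.id ℝ PerFun + reflect)

@[simp] theorem evenPart_apply (f : PerFun) (x : AddCircle (2 * Real.pi)) :
    evenPart f x = 2⁻¹ * (f x + f (-x)) := by
  simp [evenPart]
  ring

theorem isEven_evenPart (f : PerFun) : IsEven (evenPart f) := by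
  intro x
  simp [add_comm]

theorem isOdd_sub_evenPart (f : PerFun) : IsOdd (f - evenPart f) := by
  intro x
  simp
  ring

theorem IsEven.evenPart_eq {f : PerFun} (h : IsEven f) : evenPart f = f := by
  ext x
  simp [h x]
  ring

theorem IsOdd.evenPart_eq {f : PerFun} (h : IsOdd f) : evenPart f = 0 := by
  ext x
  simp [h x]

theorem isEven_cosC : IsEven cosC := by
  intro x
  induction x using QuotientAddGroup.induction_on with
  | H θ => exact Real.cos_neg θ

theorem isOdd_sinC : IsOdd sinC := by
  intro x
  induction x using QuotientAddGroup.induction_on with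
  | H θ => exact Real.sin_neg θ

theorem isEven_one : IsEven 1 := fun _ => rfl

theorem IsEven.add {f g : PerFun} (hf : IsEven f) (hg : IsEven g) : IsEven (f + g) := fun x => by
  simp [hf x, hg x]

theorem IsEven.sub {f g : PerFun} (hf : IsEven f) (hg : IsEven g) : IsEven (f - g) := fun x => by
  simp [hf x, hg x]

theorem IsEven.smul {f : PerFun} (hf : IsEven f) (c : ℝ) : IsEven (c • f) := fun x => by
  simp [hf x]

theorem IsEven.mul {f g : PerFun} (hf : IsEven f) (hg : IsEven g) : IsEven (f * g) := fun x => by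
  simp [hf x, hg x]

theorem IsOdd.add {f g : PerFun} (hf : IsOdd f) (hg : IsOdd g) : IsOdd (f + g) := fun x => by
  simp [hf x, hg x]; ring

theorem IsOdd.sub {f g : PerFun} (hf : IsOdd f) (hg : IsOdd g) : IsOdd (f - g) := fun x => by
  simp [hf x, hg x]; ring

theorem IsOdd.smul {f : PerFun} (hf : IsOdd f) (c : ℝ) : IsOdd (c • f) := fun x => by
  simp [hf x]

theorem IsOdd.mul {f g : PerFun} (hf : IsOdd f) (hg : IsOdd g) : IsEven (f * g) := fun x => by
  simp [hf x, hg x]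

theorem IsOdd.mul_isEven {f g : PerFun} (hf : IsOdd f) (hg : IsEven g) : IsOdd (f * g) := fun x => by
  simp [hf x, hg x]

theorem IsEven.mul_isOdd {f g : PerFun} (hf : IsEven f) (hg : IsOdd g) : IsOdd (f * g) := fun x => by
  simp [hf x, hg x]

theorem IsOdd.apply_zero {f : PerFun} (hf : IsOdd f) : f 0 = 0 := by
  have := hf 0
  rw [neg_zero] at this
  linarith

theorem IsOdd.avg_eq_zero {f : PerFun} (hf : IsOdd f) : avg f = 0 := by
  have h1 : ∫ θ in (0 : ℝ)..(2 * Real.pi), f ((-θ : ℝ) : AddCircle (2 * Real.pi))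
      = ∫ θ in (0 : ℝ)..(2 * Real.pi), f (θ : AddCircle (2 * Real.pi)) := by
    rw [intervalIntegral.integral_comp_neg (fun θ : ℝ => f (θ : AddCircle (2 * Real.pi)))]
    have := (periodic_coe f).intervalIntegral_add_eq (-(2 * Real.pi)) 0
    simpa using this
  have h2 : ∫ θ in (0 : ℝ)..(2 * Real.pi), f ((-θ : ℝ) : AddCircle (2 * Real.pi))
      = -∫ θ in (0 : ℝ)..(2 * Real.pi), f (θ : AddCircle (2 * Real.pi)) := by
    rw [← intervalIntegral.integral_neg]
    congr 1
    ext θ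
    rw [AddCircle.coe_neg, hf]
  rw [avg_apply]
  have : ∫ θ in (0 : ℝ)..(2 * Real.pi), f (θ : AddCircle (2 * Real.pi)) = 0 := by linarith
  rw [this, mul_zero]

theorem IsEven.isOdd_prim {f : PerFun} (hf : IsEven f) : IsOdd (prim f) := by
  intro x
  induction x using QuotientAddGroup.induction_on with
  | H θ =>
    change primFun f (-θ) = -primFun f θ
    unfold primFun
    have := intervalIntegral.integral_comp_neg (a := 0) (b := θ)
      (fun t : ℝ => (f - avg f • (1 : PerFun)) (t : AddCircle (2 * Real.pi)))
    rw [neg_zero] at this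
    rw [intervalIntegral.integral_symm, ← this]
    congr 1
    refine intervalIntegral.integral_congr fun t _ => ?_
    simp [hf (t : AddCircle (2 * Real.pi))]

theorem IsOdd.isEven_prim {f : PerFun} (hf : IsOdd f) : IsEven (prim f) := by
  intro x
  induction x using QuotientAddGroup.induction_on with
  | H θ =>
    change primFun f (-θ) = primFun f θ
    unfold primFun
    have := intervalIntegral.integral_comp_neg (a := 0) (b := θ)
      (fun t : ℝ => (f - avg f • (1 : PerFun)) (t : AddCircle (2 * Real.pi)))
    rw [neg_zero] at this
    rw [intervalIntegral.integral_symm, ← this, ← intervalIntegral.integral_neg]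
    refine intervalIntegral.integral_congr fun t _ => ?_
    simp [hf (t : AddCircle (2 * Real.pi)), hf.avg_eq_zero]

/-! #### Primitives and the resonant oscillator -/

/-- The odd primitive of the even part of `f`, minus its mean. -/
def primEven : PerFun →L[ℝ] PerFun := prim.comp evenPart

/-- The mean-zero even primitive of the odd part of `f`. -/
def primOdd : PerFun →L[ℝ] PerFun :=
  (ContinuousLinearMap.id ℝ PerFun - avg.smulRight (1 : PerFun)).comp
    (prim.comp (ContinuousLinearMap.id ℝ PerFun - evenPart))

theorem primEven_apply (f : PerFun) : primEven f = prim (evenPart f) := rfl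

theorem primOdd_apply (f : PerFun) :
    primOdd f = prim (f - evenPart f) - avg (prim (f - evenPart f)) • (1 : PerFun) := rfl

/-- The parity projection inside the operator makes the output odd for every input. The fixed-point
map can thus act on all of `PerFun`, and its fixed points acquire the symmetry automatically. -/
theorem isOdd_primEven (f : PerFun) : IsOdd (primEven f) := (isEven_evenPart f).isOdd_prim

theorem isEven_primOdd (f : PerFun) : IsEven (primOdd f) :=
  (isOdd_sub_evenPart f).isEven_prim.sub (isEven_one.smul _)

theorem avg_primOdd (f : PerFun) : avg (primOdd f) = 0 := by
  rw [primOdd_apply]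
  simp

theorem IsEven.hasDerivAt_primEven {f : PerFun} (hf : IsEven f) (θ : ℝ) :
    HasDerivAt (fun θ : ℝ => primEven f (θ : AddCircle (2 * Real.pi)))
      (f (θ : AddCircle (2 * Real.pi)) - avg f) θ := by
  rw [primEven_apply, hf.evenPart_eq]
  exact hasDerivAt_prim f θ

theorem IsOdd.hasDerivAt_primOdd {f : PerFun} (hf : IsOdd f) (θ : ℝ) :
    HasDerivAt (fun θ : ℝ => primOdd f (θ : AddCircle (2 * Real.pi)))
      (f (θ : AddCircle (2 * Real.pi))) θ := by
  rw [primOdd_apply, hf.evenPart_eq, sub_zero]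
  have := (hasDerivAt_prim f θ).sub_const (avg (prim f))
  simpa [hf.avg_eq_zero] using this

theorem hasDerivAt_cosC (θ : ℝ) :
    HasDerivAt (fun θ : ℝ => cosC (θ : AddCircle (2 * Real.pi))) (-Real.sin θ) θ :=
  Real.hasDerivAt_cos θ

theorem hasDerivAt_sinC (θ : ℝ) :
    HasDerivAt (fun θ : ℝ => sinC (θ : AddCircle (2 * Real.pi))) (Real.cos θ) θ :=
  Real.hasDerivAt_sin θ

theorem cosC_sq_add_sinC_sq : cosC * cosC + sinC * sinC = 1 := by
  refine ext_coe fun θ => ?_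
  simp only [ContinuousMap.add_apply, ContinuousMap.mul_apply, cosC_coe, sinC_coe,
    ContinuousMap.one_apply]
  nlinarith [Real.sin_sq_add_cos_sq θ]

@[simp] theorem avg_cosC : avg cosC = 0 :=
  avg_eq_zero_of_hasDerivAt (f := sinC) fun θ => hasDerivAt_sinC θ

/-- Since cos² - sin² is the derivative of sin · cos, both squares have the same mean, and these
means add up to 1. -/
theorem avg_cosC_sq : avg (cosC * cosC) = 1 / 2 := by
  have h1 : avg (cosC * cosC - sinC * sinC) = 0 :=
    avg_eq_zero_of_hasDerivAt (f := sinC * cosC) fun θ => by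
      have := (hasDerivAt_sinC θ).mul (hasDerivAt_cosC θ)
      refine this.congr_deriv ?_
      simp
      ring
  have h2 := congrArg avg cosC_sq_add_sinC_sq
  rw [map_add, avg_one] at h2
  rw [map_sub] at h1
  linarith

theorem avg_sinC_sq : avg (sinC * sinC) = 1 / 2 := by
  have h2 := congrArg avg cosC_sq_add_sinC_sq
  rw [map_add, avg_one, avg_cosC_sq] at h2
  linarith

theorem avg_sinC_sq_mul_cosC : avg (sinC * sinC * cosC) = 0 :=
  avg_eq_zero_of_hasDerivAt (f := (1 / 3 : ℝ) • (sinC * sinC * sinC)) fun θ => by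
    have := (((hasDerivAt_sinC θ).mul (hasDerivAt_sinC θ)).mul (hasDerivAt_sinC θ)).const_mul
      (1 / 3 : ℝ)
    refine this.congr_deriv ?_
    simp
    ring

theorem avg_cosC_cube : avg (cosC * cosC * cosC) = 0 := by
  have h2 := congrArg (fun f => avg (f * cosC)) cosC_sq_add_sinC_sq
  simp only [add_mul, one_mul, map_add, avg_sinC_sq_mul_cosC, avg_cosC] at h2
  linarith

theorem primEven_cosC : primEven cosC = sinC := by
  refine eq_of_hasDerivAt (h := cosC) (fun θ => ?_) hasDerivAt_sinC ?_
  · simpa using isEven_cosC.hasDerivAt_primEven θ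
  · rw [(isOdd_primEven _).apply_zero, isOdd_sinC.apply_zero]

theorem primOdd_sinC_mul_cosC :
    primOdd (sinC * cosC) = (1 / 2 : ℝ) • (sinC * sinC) - (1 / 4 : ℝ) • (1 : PerFun) := by
  have hodd : IsOdd (sinC * cosC) := isOdd_sinC.mul_isEven isEven_cosC
  have h : prim (sinC * cosC) = (1 / 2 : ℝ) • (sinC * sinC) := by
    refine eq_of_hasDerivAt (h := sinC * cosC) (fun θ => ?_) (fun θ => ?_) ?_
    · simpa [hodd.avg_eq_zero] using hasDerivAt_prim (sinC * cosC) θ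
    · have := ((hasDerivAt_sinC θ).mul (hasDerivAt_sinC θ)).const_mul (1 / 2 : ℝ)
      refine this.congr_deriv ?_
      simp
      ring
    · simp
  -- The constant 1/4 is the mean of sin²/2.
  rw [primOdd_apply, hodd.evenPart_eq, sub_zero, h, map_smul, avg_sinC_sq]
  norm_num

/-- A solution operator for `r'' + r = f`, `f` even with `avg (f cos) = 0`, before normalization. -/
def oscRaw : PerFun →L[ℝ] PerFun :=
  (ContinuousLinearMap.mul ℝ PerFun sinC).comp
      (prim.comp ((ContinuousLinearMap.mul ℝ PerFun cosC).comp evenPart))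
    - (ContinuousLinearMap.mul ℝ PerFun cosC).comp
      (prim.comp ((ContinuousLinearMap.mul ℝ PerFun sinC).comp evenPart))

/-- The derivative of `oscRaw f`. -/
def oscRawDeriv : PerFun →L[ℝ] PerFun :=
  (ContinuousLinearMap.mul ℝ PerFun cosC).comp
      (prim.comp ((ContinuousLinearMap.mul ℝ PerFun cosC).comp evenPart))
    + (ContinuousLinearMap.mul ℝ PerFun sinC).comp
      (prim.comp ((ContinuousLinearMap.mul ℝ PerFun sinC).comp evenPart))

/-- Variation of parameters: sin θ ∫ f cos - cos θ ∫ f sin. -/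
theorem oscRaw_apply (f : PerFun) :
    oscRaw f = sinC * prim (cosC * evenPart f) - cosC * prim (sinC * evenPart f) := rfl

theorem oscRawDeriv_apply (f : PerFun) :
    oscRawDeriv f = cosC * prim (cosC * evenPart f) + sinC * prim (sinC * evenPart f) := rfl

/-- The solution of `r'' + r = f` with `avg (r cos) = 0`, for `f` even with `avg (f cos) = 0`. -/
def osc : PerFun →L[ℝ] PerFun :=
  oscRaw - ((2 : ℝ) • avg.comp ((ContinuousLinearMap.mul ℝ PerFun cosC).comp oscRaw)).smulRight cosC

/-- The derivative of `osc f`. -/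
def oscDeriv : PerFun →L[ℝ] PerFun :=
  oscRawDeriv + ((2 : ℝ) • avg.comp ((ContinuousLinearMap.mul ℝ PerFun cosC).comp oscRaw)).smulRight sinC

theorem osc_apply (f : PerFun) : osc f = oscRaw f - (2 * avg (cosC * oscRaw f)) • cosC := rfl

theorem oscDeriv_apply (f : PerFun) :
    oscDeriv f = oscRawDeriv f + (2 * avg (cosC * oscRaw f)) • sinC := rfl

theorem isEven_osc (f : PerFun) : IsEven (osc f) := by
  have h1 : IsEven (evenPart f) := isEven_evenPart f
  rw [osc_apply, oscRaw_apply]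
  exact ((isOdd_sinC.mul (isEven_cosC.mul h1).isOdd_prim).sub
    (isEven_cosC.mul (isOdd_sinC.mul_isEven h1).isEven_prim)).sub (isEven_cosC.smul _)

theorem isOdd_oscDeriv (f : PerFun) : IsOdd (oscDeriv f) := by
  have h1 : IsEven (evenPart f) := isEven_evenPart f
  rw [oscDeriv_apply, oscRawDeriv_apply]
  exact ((isEven_cosC.mul_isOdd (isEven_cosC.mul h1).isOdd_prim).add
    (isOdd_sinC.mul_isEven (isOdd_sinC.mul_isEven h1).isEven_prim)).add (isOdd_sinC.smul _)

/-- The factor 2 in `osc` compensates avg cos² = 1/2. The cos-component of r is thereby left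
entirely to the coefficient `κ`. -/
theorem avg_cosC_mul_osc (f : PerFun) : avg (cosC * osc f) = 0 := by
  rw [osc_apply, mul_sub, mul_smul_comm, map_sub, map_smul, avg_cosC_sq, smul_eq_mul]
  ring

/-- `prim` removes means, so variation of parameters is exact only if f cos and f sin both have mean
zero. The first is the non-resonance hypothesis, the second follows from parity. The extra multiple
of cos solves the homogeneous equation. -/
theorem hasDerivAt_osc {f : PerFun} (hf : IsEven f) (h0 : avg (cosC * f) = 0) (θ : ℝ) :
    HasDerivAt (fun θ : ℝ => osc f (θ : AddCircle (2 * Real.pi)))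
      (oscDeriv f (θ : AddCircle (2 * Real.pi))) θ := by
  have h1 : avg (sinC * f) = 0 := (isOdd_sinC.mul_isEven hf).avg_eq_zero
  rw [osc_apply, oscDeriv_apply, oscRaw_apply, oscRawDeriv_apply, hf.evenPart_eq]
  have := (((hasDerivAt_sinC θ).mul (hasDerivAt_prim (cosC * f) θ)).sub
    ((hasDerivAt_cosC θ).mul (hasDerivAt_prim (sinC * f) θ))).sub
    ((hasDerivAt_cosC θ).const_mul
      (2 * avg (cosC * (sinC * prim (cosC * f) - cosC * prim (sinC * f)))))
  refine this.congr_deriv ?_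
  simp only [h0, h1, ContinuousMap.mul_apply, ContinuousMap.add_apply, ContinuousMap.smul_apply,
    cosC_coe, sinC_coe, smul_eq_mul]
  ring

theorem hasDerivAt_oscDeriv {f : PerFun} (hf : IsEven f) (h0 : avg (cosC * f) = 0) (θ : ℝ) :
    HasDerivAt (fun θ : ℝ => oscDeriv f (θ : AddCircle (2 * Real.pi)))
      (f (θ : AddCircle (2 * Real.pi)) - osc f (θ : AddCircle (2 * Real.pi))) θ := by
  have h1 : avg (sinC * f) = 0 := (isOdd_sinC.mul_isEven hf).avg_eq_zero
  rw [osc_apply, oscDeriv_apply, oscRaw_apply, oscRawDeriv_apply, hf.evenPart_eq]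
  have := (((hasDerivAt_cosC θ).mul (hasDerivAt_prim (cosC * f) θ)).add
    ((hasDerivAt_sinC θ).mul (hasDerivAt_prim (sinC * f) θ))).add
    ((hasDerivAt_sinC θ).const_mul
      (2 * avg (cosC * (sinC * prim (cosC * f) - cosC * prim (sinC * f)))))
  refine this.congr_deriv ?_
  simp only [h0, h1, ContinuousMap.mul_apply, ContinuousMap.sub_apply, ContinuousMap.smul_apply,
    cosC_coe, sinC_coe, smul_eq_mul]
  linear_combination f (θ : AddCircle (2 * Real.pi)) * Real.sin_sq_add_cos_sq θ

/-- Average r'' + r = f over a period. -/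
theorem avg_osc {f : PerFun} (hf : IsEven f) (h0 : avg (cosC * f) = 0) : avg (osc f) = avg f := by
  have := avg_eq_zero_of_hasDerivAt (f := oscDeriv f) (g := f - osc f)
    (fun θ => hasDerivAt_oscDeriv hf h0 θ)
  rw [map_sub] at this
  linarith

end PerFun
end
end CGL

namespace CGL
noncomputable section

/-! ### The branch of fixed points -/

/-- A family of maps that is constant at the parameter value `0` has a continuous branch of fixed
points. -/
theorem exists_fixedPoint_branch {E : Type*} [NormedAddCommGroup E] [NormedSpace ℝ E]
    [CompleteSpace E] {Φ : ℝ × E → E} {u₀ : E} (hΦ : ContDiffAt ℝ 1 Φ (0, u₀))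
    (hconst : ∀ u, Φ (0, u) = u₀) :
    ∃ u : ℝ → E, u 0 = u₀ ∧ ∀ᶠ ε in nhds (0 : ℝ), ContinuousAt u ε ∧ Φ (ε, u ε) = u ε := by
  set F : ℝ × E → E := fun z => z.2 - Φ z with hF
  have hcd : ContDiffAt ℝ 1 F (0, u₀) := contDiffAt_snd.sub hΦ
  -- On the slice ε = 0 the map F is u ↦ u - u₀, so its partial derivative is the identity and no
  -- estimate on Φ is needed.
  have hd : (fderiv ℝ F (0, u₀)).comp (ContinuousLinearMap.inr ℝ ℝ E)
      = ContinuousLinearMap.id ℝ E := by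
    have h1 : HasFDerivAt (fun u : E => F (0, u))
        ((fderiv ℝ F (0, u₀)).comp (ContinuousLinearMap.inr ℝ ℝ E)) u₀ := by
      have hin : HasFDerivAt (fun u : E => ((0 : ℝ), u)) (ContinuousLinearMap.inr ℝ ℝ E) u₀ :=
        hasFDerivAt_prodMk_right 0 u₀
      exact (hcd.differentiableAt one_ne_zero).hasFDerivAt.comp u₀ hin
    have h2 : HasFDerivAt (fun u : E => F (0, u)) (ContinuousLinearMap.id ℝ E) u₀ := by
      have : (fun u : E => F (0, u)) = fun u => u - u₀ := by
        funext u
        simp [hF, hconst]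
      rw [this]
      exact (hasFDerivAt_id u₀).sub_const u₀
    exact h1.unique h2
  have hinv : ((fderiv ℝ F (0, u₀)).comp (ContinuousLinearMap.inr ℝ ℝ E)).IsInvertible := by
    rw [hd]
    exact ⟨ContinuousLinearEquiv.refl ℝ E, rfl⟩
  refine ⟨hcd.implicitFunction one_ne_zero hinv,
    hcd.implicitFunction_apply_self one_ne_zero hinv, ?_⟩
  have h1 := hcd.eventually_apply_implicitFunction one_ne_zero hinv
  -- Being C¹ at a point is an open condition, which gives continuity of the branch at all nearby ε
  -- and not only at 0.
  have h2 := (hcd.contDiffAt_implicitFunction one_ne_zero hinv).eventually (by simp)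
  filter_upwards [h1, h2] with ε hε hc
  refine ⟨hc.continuousAt, ?_⟩
  simp only [hF, hconst, sub_self] at hε
  exact (sub_eq_zero.mp hε).symm

/-! ### The reduced fixed-point problem -/

open CGL.PerFun

/-- The constants of the reduced problem: `s = 1 + αβ`, `m = 1 + α²`, the coefficients `d`, `lam`,
`a`, `μ`, and the amplitude `amp` of the leading mode. -/
structure Reduced where
  s : ℝ
  m : ℝ
  d : ℝ
  lam : ℝ
  a : ℝ
  μ : ℝ
  amp : ℝ

/-- The parameter `ε` and the unknowns `(r, h, γ, σ)`, where `P = ε (amp cos + ε r)`,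
`M̃ = ε² h` and `σ = ω₃ - d a₂₂`. -/
abbrev Unknowns : Type := ℝ × (PerFun × PerFun × ℝ × ℝ)

namespace Reduced

variable (c : Reduced) (z : Unknowns)

/-- `e` -/
def e : ℝ := c.μ + z.1 ^ 2 * z.2.2.2.2 * (c.s / c.m)

/-- `ω₁²` -/
def W : ℝ := -(2 * c.s / c.m) * (c.e z + 2 * z.1 ^ 2 * z.2.2.2.2)

/-- `k` -/
def k : ℝ := c.lam / c.a * (c.e z - c.lam * c.W z)

/-- `Ω²` -/
def V : ℝ := c.W z + z.1 * z.2.2.2.1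

/-- `P / ε` -/
def p : PerFun := c.amp • cosC + z.1 • z.2.1

/-- `Ω Ñ / ε` -/
def n : PerFun := (z.1 * (c.lam / c.a)) • primEven z.2.2.1 + c.k z • primEven (c.p z)

/-- The mean value of `h`. -/
def hMean : ℝ := c.k z * c.d * c.a / (c.lam * c.e z) * avg (c.p z * c.p z)

/-- `M̃ / ε²` -/
def h : PerFun := c.hMean z • (1 : PerFun) + (c.V z)⁻¹ • primOdd (c.n z * c.p z)

/-- The quadratic term `h - d p²`. -/
def quad : PerFun := c.h z - c.d • (c.p z * c.p z)

/-- Non-resonance of the forcing requires γ avg(p cos) + λ⁻¹ avg(quad cos) = 0, with avg(p cos) =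
amp/2 + ε avg(r cos). The amp/2 term is solved for γ, and the ε term keeps the old γ, so only the
constant amp is divided by. -/
def γ : ℝ := -(2 / c.amp) * (z.1 * z.2.2.2.1 * avg (cosC * z.2.1) + c.lam⁻¹ * avg (cosC * c.quad z))

/-- The forcing of the oscillator `r'' + r = g`. -/
def g : PerFun := (c.V z)⁻¹ • (c.lam⁻¹ • c.quad z + c.γ z • c.p z)

/-- The coefficient of `cos` in `r`, fixed by the normalization of the mean. -/
def κ : ℝ := avg (cosC * c.h z) / (c.lam * c.W z)

def r : PerFun := osc (c.g z) + c.κ z • cosC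

/-- The consistency condition at θ = 0, freed of the factor ε²R² and solved for the term s μ σ. The
remaining occurrences of σ carry powers of ε; the quadratic one comes from expanding e. -/
def σ : ℝ := (c.s * c.μ)⁻¹ * (c.d * c.m / (2 * c.lam) * ContinuousMap.evalCLM ℝ 0 (c.quad z)
  - c.s * c.d ^ 2 * (ContinuousMap.evalCLM ℝ 0 (c.p z)) ^ 2
  + z.1 * c.s * c.d * z.2.2.2.2 * ContinuousMap.evalCLM ℝ 0 (c.p z)
  - z.1 ^ 2 * z.2.2.2.2 ^ 2 * c.s ^ 2 / c.m)

/-- The fixed point map. -/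
def Φ : PerFun × PerFun × ℝ × ℝ := (c.r z, c.h z, c.γ z, c.σ z)

/-- The derivative of `p` at a fixed point. -/
def q : PerFun := z.1 • (oscDeriv (c.g z) - c.κ z • sinC) - c.amp • sinC

/-! ### Smoothness of the fixed-point map -/

variable {c z}

theorem contDiff_e : ContDiff ℝ 1 c.e := by
  unfold e; fun_prop

theorem contDiff_W : ContDiff ℝ 1 c.W := by
  have := contDiff_e (c := c)
  unfold W; fun_prop

theorem contDiff_k : ContDiff ℝ 1 c.k := by
  have := contDiff_e (c := c)
  have := contDiff_W (c := c)
  unfold k; fun_prop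

theorem contDiff_V : ContDiff ℝ 1 c.V := by
  have := contDiff_W (c := c)
  unfold V; fun_prop

theorem contDiff_p : ContDiff ℝ 1 c.p := by
  unfold p; fun_prop

/-- Because Ñ is scaled by Ω, the reduced equations contain only Ω² = V, and no square root enters
Φ. -/
theorem contDiff_n : ContDiff ℝ 1 c.n := by
  have := contDiff_p (c := c)
  have := contDiff_k (c := c)
  unfold n; fun_prop

theorem contDiffAt_hMean (hl : c.lam ≠ 0) (he : c.e z ≠ 0) : ContDiffAt ℝ 1 c.hMean z := by
  have h1 := (contDiff_p (c := c)).contDiffAt (x := z)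
  have h2 := (contDiff_k (c := c)).contDiffAt (x := z)
  have h3 := (contDiff_e (c := c)).contDiffAt (x := z)
  unfold hMean
  fun_prop (disch := simp [hl, he])

theorem contDiffAt_h (hl : c.lam ≠ 0) (he : c.e z ≠ 0) (hV : c.V z ≠ 0) :
    ContDiffAt ℝ 1 c.h z := by
  have h1 := (contDiff_p (c := c)).contDiffAt (x := z)
  have h2 := (contDiff_n (c := c)).contDiffAt (x := z)
  have h3 := contDiffAt_hMean hl he
  have h4 := (contDiff_V (c := c)).contDiffAt (x := z)
  unfold h
  fun_prop (disch := exact hV)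

theorem contDiffAt_quad (hl : c.lam ≠ 0) (he : c.e z ≠ 0) (hV : c.V z ≠ 0) :
    ContDiffAt ℝ 1 c.quad z := by
  have h1 := (contDiff_p (c := c)).contDiffAt (x := z)
  have h2 := contDiffAt_h hl he hV
  unfold quad
  fun_prop

theorem contDiffAt_γ (hl : c.lam ≠ 0) (he : c.e z ≠ 0) (hV : c.V z ≠ 0) :
    ContDiffAt ℝ 1 c.γ z := by
  have h2 := contDiffAt_quad hl he hV
  unfold γ
  fun_prop

theorem contDiffAt_g (hl : c.lam ≠ 0) (he : c.e z ≠ 0) (hV : c.V z ≠ 0) :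
    ContDiffAt ℝ 1 c.g z := by
  have h1 := (contDiff_p (c := c)).contDiffAt (x := z)
  have h2 := contDiffAt_quad hl he hV
  have h3 := contDiffAt_γ hl he hV
  have h4 := (contDiff_V (c := c)).contDiffAt (x := z)
  unfold g
  fun_prop (disch := exact hV)

theorem contDiffAt_κ (hl : c.lam ≠ 0) (he : c.e z ≠ 0) (hV : c.V z ≠ 0) (hW : c.W z ≠ 0) :
    ContDiffAt ℝ 1 c.κ z := by
  have h2 := contDiffAt_h hl he hV
  have h4 := (contDiff_W (c := c)).contDiffAt (x := z)
  unfold κ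
  fun_prop (disch := simp [hl, hW])

theorem contDiffAt_r (hl : c.lam ≠ 0) (he : c.e z ≠ 0) (hV : c.V z ≠ 0) (hW : c.W z ≠ 0) :
    ContDiffAt ℝ 1 c.r z := by
  have h1 := contDiffAt_g hl he hV
  have h2 := contDiffAt_κ hl he hV hW
  unfold r
  fun_prop

theorem contDiffAt_q (hl : c.lam ≠ 0) (he : c.e z ≠ 0) (hV : c.V z ≠ 0) (hW : c.W z ≠ 0) :
    ContDiffAt ℝ 1 c.q z := by
  have h1 := contDiffAt_g hl he hV
  have h2 := contDiffAt_κ hl he hV hW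
  unfold q
  fun_prop

theorem contDiffAt_σ (hl : c.lam ≠ 0) (he : c.e z ≠ 0) (hV : c.V z ≠ 0) :
    ContDiffAt ℝ 1 c.σ z := by
  have h1 := (contDiff_p (c := c)).contDiffAt (x := z)
  have h2 := contDiffAt_quad hl he hV
  unfold σ
  fun_prop

theorem contDiffAt_Φ (hl : c.lam ≠ 0) (he : c.e z ≠ 0) (hV : c.V z ≠ 0) (hW : c.W z ≠ 0) :
    ContDiffAt ℝ 1 c.Φ z := by
  have h1 := contDiffAt_r hl he hV hW
  have h2 := contDiffAt_h hl he hV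
  have h3 := contDiffAt_γ hl he hV
  have h4 := contDiffAt_σ hl he hV
  unfold Φ
  fun_prop

/-! #### The value at `ε = 0` -/

theorem e_zero (u : PerFun × PerFun × ℝ × ℝ) : c.e (0, u) = c.μ := by simp [e]

theorem W_zero (u : PerFun × PerFun × ℝ × ℝ) : c.W (0, u) = -(2 * c.s / c.m) * c.μ := by
  simp [W, e_zero]

theorem k_zero (u : PerFun × PerFun × ℝ × ℝ) :
    c.k (0, u) = c.lam / c.a * (c.μ + 2 * c.s * c.lam * c.μ / c.m) := by
  rw [k, e_zero, W_zero]
  ring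

theorem V_zero (u : PerFun × PerFun × ℝ × ℝ) : c.V (0, u) = -(2 * c.s / c.m) * c.μ := by
  simp [V, W_zero]

theorem p_zero (u : PerFun × PerFun × ℝ × ℝ) : c.p (0, u) = c.amp • cosC := by simp [p]

theorem n_zero (u : PerFun × PerFun × ℝ × ℝ) :
    c.n (0, u) = (c.k (0, u) * c.amp) • sinC := by
  simp [n, p_zero, primEven_cosC, smul_smul]

theorem hMean_zero (u : PerFun × PerFun × ℝ × ℝ) :
    c.hMean (0, u) = c.k (0, u) * c.d * c.a / (c.lam * c.μ) * (c.amp ^ 2 / 2) := by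
  rw [hMean, p_zero, e_zero, smul_mul_smul_comm, map_smul, avg_cosC_sq, smul_eq_mul]
  ring

theorem h_zero (u : PerFun × PerFun × ℝ × ℝ) :
    c.h (0, u) = c.hMean (0, u) • (1 : PerFun) + ((c.V (0, u))⁻¹ * (c.k (0, u) * c.amp * c.amp)) •
      ((1 / 2 : ℝ) • (sinC * sinC) - (1 / 4 : ℝ) • (1 : PerFun)) := by
  rw [h, n_zero, p_zero, smul_mul_smul_comm, map_smul, primOdd_sinC_mul_cosC, smul_smul]

/-- At ε = 0 the quadratic term is a combination of 1, sin² and cos², hence has only even harmonics.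
-/
theorem quad_zero_avg (u : PerFun × PerFun × ℝ × ℝ) : avg (cosC * c.quad (0, u)) = 0 := by
  have h1 : avg (cosC * (sinC * sinC)) = 0 := by
    rw [mul_comm cosC, avg_sinC_sq_mul_cosC]
  have h2 : avg (cosC * (cosC * cosC)) = 0 := by
    rw [← mul_assoc, avg_cosC_cube]
  rw [quad, h_zero, p_zero]
  simp only [mul_sub, mul_add, mul_smul_comm, smul_mul_assoc, map_sub, map_add, map_smul, mul_one,
    h1, h2, avg_cosC, smul_zero, add_zero, sub_zero]

theorem γ_zero (u : PerFun × PerFun × ℝ × ℝ) : c.γ (0, u) = 0 := by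
  simp [γ, quad_zero_avg]

/-- The unknowns enter every ingredient of Φ with a factor ε, so at ε = 0 only the constants of the
problem remain. -/
theorem Φ_zero (u : PerFun × PerFun × ℝ × ℝ) : c.Φ (0, u) = c.Φ (0, 0) := by
  have hk : c.k (0, u) = c.k (0, 0) := by rw [k_zero, k_zero]
  have hV : c.V (0, u) = c.V (0, 0) := by rw [V_zero, V_zero]
  have hW : c.W (0, u) = c.W (0, 0) := by rw [W_zero, W_zero]
  have hp : c.p (0, u) = c.p (0, 0) := by rw [p_zero, p_zero]
  have hm : c.hMean (0, u) = c.hMean (0, 0) := by rw [hMean_zero, hMean_zero, hk]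
  have hh : c.h (0, u) = c.h (0, 0) := by rw [h_zero, h_zero, hk, hV, hm]
  have hq : c.quad (0, u) = c.quad (0, 0) := by rw [quad, quad, hh, hp]
  have hg : c.g (0, u) = c.g (0, 0) := by rw [g, g, γ_zero, γ_zero, hV, hp, hq]
  have hκ : c.κ (0, u) = c.κ (0, 0) := by rw [κ, κ, hh, hW]
  have hr : c.r (0, u) = c.r (0, 0) := by rw [r, r, hg, hκ]
  have hσ : c.σ (0, u) = c.σ (0, 0) := by simp [σ, hp, hq]
  rw [Φ, Φ, hr, hh, γ_zero, γ_zero, hσ]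

theorem q_zero (u : PerFun × PerFun × ℝ × ℝ) : c.q (0, u) = -(c.amp • sinC) := by
  simp [q]

theorem σ_zero (u : PerFun × PerFun × ℝ × ℝ) :
    c.σ (0, u) = (c.s * c.μ)⁻¹ * (c.d * c.m / (2 * c.lam) * (c.hMean (0, u)
      - (c.V (0, u))⁻¹ * c.k (0, u) * c.amp ^ 2 / 4 - c.d * c.amp ^ 2)
      - c.s * c.d ^ 2 * c.amp ^ 2) := by
  simp only [σ, quad, h_zero, p_zero, ContinuousMap.evalCLM_apply, ContinuousMap.add_apply,
    ContinuousMap.sub_apply, ContinuousMap.smul_apply, ContinuousMap.mul_apply,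
    ContinuousMap.one_apply, cosC_zero, sinC_zero, smul_eq_mul]
  ring

/-! #### Fixed points -/

variable (c) in
/-- The constants that are divided by do not vanish. -/
structure Nondeg : Prop where
  s : c.s ≠ 0
  m : c.m ≠ 0
  lam : c.lam ≠ 0
  a : c.a ≠ 0
  μ : c.μ ≠ 0
  amp : c.amp ≠ 0

variable (c z) in
/-- Fixed points of `Φ` at which `e`, `ω₁²` and `Ω²` do not vanish. -/
structure IsFixed : Prop where
  nondeg : c.Nondeg
  e : c.e z ≠ 0
  W : c.W z ≠ 0
  V : c.V z ≠ 0
  fixed : c.Φ z = z.2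

namespace IsFixed

theorem r_eq (H : c.IsFixed z) : z.2.1 = c.r z := by rw [← H.fixed]; rfl

theorem h_eq (H : c.IsFixed z) : z.2.2.1 = c.h z := by rw [← H.fixed]; rfl

theorem γ_eq (H : c.IsFixed z) : z.2.2.2.1 = c.γ z := by rw [← H.fixed]; rfl

theorem σ_eq (H : c.IsFixed z) : z.2.2.2.2 = c.σ z := by rw [← H.fixed]; rfl

theorem isEven_h (c : Reduced) (z : Unknowns) : IsEven (c.h z) :=
  (isEven_one.smul _).add ((isEven_primOdd _).smul _)

theorem isOdd_n (c : Reduced) (z : Unknowns) : IsOdd (c.n z) :=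
  ((isOdd_primEven _).smul _).add ((isOdd_primEven _).smul _)

theorem isOdd_q (c : Reduced) (z : Unknowns) : IsOdd (c.q z) :=
  (((isOdd_oscDeriv _).sub (isOdd_sinC.smul _)).smul _).sub (isOdd_sinC.smul _)

theorem isEven_p (H : c.IsFixed z) : IsEven (c.p z) := by
  rw [p, H.r_eq]
  exact (isEven_cosC.smul _).add (((isEven_osc _).add (isEven_cosC.smul _)).smul _)

theorem isEven_quad (H : c.IsFixed z) : IsEven (c.quad z) :=
  (isEven_h c z).sub ((H.isEven_p.mul H.isEven_p).smul _)

theorem isEven_g (H : c.IsFixed z) : IsEven (c.g z) :=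
  ((H.isEven_quad.smul _).add (H.isEven_p.smul _)).smul _

theorem avg_cosC_mul_p (c : Reduced) (z : Unknowns) :
    avg (cosC * c.p z) = c.amp / 2 + z.1 * avg (cosC * z.2.1) := by
  rw [p, mul_add, mul_smul_comm, mul_smul_comm, map_add, map_smul, map_smul, avg_cosC_sq,
    smul_eq_mul, smul_eq_mul]
  ring

/-- At a fixed point the old and the new γ coincide, and the defining formula of `γ` becomes the
solvability condition of the oscillator. -/
theorem avg_cosC_mul_g (H : c.IsFixed z) : avg (cosC * c.g z) = 0 := by
  have hamp := H.nondeg.amp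
  have h1 : c.γ z * avg (cosC * c.p z) + c.lam⁻¹ * avg (cosC * c.quad z) = 0 := by
    have h2 : c.γ z = -(2 / c.amp) * (z.1 * c.γ z * avg (cosC * z.2.1)
        + c.lam⁻¹ * avg (cosC * c.quad z)) := by
      conv_rhs => rw [← H.γ_eq]
      rfl
    rw [avg_cosC_mul_p]
    field_simp at h2 ⊢
    linear_combination h2
  rw [g, mul_smul_comm, mul_add, mul_smul_comm, mul_smul_comm, map_smul, map_add, map_smul,
    map_smul, smul_eq_mul, smul_eq_mul, smul_eq_mul]
  rw [add_comm, h1, mul_zero]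

theorem avg_r (H : c.IsFixed z) : avg z.2.1 = avg (c.g z) := by
  rw [H.r_eq, r, map_add, map_smul, avg_cosC, avg_osc H.isEven_g H.avg_cosC_mul_g, smul_zero,
    add_zero]

theorem avg_p (c : Reduced) (z : Unknowns) : avg (c.p z) = z.1 * avg z.2.1 := by
  simp [p]

theorem avg_h (c : Reduced) (z : Unknowns) : avg (c.h z) = c.hMean z := by
  simp [h, avg_primOdd]

theorem avg_quad (c : Reduced) (z : Unknowns) :
    avg (c.quad z) = c.hMean z - c.d * avg (c.p z * c.p z) := by
  rw [quad, map_sub, avg_h, map_smul, smul_eq_mul]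

/-- The mean value of the right-hand side of the equation for `n` vanishes. -/
theorem avg_rhs_n (H : c.IsFixed z) :
    z.1 * (c.lam / c.a) * avg (c.h z) + c.k z * avg (c.p z) = 0 := by
  have hl := H.nondeg.lam
  have ha := H.nondeg.a
  have he := H.e
  have hW := H.W
  have hV := H.V
  -- The average of r'' + r = g, multiplied by V.
  have h1 : avg z.2.1 * c.V z = c.lam⁻¹ * avg (c.quad z) + c.γ z * avg (c.p z) := by
    rw [H.avg_r, g, map_smul, map_add, map_smul, map_smul, smul_eq_mul, smul_eq_mul, smul_eq_mul]
    field_simp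
  rw [avg_p, Reduced.V, H.γ_eq] at h1
  -- Since avg p = ε avg r, the γ-terms cancel against V - W = εγ.
  have h2 : avg z.2.1 * (c.lam * c.W z) = avg (c.quad z) := by
    field_simp at h1
    linear_combination h1
  rw [avg_quad] at h2
  have h3 : c.hMean z * (c.lam * c.e z) = c.k z * c.d * c.a * avg (c.p z * c.p z) := by
    rw [hMean]
    field_simp
  have h4 : c.k z * c.a = c.lam * (c.e z - c.lam * c.W z) := by
    rw [k]; field_simp
  -- Eliminating avg r leaves hMean · (λ²W + ak) = a k d avg(p²). The relation ak = λ(e - λW) turns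
  -- the bracket into λe, which is the denominator in `hMean`.
  have h5 : (c.lam * c.W z) * (c.lam * c.hMean z + c.k z * c.a * avg z.2.1) = 0 := by
    linear_combination (c.k z * c.a) * h2 + h3 + c.hMean z * h4
  have h6 := (mul_eq_zero.mp h5).resolve_left (mul_ne_zero hl hW)
  rw [avg_h, avg_p]
  field_simp
  linear_combination z.1 * h6

theorem hasDerivAt_p (H : c.IsFixed z) (θ : ℝ) :
    HasDerivAt (fun θ : ℝ => c.p z (θ : AddCircle (2 * Real.pi)))
      (c.q z (θ : AddCircle (2 * Real.pi))) θ := by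
  have h1 := ((hasDerivAt_cosC θ).const_mul c.amp).add
    (((hasDerivAt_osc H.isEven_g H.avg_cosC_mul_g θ).add
      ((hasDerivAt_cosC θ).const_mul (c.κ z))).const_mul z.1)
  rw [p, H.r_eq]
  refine h1.congr_deriv ?_
  simp [q]
  ring

theorem hasDerivAt_q (H : c.IsFixed z) (θ : ℝ) :
    HasDerivAt (fun θ : ℝ => c.q z (θ : AddCircle (2 * Real.pi)))
      (z.1 / c.V z * (c.quad z (θ : AddCircle (2 * Real.pi)) / c.lam
        + c.γ z * c.p z (θ : AddCircle (2 * Real.pi))) - c.p z (θ : AddCircle (2 * Real.pi))) θ := by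
  have h1 := (((hasDerivAt_oscDeriv H.isEven_g H.avg_cosC_mul_g θ).sub
      ((hasDerivAt_sinC θ).const_mul (c.κ z))).const_mul z.1).sub
      ((hasDerivAt_sinC θ).const_mul c.amp)
  refine h1.congr_deriv ?_
  have h2 : c.p z (θ : AddCircle (2 * Real.pi)) = c.amp * Real.cos θ
      + z.1 * (osc (c.g z) (θ : AddCircle (2 * Real.pi)) + c.κ z * Real.cos θ) := by
    conv_lhs => rw [p, H.r_eq]
    simp [r]
    ring
  have h3 : c.g z (θ : AddCircle (2 * Real.pi)) = (c.V z)⁻¹ *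
      (c.quad z (θ : AddCircle (2 * Real.pi)) / c.lam
        + c.γ z * c.p z (θ : AddCircle (2 * Real.pi))) := by
    simp [g]
    ring
  rw [h3]
  linear_combination h2

theorem hasDerivAt_h (H : c.IsFixed z) (θ : ℝ) :
    HasDerivAt (fun θ : ℝ => c.h z (θ : AddCircle (2 * Real.pi)))
      ((c.V z)⁻¹ * (c.n z (θ : AddCircle (2 * Real.pi)) * c.p z (θ : AddCircle (2 * Real.pi)))) θ := by
  have h1 := ((((isOdd_n c z).mul_isEven H.isEven_p).hasDerivAt_primOdd θ).const_mul
    (c.V z)⁻¹).const_add (c.hMean z)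
  simpa [h] using h1

theorem hasDerivAt_n (H : c.IsFixed z) (θ : ℝ) :
    HasDerivAt (fun θ : ℝ => c.n z (θ : AddCircle (2 * Real.pi)))
      (z.1 * (c.lam / c.a) * c.h z (θ : AddCircle (2 * Real.pi))
        + c.k z * c.p z (θ : AddCircle (2 * Real.pi))) θ := by
  have h1 := (((isEven_h c z).hasDerivAt_primEven θ).const_mul (z.1 * (c.lam / c.a))).add
    ((H.isEven_p.hasDerivAt_primEven θ).const_mul (c.k z))
  rw [n, H.h_eq]
  refine h1.congr_deriv ?_
  -- `primEven` subtracts the mean of each summand; together these means are zero.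
  linear_combination -H.avg_rhs_n

/-- The normalization of the mean value of `z₂`. -/
theorem avg_normalized (H : c.IsFixed z) :
    2 * avg (cosC * c.p z) - z.1 / (c.lam * c.W z) * avg (cosC * c.h z) = c.amp := by
  -- The `osc` part of r is orthogonal to cos.
  have h1 : avg (cosC * z.2.1) = c.κ z / 2 := by
    rw [H.r_eq, r, mul_add, mul_smul_comm, map_add, map_smul, avg_cosC_sq, avg_cosC_mul_osc,
      smul_eq_mul]
    ring
  rw [avg_cosC_mul_p, h1, κ]
  ring

/-- The derivative of p sin has mean zero. -/
theorem avg_sinC_mul_q (H : c.IsFixed z) : avg (sinC * c.q z) = -avg (cosC * c.p z) := by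
  have : avg (cosC * c.p z + sinC * c.q z) = 0 :=
    avg_eq_zero_of_hasDerivAt (f := sinC * c.p z) fun θ =>
      (hasDerivAt_sinC θ).mul (H.hasDerivAt_p θ)
  rw [map_add] at this
  linarith

/-- The consistency condition at the point of symmetry. -/
theorem consistency_zero (H : c.IsFixed z) :
    c.s * c.σ z * (c.e z - z.1 * c.d * c.p z 0)
      = c.d * c.m / (2 * c.lam) * (c.h z 0 - c.d * c.p z 0 ^ 2) - c.s * c.d ^ 2 * c.p z 0 ^ 2 := by
  have hs := H.nondeg.s
  have hμ := H.nondeg.μ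
  have hm := H.nondeg.m
  have h1 : c.s * c.μ * c.σ z = c.d * c.m / (2 * c.lam) * (c.h z 0 - c.d * (c.p z 0 * c.p z 0))
      - c.s * c.d ^ 2 * (c.p z 0) ^ 2 + z.1 * c.s * c.d * c.σ z * c.p z 0
      - z.1 ^ 2 * c.σ z ^ 2 * c.s ^ 2 / c.m := by
    conv_lhs => rw [σ]
    rw [mul_inv_cancel_left₀ (mul_ne_zero hs hμ), H.σ_eq]
    rfl
  rw [Reduced.e, H.σ_eq]
  linear_combination h1

end IsFixed

/-- The branch of fixed points. -/
theorem exists_branch (hc : c.Nondeg) :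
    ∃ u : ℝ → PerFun × PerFun × ℝ × ℝ, ∀ᶠ ε in nhds (0 : ℝ),
      ContinuousAt u ε ∧ c.Φ (ε, u ε) = u ε := by
  have hW : c.W (0, c.Φ (0, 0)) ≠ 0 := by
    rw [W_zero]
    have := hc.s
    have := hc.m
    have := hc.μ
    simp [*]
  have hV : c.V (0, c.Φ (0, 0)) ≠ 0 := by
    rwa [V_zero, ← W_zero (c.Φ (0, 0))]
  have he : c.e (0, c.Φ (0, 0)) ≠ 0 := by
    rw [e_zero]
    exact hc.μ
  obtain ⟨u, -, hu⟩ := exists_fixedPoint_branch (contDiffAt_Φ hc.lam he hV hW) Φ_zero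
  exact ⟨u, hu⟩

end Reduced
end
end CGL

namespace CGL
noncomputable section

/-! ### Coefficients near `ω = μβ` -/

theorem beta_sub_alpha_ne_zero {α β : ℝ} (h : 1 + α * β < 0) : β - α ≠ 0 := by
  intro h0
  have : β = α := by linarith
  subst this
  nlinarith [sq_nonneg β]

theorem one_add_sq_pos (α : ℝ) : 0 < 1 + α ^ 2 := by positivity

theorem coefA_eq (α β : ℝ) : coefA α β = (1 + α ^ 2) ^ 2 * coefD α β / 4 := by
  unfold coefA coefD
  generalize β - α = D
  ring

theorem coefD_ne_zero {α β : ℝ} (h : β - α ≠ 0) : coefD α β ≠ 0 := one_div_ne_zero h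

theorem coefA_ne_zero {α β : ℝ} (h : β - α ≠ 0) : coefA α β ≠ 0 := by
  rw [coefA_eq]
  have := coefD_ne_zero h
  have := (one_add_sq_pos α).ne'
  positivity

theorem coefC_eq (α β : ℝ) :
    coefC α β = -(3 / 2) * (1 + α * β) * (1 + α ^ 2) * coefD α β ^ 2 := by
  unfold coefC coefD
  generalize β - α = D
  ring

theorem coefB_eq (μ α β ω : ℝ) : coefB μ α β ω = (1 + α ^ 2) / 2 * coefD α β *
    (2 * (α * ω + μ) - 3 * (1 + α * β) * coefE μ α β ω) := by
  unfold coefB coefD coefE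
  generalize β - α = D
  ring

theorem root_ne_zero {α β lam : ℝ} (h : β - α ≠ 0)
    (hlam : lam ^ 2 + coefC α β * lam - 2 * coefA α β * coefD α β = 0) : lam ≠ 0 := by
  rintro rfl
  have h1 := coefD_ne_zero h
  have h2 := coefA_ne_zero h
  have : coefA α β * coefD α β = 0 := by linarith
  simp_all

/-- The quadratic equation for `lam` without denominators. -/
theorem root_sq {α β lam : ℝ}
    (hlam : lam ^ 2 + coefC α β * lam - 2 * coefA α β * coefD α β = 0) :
    lam ^ 2 = 3 / 2 * (1 + α * β) * (1 + α ^ 2) * coefD α β ^ 2 * lam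
      + (1 + α ^ 2) ^ 2 * coefD α β ^ 2 / 2 := by
  rw [coefC_eq, coefA_eq] at hlam
  linear_combination hlam

theorem eTilde_eq {α β : ℝ} (h : β - α ≠ 0) (μ lam ω : ℝ) :
    eTilde μ α β lam ω = lam * (2 / (1 + α ^ 2)
      * (2 * (α * ω + μ) - 3 * (1 + α * β) * coefE μ α β ω)) := by
  have h1 := coefD_ne_zero h
  have h2 := (one_add_sq_pos α).ne'
  rw [eTilde, coefB_eq, coefA_eq]
  field_simp
  ring

/-- The carrier frequency at distance `δ` from the bifurcation point, in the normalization of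
`carrierFreq`. -/
def freq (μ α β δ : ℝ) : ℝ := μ * β + δ * ((1 + α * β) * (β - α) / (1 + α ^ 2))

theorem carrierFreq_eq_freq (μ α β ρ a₂₂ ω₃ : ℝ) :
    carrierFreq μ α β ρ a₂₂ ω₃ = freq μ α β (ρ ^ 4 * (ω₃ - coefD α β * a₂₂)) := rfl

theorem freq_zero (μ α β : ℝ) : freq μ α β 0 = μ * β := by simp [freq]

theorem coefE_freq {α β : ℝ} (h : β - α ≠ 0) (μ δ : ℝ) :
    coefE μ α β (freq μ α β δ) = μ + δ * ((1 + α * β) / (1 + α ^ 2)) := by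
  have h2 := (one_add_sq_pos α).ne'
  unfold coefE freq
  field_simp
  ring

/-- The parametrization `freq` is chosen so that δ is exactly e - (αω+μ)/(1+αβ); this is the form in
which the frequency enters M. -/
theorem alpha_mul_freq_add {α β : ℝ} (h : β - α ≠ 0) (μ δ : ℝ) :
    α * freq μ α β δ + μ = (1 + α * β) * (coefE μ α β (freq μ α β δ) - δ) := by
  have h2 := (one_add_sq_pos α).ne'
  rw [coefE_freq h]
  unfold freq
  field_simp
  ring

theorem eTilde_freq {α β : ℝ} (h : β - α ≠ 0) (μ lam δ : ℝ) :
    eTilde μ α β lam (freq μ α β δ) = lam * (-(2 * (1 + α * β) / (1 + α ^ 2))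
      * (coefE μ α β (freq μ α β δ) + 2 * δ)) := by
  rw [eTilde_eq h, alpha_mul_freq_add h]
  ring

theorem coefE_base {α β : ℝ} (h : β - α ≠ 0) (μ : ℝ) : coefE μ α β (μ * β) = μ := by
  rw [← freq_zero μ α β, coefE_freq h]
  simp

theorem eTilde_base {α β : ℝ} (h : β - α ≠ 0) (μ lam : ℝ) :
    eTilde μ α β lam (μ * β) = lam * (-(2 * (1 + α * β) / (1 + α ^ 2)) * μ) := by
  rw [← freq_zero μ α β, eTilde_freq h, coefE_freq h]
  simp

theorem base_freq_sq_pos {μ α β : ℝ} (hμ : 0 < μ) (h : 1 + α * β < 0) :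
    0 < -(2 * (1 + α * β) / (1 + α ^ 2)) * μ := by
  have h2 := one_add_sq_pos α
  have : 0 < -(1 + α * β) / (1 + α ^ 2) := div_pos (by linarith) h2
  have h3 : -(2 * (1 + α * β) / (1 + α ^ 2)) * μ = 2 * (-(1 + α * β) / (1 + α ^ 2)) * μ := by ring
  rw [h3]
  positivity

/-- The function `M` in the scaled variables. -/
theorem bigM_freq {α β lam : ℝ} (h : β - α ≠ 0) (hl : lam ≠ 0) (μ ε σ hh p : ℝ)
    (Y : Fin 4 → ℝ) (h0 : Y 0 = ε ^ 2 * hh) (h2 : Y 2 = ε * p) :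
    bigM μ α β lam (freq μ α β (ε ^ 2 * σ)) Y =
      ε ^ 2 * ((coefD α β * (ε * p) + coefE μ α β (freq μ α β (ε ^ 2 * σ)))
        * (coefD α β * (1 + α ^ 2) / (2 * lam) * (hh - coefD α β * p ^ 2)
          - (1 + α * β) * coefD α β ^ 2 * p ^ 2 + (1 + α * β) * ε * coefD α β * σ * p
          - (1 + α * β) * coefE μ α β (freq μ α β (ε ^ 2 * σ)) * σ))
      - coefD α β ^ 2 * (1 + α ^ 2) / 4 * Y 3 ^ 2 := by
  have hm := (one_add_sq_pos α).ne'
  have h3 : (1 + α ^ 2) / (2 * lam) * eTilde μ α β lam (freq μ α β (ε ^ 2 * σ))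
      = -(1 + α * β) * (coefE μ α β (freq μ α β (ε ^ 2 * σ)) + 2 * (ε ^ 2 * σ)) := by
    rw [eTilde_freq h]
    field_simp
  have h4 := alpha_mul_freq_add h μ (ε ^ 2 * σ)
  rw [bigM, h0, h2]
  set e := coefE μ α β (freq μ α β (ε ^ 2 * σ))
  -- With ẽ and αω + μ expressed through e and δ = ε²σ, all terms other than the Q² term share the
  -- factor R² = dP + e, and in the cofactor everything of order below ε² cancels.
  linear_combination (-(coefD α β) * (coefD α β * (ε * p) + e) * ε * p) * h3
    + (coefD α β * (ε * p) + e) ^ 2 * h4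

/-! ### The linear part -/

/-- On the kernel Q = 0 and M̃ = ẽP. The second row then reads (λ/a) e P = 0, because (λ/a) ẽ + k =
(λ/a) e; hence P = 0 and only the Ñ-axis remains. -/
theorem finrank_eigenspace_linPart {μ α β lam ω : ℝ} (hl : lam ≠ 0) (ha : coefA α β ≠ 0)
    (he : coefE μ α β ω ≠ 0) :
    Module.finrank ℝ (Module.End.eigenspace (Matrix.toLin' (linPart μ α β lam ω)) 0) = 1 := by
  have h1 : Module.End.eigenspace (Matrix.toLin' (linPart μ α β lam ω)) 0
      = Submodule.span ℝ {(Pi.single 1 1 : Fin 4 → ℝ)} := by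
    ext v
    rw [Module.End.mem_eigenspace_iff, zero_smul, Matrix.toLin'_apply,
      Submodule.mem_span_singleton]
    constructor
    · intro hv
      have hv1 := congrFun hv 1
      have hv2 := congrFun hv 2
      have hv3 := congrFun hv 3
      simp [linPart, Matrix.mulVec, dotProduct, Fin.sum_univ_four] at hv1 hv2 hv3
      have hv0 : v 0 = eTilde μ α β lam ω * v 2 := by
        field_simp at hv3
        linarith
      have hv4 : v 2 = 0 := by
        rw [hv0, coefK] at hv1
        have : lam * coefE μ α β ω * v 2 = 0 := by
          field_simp at hv1
          linear_combination hv1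
        have hne := mul_ne_zero hl he
        exact (mul_eq_zero.mp this).resolve_left hne
      refine ⟨v 1, ?_⟩
      ext i
      fin_cases i <;> simp [hv2, hv4, hv0]
    · rintro ⟨t, rfl⟩
      ext i
      fin_cases i <;> simp [linPart, Matrix.mulVec, dotProduct, Fin.sum_univ_four]
  rw [h1, finrank_span_singleton]
  intro h
  simpa using congrFun h 1

theorem charpoly_linPart (μ α β lam ω : ℝ) :
    (linPart μ α β lam ω).charpoly =
      Polynomial.X ^ 2 * (Polynomial.X ^ 2 + Polynomial.C (eTilde μ α β lam ω / lam)) := by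
  simp [Matrix.charpoly, Matrix.charmatrix, linPart, Matrix.det_succ_row_zero, Fin.sum_univ_succ,
    Fin.succAbove, neg_div]
  ring

/-! ### Means of trigonometric polynomials -/

theorem mean_comp_mul {Ω : ℝ} (hΩ : 0 < Ω) (f : PerFun) :
    mean (2 * Real.pi / Ω) (fun τ => f ((Ω * τ : ℝ) : AddCircle (2 * Real.pi)))
      = PerFun.avg f := by
  have hpi := Real.pi_pos
  rw [mean, intervalIntegral.integral_comp_mul_left
    (fun θ : ℝ => f (θ : AddCircle (2 * Real.pi))) hΩ.ne', mul_zero,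
    mul_div_cancel₀ _ hΩ.ne', PerFun.integral_eq_avg, smul_eq_mul]
  field_simp

/-- These six monomials are all that occur when the determining functions are evaluated on the
starting vector. -/
theorem mean_trig {Ω : ℝ} (hΩ : 0 < Ω) (c₀ c₁ c₂ c₃ c₄ c₅ : ℝ) :
    mean (2 * Real.pi / Ω) (fun τ => c₀ + c₁ * Real.cos (Ω * τ) + c₂ * Real.cos (Ω * τ) ^ 2
      + c₃ * Real.cos (Ω * τ) ^ 3 + c₄ * Real.sin (Ω * τ) ^ 2
      + c₅ * (Real.sin (Ω * τ) ^ 2 * Real.cos (Ω * τ))) = c₀ + c₂ / 2 + c₄ / 2 := by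
  have h := mean_comp_mul hΩ (c₀ • (1 : PerFun) + c₁ • PerFun.cosC
    + c₂ • (PerFun.cosC * PerFun.cosC) + c₃ • (PerFun.cosC * PerFun.cosC * PerFun.cosC)
    + c₄ • (PerFun.sinC * PerFun.sinC) + c₅ • (PerFun.sinC * PerFun.sinC * PerFun.cosC))
  simp only [map_add, map_smul, PerFun.avg_one, PerFun.avg_cosC, PerFun.avg_cosC_sq,
    PerFun.avg_cosC_cube, PerFun.avg_sinC_sq, PerFun.avg_sinC_sq_mul_cosC, smul_eq_mul] at h
  rw [show c₀ + c₂ / 2 + c₄ / 2 = c₀ * 1 + c₁ * 0 + c₂ * (1 / 2) + c₃ * 0 + c₄ * (1 / 2)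
    + c₅ * 0 by ring, ← h]
  congr 1
  funext τ
  simp only [ContinuousMap.add_apply, ContinuousMap.smul_apply, ContinuousMap.mul_apply,
    ContinuousMap.one_apply, PerFun.cosC_coe, PerFun.sinC_coe, smul_eq_mul]
  ring

end
end CGL

namespace CGL
noncomputable section

/-! ### The determining equations -/

/-- The diagonal of the (affine) determining map. -/
def determiningDiag (μ α β lam : ℝ) : Fin 3 → ℝ :=
  ![lam * coefE μ α β (μ * β) / coefA α β, 1, 4 * (1 + α * β) ^ 2 * lam * μ]

/-- The constant term of the determining map. -/
def determiningConst (μ α β lam a₄ : ℝ) : Fin 3 → ℝ :=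
  ![-(coefK μ α β lam (μ * β) * coefD α β * a₄ ^ 2 / (2 * eTilde μ α β lam (μ * β))), 0,
    a₄ ^ 2 * (-lam + coefD α β ^ 2 * (1 + α * β) * (1 + α ^ 2 + lam + lam * α * β))]

/-- Because the linear part is diagonal, the Jacobian is a product of three entries and the
equations are solved one component at a time. -/
theorem determiningMap_eq (μ α β lam a₄ : ℝ) : determiningMap μ α β lam a₄ = fun p =>
    Matrix.toLin' (Matrix.diagonal (determiningDiag μ α β lam)) p
      + determiningConst μ α β lam a₄ := by
  funext p i
  fin_cases i <;>
    simp [determiningMap, determiningDiag, determiningConst, Matrix.mulVec_diagonal] <;> ring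

theorem hasFDerivAt_determiningMap (μ α β lam a₄ : ℝ) (p : Fin 3 → ℝ) :
    HasFDerivAt (determiningMap μ α β lam a₄)
      (LinearMap.toContinuousLinearMap
        (Matrix.toLin' (Matrix.diagonal (determiningDiag μ α β lam)))) p := by
  rw [determiningMap_eq]
  exact (LinearMap.toContinuousLinearMap
    (Matrix.toLin' (Matrix.diagonal (determiningDiag μ α β lam)))).hasFDerivAt.add_const _

theorem det_fderiv_determiningMap (μ α β lam a₄ : ℝ) (p : Fin 3 → ℝ) :
    (fderiv ℝ (determiningMap μ α β lam a₄) p).det =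
      4 * (1 + α * β) ^ 2 * lam ^ 2 * μ * coefE μ α β (μ * β) / coefA α β := by
  rw [(hasFDerivAt_determiningMap μ α β lam a₄ p).fderiv, ContinuousLinearMap.det,
    LinearMap.coe_toContinuousLinearMap, LinearMap.det_toLin', Matrix.det_diagonal,
    Fin.prod_univ_three]
  simp [determiningDiag]
  ring

theorem existsUnique_determiningMap {μ α β lam : ℝ} (a₄ : ℝ)
    (h : ∀ i, determiningDiag μ α β lam i ≠ 0) :
    ∃! p : Fin 3 → ℝ, determiningMap μ α β lam a₄ p = 0 := by
  have key : ∀ p, determiningMap μ α β lam a₄ p = 0 ↔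
      ∀ i, p i = -determiningConst μ α β lam a₄ i / determiningDiag μ α β lam i := by
    intro p
    rw [determiningMap_eq, funext_iff]
    refine forall_congr' fun i => ?_
    have := h i
    simp only [Matrix.toLin'_apply, Pi.add_apply, Matrix.mulVec_diagonal, Pi.zero_apply]
    rw [eq_div_iff this, mul_comm (p i), eq_neg_iff_add_eq_zero]
  refine ⟨fun i => -determiningConst μ α β lam a₄ i / determiningDiag μ α β lam i,
    (key _).mpr fun _ => rfl, fun p hp => funext ((key p).mp hp)⟩

/-! ### The starting map -/

section Starting

variable {μ α β lam : ℝ}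

theorem physical_eq (ω ρ Ω τ : ℝ) (v : Fin 4 → ℝ) :
    physical μ α β lam ω ρ Ω τ v =
      ![ρ ^ 2 * (eTilde μ α β lam ω * (ρ * v 1)),
        ρ ^ 2 * (v 0 - coefK μ α β lam ω * (lam / eTilde μ α β lam ω)
          * (Ω * v 2 * Real.cos (Ω * τ) - Ω * v 3 * Real.sin (Ω * τ))),
        ρ ^ 2 * (ρ * v 1 + (v 2 * Real.sin (Ω * τ) + v 3 * Real.cos (Ω * τ))),
        ρ ^ 2 * (Ω * v 2 * Real.cos (Ω * τ) - Ω * v 3 * Real.sin (Ω * τ))] := by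
  funext i
  fin_cases i <;> simp [physical, changeD, rotate] <;> ring_nf <;> tauto

/-- On the starting vector z = ρ²a + a₄ cos Ωτ, z̃ = a₄ cos Ωτ, and y is a multiple of sin Ωτ, so
the integrand has the form treated in `mean_trig`. -/
theorem mean_rescaledVF_zero {Ω : ℝ} (hΩ : 0 < Ω) (a₄ ω ρ γ a : ℝ) :
    mean (2 * Real.pi / Ω) (fun τ => rescaledVF μ α β lam ω ρ γ Ω τ ![0, ρ * a, 0, a₄] 0)
      = ρ ^ 2 * (a * (lam * coefE μ α β ω / coefA α β)
        - coefK μ α β lam ω * (coefD α β / eTilde μ α β lam ω)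
          * (ρ ^ 4 * a ^ 2 + a₄ ^ 2 / 2)) := by
  have h := mean_trig hΩ (ρ ^ 2 * (a * (lam * coefE μ α β ω / coefA α β))
      - ρ ^ 2 * coefK μ α β lam ω * (coefD α β / eTilde μ α β lam ω) * (ρ ^ 2 * a) ^ 2)
    (-(ρ ^ 2 * coefK μ α β lam ω * (coefD α β / eTilde μ α β lam ω)) * (2 * (ρ ^ 2 * a) * a₄))
    (-(ρ ^ 2 * coefK μ α β lam ω * (coefD α β / eTilde μ α β lam ω)) * a₄ ^ 2) 0 0 0
  refine Eq.trans (congrArg _ ?_) (h.trans ?_)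
  · funext τ
    simp [rescaledVF]
    ring
  · ring

theorem mean_rescaledVF_two {Ω : ℝ} (hΩ : 0 < Ω) (a₄ ω ρ γ a : ℝ) :
    mean (2 * Real.pi / Ω) (fun τ => rescaledVF μ α β lam ω ρ γ Ω τ ![0, ρ * a, 0, a₄] 2)
      = ρ ^ 2 / Ω * (a₄ / 2) * (γ - ρ ^ 2 * (2 * coefD α β / lam * a
        + Ω ^ 2 * lam * coefK μ α β lam ω / eTilde μ α β lam ω ^ 2 * a)) := by
  have h := mean_trig hΩ 0 (-(ρ ^ 2 / Ω * coefD α β / lam * (ρ ^ 2 * a) ^ 2))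
    (ρ ^ 2 / Ω * (γ * a₄ - coefD α β / lam * (2 * ρ ^ 2 * a * a₄)))
    (-(ρ ^ 2 / Ω * coefD α β / lam * a₄ ^ 2))
    (-(ρ ^ 2 / Ω * (Ω / eTilde μ α β lam ω * coefK μ α β lam ω
      * (Ω * lam / eTilde μ α β lam ω) * a₄ * (ρ ^ 2 * a))))
    (-(ρ ^ 2 / Ω * (Ω / eTilde μ α β lam ω * coefK μ α β lam ω
      * (Ω * lam / eTilde μ α β lam ω) * a₄ * a₄)))
  refine Eq.trans (congrArg _ ?_) (h.trans ?_)
  · funext τ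
    simp [rescaledVF]
    ring
  · ring

/-- The mean of the defect on the starting vector, divided by `ρ⁴`; here `e`, `V = Ω²` and
`W = ω₁²`. -/
def defectMean (α β lam a₄ ε a σ e V W : ℝ) : ℝ :=
  let s := 1 + α * β
  let m := 1 + α ^ 2
  let d := coefD α β
  let b₀ := d * m / (2 * lam) * (lam * W * a) - s * e * σ
  let b₁ := s * ε * d * σ
  let b₂ := d * m / (2 * lam) * d + s * d ^ 2
  let q := ε * a
  m * (e * b₀ + (e * b₁ + d * ε * b₀) * q + (d * ε * b₁ - e * b₂) * q ^ 2 - d * ε * b₂ * q ^ 3)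
    + m * a₄ ^ 2 * ((d * ε * b₁ - e * b₂) - 3 * q * (d * ε * b₂)) / 2
    + (-(m * (d ^ 2 * m / 4 * V * a₄ ^ 2)) - a₄ ^ 2 * V * e ^ 2 / W ^ 2) / 2

/-- With p = q + a₄ cos Ωτ the cofactor in `bigM_freq` is b₀ + b₁p - b₂p² and R² = e + dρ²p. Their
product is a cubic in cos; the momentum and the Q² term contribute multiples of sin². -/
theorem mean_defect (h : β - α ≠ 0) (hl : lam ≠ 0) {Ω : ℝ} (hΩ : 0 < Ω) (a₄ ρ a σ W : ℝ)
    (hW : W ≠ 0) (het : eTilde μ α β lam (freq μ α β (ρ ^ 4 * σ)) = lam * W) :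
    mean (2 * Real.pi / Ω) (fun τ => consistencyDefect μ α β lam (freq μ α β (ρ ^ 4 * σ))
        (physical μ α β lam (freq μ α β (ρ ^ 4 * σ)) ρ Ω τ ![0, ρ * a, 0, a₄]))
      = ρ ^ 4 * defectMean α β lam a₄ (ρ ^ 2) a σ (coefE μ α β (freq μ α β (ρ ^ 4 * σ)))
          (Ω ^ 2) W := by
  have hA := coefA_ne_zero h
  set ω := freq μ α β (ρ ^ 4 * σ) with hω
  set e := coefE μ α β ω with he
  set s := 1 + α * β with hs
  set m := 1 + α ^ 2 with hm
  set d := coefD α β with hd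
  set b₀ := d * m / (2 * lam) * (lam * W * a) - s * e * σ with hb₀
  set b₁ := s * ρ ^ 2 * d * σ with hb₁
  set b₂ := d * m / (2 * lam) * d + s * d ^ 2 with hb₂
  set q := ρ ^ 2 * a with hq
  have hmean := mean_trig hΩ
    (ρ ^ 4 * (m * (e * b₀ + (e * b₁ + d * ρ ^ 2 * b₀) * q + (d * ρ ^ 2 * b₁ - e * b₂) * q ^ 2
      - d * ρ ^ 2 * b₂ * q ^ 3)))
    (ρ ^ 4 * (m * a₄ * ((e * b₁ + d * ρ ^ 2 * b₀) + 2 * q * (d * ρ ^ 2 * b₁ - e * b₂)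
      - 3 * q ^ 2 * (d * ρ ^ 2 * b₂))))
    (ρ ^ 4 * (m * a₄ ^ 2 * ((d * ρ ^ 2 * b₁ - e * b₂) - 3 * q * (d * ρ ^ 2 * b₂))))
    (ρ ^ 4 * (-(m * a₄ ^ 3 * (d * ρ ^ 2 * b₂))))
    (ρ ^ 4 * (-(m * (d ^ 2 * m / 4 * Ω ^ 2 * a₄ ^ 2)) - a₄ ^ 2 * Ω ^ 2 * e ^ 2 / W ^ 2)) 0
  refine Eq.trans (congrArg _ ?_) (hmean.trans ?_)
  · funext τ
    set Y := physical μ α β lam ω ρ Ω τ ![0, ρ * a, 0, a₄] with hY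
    have hY0 : Y 0 = (ρ ^ 2) ^ 2 * (lam * W * a) := by
      simp [hY, physical_eq, het]
      ring
    have hY1 : Y 1 = ρ ^ 2 * (coefK μ α β lam ω * (lam / (lam * W))
        * (Ω * a₄ * Real.sin (Ω * τ))) := by
      simp [hY, physical_eq, het]
    have hY2 : Y 2 = ρ ^ 2 * (q + a₄ * Real.cos (Ω * τ)) := by
      rw [hY, physical_eq, hq]
      simp only [Matrix.cons_val]
      ring
    have hY3 : Y 3 = -(ρ ^ 2 * (Ω * a₄ * Real.sin (Ω * τ))) := by
      simp [hY, physical_eq]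
    -- The definition of k makes the λ-contributions of Ñ and Q cancel, leaving the ratio e/W.
    have hG : coefA α β / lam * Y 1 - lam * Y 3
        = ρ ^ 2 * (a₄ * Ω * e / W * Real.sin (Ω * τ)) := by
      rw [hY1, hY3, coefK, het]
      field_simp
      ring
    have hMM := bigM_freq h hl μ (ρ ^ 2) σ (lam * W * a) (q + a₄ * Real.cos (Ω * τ)) Y hY0 hY2
    rw [← pow_mul, show 2 * 2 = 4 from rfl, ← hω] at hMM
    rw [consistencyDefect, hG, hMM, hY3]
    rw [← hs, ← hm, ← hd, ← he]
    rw [hb₀, hb₁, hb₂]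
    ring
  · simp only [defectMean]
    rw [hb₀, hb₁, hb₂, hq]
    ring

/-- For small ρ ≠ 0 the normalizing powers of ρ cancel and the map equals an explicit `T` that is
continuous at 0. The neighbourhood is punctured because these inverse powers take a junk value at ρ
= 0. -/
theorem tendsto_startingMap (hμ : 0 < μ) (hs : 1 + α * β < 0) (hl : lam ≠ 0) {a₄ : ℝ}
    (ha₄ : a₄ ≠ 0) (p : Fin 3 → ℝ) :
    Filter.Tendsto (fun ρ => startingMap μ α β lam a₄ ρ p)
      (nhdsWithin 0 {0}ᶜ) (nhds (determiningMap μ α β lam a₄ p)) := by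
  have h := beta_sub_alpha_ne_zero hs
  have hA := coefA_ne_zero h
  have hm := one_add_sq_pos α
  set σ := p 2 - coefD α β * p 0 with hσ
  set w : ℝ → ℝ := fun ρ => freq μ α β (ρ ^ 4 * σ) with hw
  set e : ℝ → ℝ := fun ρ => coefE μ α β (w ρ) with he
  set W : ℝ → ℝ := fun ρ => -(2 * (1 + α * β) / (1 + α ^ 2)) * (e ρ + 2 * (ρ ^ 4 * σ)) with hW
  set V : ℝ → ℝ := fun ρ => W ρ + ρ ^ 2 * p 1 with hV
  have hec : Continuous e := by
    have : e = fun ρ => μ + ρ ^ 4 * σ * ((1 + α * β) / (1 + α ^ 2)) :=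
      funext fun ρ => coefE_freq h μ _
    rw [this]
    fun_prop
  have hWc : Continuous W := by fun_prop
  have hVc : Continuous V := by fun_prop
  have het : ∀ ρ, eTilde μ α β lam (w ρ) = lam * W ρ := fun ρ => eTilde_freq h μ lam _
  have he0 : e 0 = μ := by simp [he, hw, coefE_freq h]
  have hW0 : W 0 = -(2 * (1 + α * β) / (1 + α ^ 2)) * μ := by simp [hW, he0]
  have hV0 : V 0 = W 0 := by simp [hV]
  have hWpos : 0 < W 0 := by rw [hW0]; exact base_freq_sq_pos hμ hs
  have hk : ∀ ρ, coefK μ α β lam (w ρ) = lam / coefA α β * (e ρ - lam * W ρ) := fun ρ => by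
    rw [coefK, het]
  have evW : ∀ᶠ ρ in nhds (0 : ℝ), 0 < W ρ := hWc.continuousAt.eventually_const_lt hWpos
  have evV : ∀ᶠ ρ in nhds (0 : ℝ), 0 < V ρ :=
    hVc.continuousAt.eventually_const_lt (by rw [hV0]; exact hWpos)
  set T : ℝ → Fin 3 → ℝ := fun ρ =>
    ![p 0 * (lam * e ρ / coefA α β) - lam / coefA α β * (e ρ - lam * W ρ)
        * (coefD α β / (lam * W ρ)) * (ρ ^ 4 * p 0 ^ 2 + a₄ ^ 2 / 2),
      p 1 - ρ ^ 2 * (2 * coefD α β / lam * p 0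
        + V ρ * lam * (lam / coefA α β * (e ρ - lam * W ρ)) / (lam * W ρ) ^ 2 * p 0),
      -(4 * (1 + α * β) * lam / ((1 + α ^ 2) * μ))
        * defectMean α β lam a₄ (ρ ^ 2) (p 0) σ (e ρ) (V ρ) (W ρ)] with hT
  have hTeq : ∀ᶠ ρ in nhdsWithin (0 : ℝ) {0}ᶜ, T ρ = startingMap μ α β lam a₄ ρ p := by
    filter_upwards [self_mem_nhdsWithin, mem_nhdsWithin_of_mem_nhds evW,
      mem_nhdsWithin_of_mem_nhds evV] with ρ hρ hWρ hVρ
    have hρ : ρ ≠ 0 := hρ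
    have hww : carrierFreq μ α β ρ (p 0) (p 2) = w ρ := rfl
    have hsq : eTilde μ α β lam (w ρ) / lam + ρ ^ 2 * p 1 = V ρ := by
      rw [het, mul_div_cancel_left₀ _ hl]
    have hΩ : 0 < spatialFreq μ α β lam (w ρ) ρ (p 1) := by
      rw [spatialFreq, hsq]
      exact Real.sqrt_pos.mpr hVρ
    have hΩsq : spatialFreq μ α β lam (w ρ) ρ (p 1) ^ 2 = V ρ := by
      rw [spatialFreq, hsq, Real.sq_sqrt hVρ.le]
    unfold startingMap
    simp only [hww]
    rw [mean_rescaledVF_zero hΩ, mean_rescaledVF_two hΩ]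
    rw [mean_defect h hl hΩ a₄ ρ (p 0) σ (W ρ) hWρ.ne' (het ρ), hΩsq, hk, het]
    have h1 : coefE μ α β (w ρ) = e ρ := rfl
    have hΩ' := hΩ.ne'
    funext i
    fin_cases i
    · simp only [hT, Fin.zero_eta, Matrix.cons_val_zero, h1]
      field_simp
    · simp only [hT, Fin.mk_one, Matrix.cons_val_one, Matrix.cons_val_zero]
      rw [div_mul_eq_mul_div, div_mul_eq_mul_div]
      field_simp
    · simp only [hT, Fin.reduceFinMk, Matrix.cons_val]
      field_simp
      rfl
  refine Filter.Tendsto.congr' hTeq ?_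
  have hT0 : T 0 = determiningMap μ α β lam a₄ p := by
    have hss : 1 + α * β ≠ 0 := hs.ne
    have hm' := hm.ne'
    funext i
    fin_cases i
    · simp [hT, determiningMap, he0, coefK, coefE_base h, eTilde_base h, hW0]
      field_simp
    · simp [hT, determiningMap]
    · simp [hT, determiningMap, he0, hV0, hW0, defectMean, hσ]
      field_simp
      ring
  rw [← hT0]
  refine Filter.Tendsto.mono_left ?_ nhdsWithin_le_nhds
  have hne : lam * W 0 ≠ 0 := mul_ne_zero hl hWpos.ne'
  have hec' := hec.continuousAt (x := 0)
  have hWc' := hWc.continuousAt (x := 0)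
  have hVc' := hVc.continuousAt (x := 0)
  refine tendsto_pi_nhds.mpr fun i => ?_
  fin_cases i
  · change ContinuousAt (fun ρ => p 0 * (lam * e ρ / coefA α β)
      - lam / coefA α β * (e ρ - lam * W ρ)
        * (coefD α β / (lam * W ρ)) * (ρ ^ 4 * p 0 ^ 2 + a₄ ^ 2 / 2)) 0
    fun_prop (disch := assumption)
  · change ContinuousAt (fun ρ => p 1 - ρ ^ 2 * (2 * coefD α β / lam * p 0
        + V ρ * lam * (lam / coefA α β * (e ρ - lam * W ρ)) / (lam * W ρ) ^ 2 * p 0)) 0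
    fun_prop (disch := exact pow_ne_zero 2 hne)
  · change ContinuousAt (fun ρ => -(4 * (1 + α * β) * lam / ((1 + α ^ 2) * μ))
        * defectMean α β lam a₄ (ρ ^ 2) (p 0) σ (e ρ) (V ρ) (W ρ)) 0
    simp only [defectMean]
    fun_prop (disch := exact pow_ne_zero 2 hWpos.ne')

end Starting
end
end CGL

namespace CGL
noncomputable section

/-! ### From the 4-D system to the CGLe -/

/-- Solutions of a smooth autonomous differential equation are smooth. -/
theorem contDiff_of_hasDerivAt_autonomous {E : Type*} [NormedAddCommGroup E] [NormedSpace ℝ E]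
    {F : E → E} (hF : ContDiff ℝ ((⊤ : ℕ∞) : WithTop ℕ∞) F) {Y : ℝ → E}
    (hY : ∀ t, HasDerivAt Y (F (Y t)) t) : ContDiff ℝ ((⊤ : ℕ∞) : WithTop ℕ∞) Y := by
  have hd : deriv Y = fun t => F (Y t) := funext fun t => (hY t).deriv
  rw [contDiff_infty]
  intro n
  induction n with
  | zero =>
    exact contDiff_zero.mpr (continuous_iff_continuousAt.mpr fun t => (hY t).continuousAt)
  | succ n ih =>
    push_cast
    rw [contDiff_succ_iff_deriv]
    refine ⟨fun t => (hY t).differentiableAt, by simp, ?_⟩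
    rw [hd]
    exact (contDiff_infty.mp hF n).comp ih

theorem contDiff_vf4 (μ α β lam ω : ℝ) :
    ContDiff ℝ ((⊤ : ℕ∞) : WithTop ℕ∞) (vf4 μ α β lam ω) := by
  refine contDiff_pi.mpr fun i => ?_
  fin_cases i <;> simp [vf4] <;> fun_prop

section System

variable {μ α β lam ω : ℝ} {Y : ℝ → Fin 4 → ℝ}

theorem hasDerivAt_comp_zero (hY : ∀ τ, HasDerivAt Y (vf4 μ α β lam ω (Y τ)) τ) (τ : ℝ) :
    HasDerivAt (fun τ => Y τ 0) (Y τ 1 * Y τ 2) τ :=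
  hasDerivAt_pi.mp (hY τ) 0

theorem hasDerivAt_comp_one (hY : ∀ τ, HasDerivAt Y (vf4 μ α β lam ω (Y τ)) τ) (τ : ℝ) :
    HasDerivAt (fun τ => Y τ 1) (lam / coefA α β * Y τ 0 + coefK μ α β lam ω * Y τ 2) τ :=
  hasDerivAt_pi.mp (hY τ) 1

theorem hasDerivAt_comp_two (hY : ∀ τ, HasDerivAt Y (vf4 μ α β lam ω (Y τ)) τ) (τ : ℝ) :
    HasDerivAt (fun τ => Y τ 2) (Y τ 3) τ :=
  hasDerivAt_pi.mp (hY τ) 2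

theorem hasDerivAt_comp_three (hY : ∀ τ, HasDerivAt Y (vf4 μ α β lam ω (Y τ)) τ) (τ : ℝ) :
    HasDerivAt (fun τ => Y τ 3)
      (1 / lam * (Y τ 0 - coefD α β * Y τ 2 ^ 2 - eTilde μ α β lam ω * Y τ 2)) τ :=
  hasDerivAt_pi.mp (hY τ) 3

/-- The equation `(1+α²) G_x = R² P`. -/
theorem hasDerivAt_momentum (h : β - α ≠ 0) (hl : lam ≠ 0)
    (hY : ∀ τ, HasDerivAt Y (vf4 μ α β lam ω (Y τ)) τ) (τ : ℝ) :
    HasDerivAt (fun τ => coefA α β / lam * Y τ 1 - lam * Y τ 3)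
      ((coefD α β * Y τ 2 + coefE μ α β ω) * Y τ 2) τ := by
  have ha := coefA_ne_zero h
  refine (((hasDerivAt_comp_one hY τ).const_mul (coefA α β / lam)).sub
    ((hasDerivAt_comp_three hY τ).const_mul lam)).congr_deriv ?_
  -- Here ẽ + (a/λ)k = e: the M̃-terms cancel and dP² + eP remains.
  rw [coefK]
  field_simp
  ring

/-- The defect of the consistency condition is a first integral of the 4-D system. -/
theorem hasDerivAt_consistencyDefect (h : β - α ≠ 0)
    (hlam : lam ^ 2 + coefC α β * lam - 2 * coefA α β * coefD α β = 0)
    (hY : ∀ τ, HasDerivAt Y (vf4 μ α β lam ω (Y τ)) τ) (τ : ℝ) :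
    HasDerivAt (fun τ => consistencyDefect μ α β lam ω (Y τ)) 0 τ := by
  have hl := root_ne_zero h hlam
  have hm := (one_add_sq_pos α).ne'
  have h0 := hasDerivAt_comp_zero hY τ
  have h2 := hasDerivAt_comp_two hY τ
  have h3 := hasDerivAt_comp_three hY τ
  have hu := (h2.const_mul (coefD α β)).add_const (coefE μ α β ω)
  have hw := (h0.sub ((h2.pow 2).const_mul (coefD α β))).sub
    (h2.const_mul (eTilde μ α β lam ω))
  have hM := ((((hu.const_mul (coefD α β * (1 + α ^ 2) / (2 * lam))).mul hw).sub
    ((h3.pow 2).const_mul (coefD α β ^ 2 * (1 + α ^ 2) / 4))).add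
    ((hu.pow 2).const_mul (α * ω + μ))).sub ((hu.pow 3).const_mul (1 + α * β))
  have hD := (hM.const_mul (1 + α ^ 2)).sub ((hasDerivAt_momentum h hl hY τ).pow 2)
  refine hD.congr_deriv ?_
  have hsq := root_sq hlam
  have het := eTilde_eq h μ lam ω
  have hA := coefA_eq α β
  simp only [Pi.sub_apply, Pi.pow_apply]
  push_cast
  rw [het, hA]
  generalize coefE μ α β ω = e
  generalize hdd : coefD α β = d at *
  generalize hss : 1 + α * β = s at *
  generalize hmm : 1 + α ^ 2 = m at *
  generalize α * ω + μ = t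
  field_simp
  -- What does not cancel identically is a multiple of the quadratic equation for λ, so that
  -- equation is what makes the defect conserved.
  linear_combination (16 * Y τ 2 * Y τ 3 * (d * Y τ 2 + e)) * hsq

theorem consistencyDefect_eq (h : β - α ≠ 0)
    (hlam : lam ^ 2 + coefC α β * lam - 2 * coefA α β * coefD α β = 0)
    (hY : ∀ τ, HasDerivAt Y (vf4 μ α β lam ω (Y τ)) τ) (τ τ' : ℝ) :
    consistencyDefect μ α β lam ω (Y τ) = consistencyDefect μ α β lam ω (Y τ') :=
  is_const_of_deriv_eq_zero
    (fun τ => (hasDerivAt_consistencyDefect h hlam hY τ).differentiableAt)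
    (fun τ => (hasDerivAt_consistencyDefect h hlam hY τ).deriv) τ τ'

theorem contDiff_comp (hY : ∀ τ, HasDerivAt Y (vf4 μ α β lam ω (Y τ)) τ) (i : Fin 4) :
    ContDiff ℝ ((⊤ : ℕ∞) : WithTop ℕ∞) (fun τ => Y τ i) :=
  contDiff_pi.mp (contDiff_of_hasDerivAt_autonomous (contDiff_vf4 μ α β lam ω) hY) i

theorem contDiff_amplitude (hY : ∀ τ, HasDerivAt Y (vf4 μ α β lam ω (Y τ)) τ)
    (hpos : ∀ x, 0 < coefD α β * Y x 2 + coefE μ α β ω) :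
    ContDiff ℝ ((⊤ : ℕ∞) : WithTop ℕ∞) (amplitude μ α β ω Y) := by
  unfold amplitude
  exact ((contDiff_const.mul (contDiff_comp hY 2)).add contDiff_const).sqrt
    fun x => (hpos x).ne'

/-- The phase gradient `G / R²`. -/
def phaseGrad (μ α β lam ω : ℝ) (Y : ℝ → Fin 4 → ℝ) (s : ℝ) : ℝ :=
  (coefA α β / lam * Y s 1 - lam * Y s 3) / (1 + α ^ 2) / (coefD α β * Y s 2 + coefE μ α β ω)

theorem contDiff_phaseGrad (hY : ∀ τ, HasDerivAt Y (vf4 μ α β lam ω (Y τ)) τ)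
    (hpos : ∀ x, 0 < coefD α β * Y x 2 + coefE μ α β ω) :
    ContDiff ℝ ((⊤ : ℕ∞) : WithTop ℕ∞) (phaseGrad μ α β lam ω Y) := by
  unfold phaseGrad
  have h1 := contDiff_comp hY 1
  have h2 := contDiff_comp hY 2
  have h3 := contDiff_comp hY 3
  exact (((contDiff_const.mul h1).sub (contDiff_const.mul h3)).div_const _).div
    ((contDiff_const.mul h2).add contDiff_const) fun x => (hpos x).ne'

theorem hasDerivAt_phase (hY : ∀ τ, HasDerivAt Y (vf4 μ α β lam ω (Y τ)) τ)
    (hpos : ∀ x, 0 < coefD α β * Y x 2 + coefE μ α β ω) (x : ℝ) :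
    HasDerivAt (phase μ α β lam ω Y) (phaseGrad μ α β lam ω Y x) x :=
  ((contDiff_phaseGrad hY hpos).continuous.integral_hasStrictDerivAt 0 x).hasDerivAt

theorem contDiff_phase (hY : ∀ τ, HasDerivAt Y (vf4 μ α β lam ω (Y τ)) τ)
    (hpos : ∀ x, 0 < coefD α β * Y x 2 + coefE μ α β ω) :
    ContDiff ℝ ((⊤ : ℕ∞) : WithTop ℕ∞) (phase μ α β lam ω Y) := by
  rw [contDiff_infty_iff_deriv]
  refine ⟨fun x => (hasDerivAt_phase hY hpos x).differentiableAt, ?_⟩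
  rw [show deriv (phase μ α β lam ω Y) = phaseGrad μ α β lam ω Y from
    funext fun x => (hasDerivAt_phase hY hpos x).deriv]
  exact contDiff_phaseGrad hY hpos

/-- Since P = (R² - e)/d, the first equation is `hasDerivAt_momentum`. The second is the vanishing
of the defect, with Q and Q' rewritten through R_x = dQ/(2R) and R_xx. -/
theorem solvesAmplitudePhase (h : β - α ≠ 0) (hl : lam ≠ 0)
    (hY : ∀ τ, HasDerivAt Y (vf4 μ α β lam ω (Y τ)) τ)
    (hpos : ∀ x, 0 < coefD α β * Y x 2 + coefE μ α β ω)
    (hdef : ∀ τ, consistencyDefect μ α β lam ω (Y τ) = 0) :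
    SolvesAmplitudePhase μ α β ω (amplitude μ α β ω Y) (phase μ α β lam ω Y) := by
  have hm := (one_add_sq_pos α).ne'
  refine ⟨contDiff_amplitude hY hpos, contDiff_phase hY hpos, fun x => ?_⟩
  have hR : ∀ x, amplitude μ α β ω Y x ^ 2 = coefD α β * Y x 2 + coefE μ α β ω :=
    fun x => Real.sq_sqrt (hpos x).le
  have hRpos : ∀ x, 0 < amplitude μ α β ω Y x := fun x => Real.sqrt_pos.mpr (hpos x)
  have hG : angMom (amplitude μ α β ω Y) (phase μ α β lam ω Y)
      = fun x => (coefA α β / lam * Y x 1 - lam * Y x 3) / (1 + α ^ 2) := by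
    funext x
    rw [angMom, (hasDerivAt_phase hY hpos x).deriv, hR, phaseGrad,
      div_mul_cancel₀ _ (hpos x).ne']
  have hR1 : ∀ x, HasDerivAt (amplitude μ α β ω Y)
      (coefD α β * Y x 3 / (2 * amplitude μ α β ω Y x)) x := fun x =>
    (((hasDerivAt_comp_two hY x).const_mul (coefD α β)).add_const (coefE μ α β ω)).sqrt
      (hpos x).ne'
  have hR2 : HasDerivAt (fun x => coefD α β * Y x 3 / (2 * amplitude μ α β ω Y x)) _ x :=
    ((hasDerivAt_comp_three hY x).const_mul (coefD α β)).div ((hR1 x).const_mul 2)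
      (mul_ne_zero two_ne_zero (hRpos x).ne')
  have hR2' : iteratedDeriv 2 (amplitude μ α β ω Y) x
      = deriv (fun x => coefD α β * Y x 3 / (2 * amplitude μ α β ω Y x)) x := by
    rw [iteratedDeriv_succ, iteratedDeriv_one,
      show deriv (amplitude μ α β ω Y) = fun x => coefD α β * Y x 3 / (2 * amplitude μ α β ω Y x)
        from funext fun x => (hR1 x).deriv]
  constructor
  · rw [hG, ((hasDerivAt_momentum h hl hY x).div_const (1 + α ^ 2)).deriv]
    have h4 : amplitude μ α β ω Y x ^ 4 = (coefD α β * Y x 2 + coefE μ α β ω) ^ 2 := by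
      rw [← hR]; ring
    rw [h4, hR, mul_div_cancel₀ _ hm]
    unfold coefD coefE
    field_simp
    ring
  · rw [hR2', hR2.deriv]
    have h5 := hdef x
    rw [consistencyDefect, bigM, ← hR] at h5
    simp only [hG]
    have hne := (hRpos x).ne'
    generalize coefA α β / lam * Y x 1 - lam * Y x 3 = N at h5 ⊢
    generalize amplitude μ α β ω Y x = R at h5 hne ⊢
    field_simp at h5 ⊢
    linear_combination (-1 / 2 : ℝ) * h5

end System

/-- The polar form of the CGLe. -/
theorem solvesCGL_field {μ α β ω : ℝ} {R φ : ℝ → ℝ} (hpos : ∀ x, 0 < R x)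
    (hS : SolvesAmplitudePhase μ α β ω R φ) : SolvesCGL μ α β (field ω R φ) := by
  obtain ⟨hRs, hφs, heq⟩ := hS
  have hR0 : ∀ x, HasDerivAt R (deriv R x) x := fun x =>
    (hRs.differentiable (by simp) x).hasDerivAt
  have hφ0 : ∀ x, HasDerivAt φ (deriv φ x) x := fun x =>
    (hφs.differentiable (by simp) x).hasDerivAt
  have hR1 : ∀ x, HasDerivAt (deriv R) (deriv (deriv R) x) x := fun x =>
    (((contDiff_infty_iff_deriv.mp hRs).2).differentiable (by simp) x).hasDerivAt
  have hφ1 : ∀ x, HasDerivAt (deriv φ) (deriv (deriv φ) x) x := fun x =>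
    (((contDiff_infty_iff_deriv.mp hφs).2).differentiable (by simp) x).hasDerivAt
  constructor
  · unfold field
    have hR2 : ContDiff ℝ 2 R := contDiff_infty.mp hRs 2
    have hφ2 : ContDiff ℝ 2 φ := contDiff_infty.mp hφs 2
    have hc : ContDiff ℝ 2 (fun x : ℝ => (x : ℂ)) := Complex.ofRealCLM.contDiff
    have h1 : ContDiff ℝ 2 (fun p : ℝ × ℝ => (R p.1 : ℂ)) := hc.comp (hR2.comp contDiff_fst)
    have h2 : ContDiff ℝ 2 (fun p : ℝ × ℝ => (φ p.1 : ℂ)) := hc.comp (hφ2.comp contDiff_fst)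
    have h3 : ContDiff ℝ 2 (fun p : ℝ × ℝ => (p.2 : ℂ)) := hc.comp contDiff_snd
    exact h1.mul (((contDiff_const.mul h2).sub (contDiff_const.mul h3)).cexp)
  · intro x t
    set E : ℝ → ℂ := fun y => Complex.exp (Complex.I * (φ y : ℂ) - Complex.I * (ω : ℂ) * (t : ℂ))
      with hE
    have hEd : ∀ y, HasDerivAt E (E y * (Complex.I * ((deriv φ y : ℝ) : ℂ))) y := fun y => by
      have h1 : HasDerivAt (fun y : ℝ => Complex.I * (φ y : ℂ) - Complex.I * (ω : ℂ) * (t : ℂ))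
          (Complex.I * ((deriv φ y : ℝ) : ℂ)) y :=
        ((hφ0 y).ofReal_comp.const_mul Complex.I).sub_const _
      exact h1.cexp
    have hA1 : ∀ y, HasDerivAt (fun y => field ω R φ y t)
        ((((deriv R y : ℝ) : ℂ) + Complex.I * (R y : ℂ) * ((deriv φ y : ℝ) : ℂ)) * E y) y := fun y => by
      refine ((hR0 y).ofReal_comp.mul (hEd y)).congr_deriv ?_
      simp only [hE]
      ring
    have hA2 : HasDerivAt (fun y => (((deriv R y : ℝ) : ℂ) + Complex.I * (R y : ℂ) * ((deriv φ y : ℝ) : ℂ)) * E y)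
        ((((deriv (deriv R) x : ℝ) : ℂ) - (R x : ℂ) * ((deriv φ x : ℝ) : ℂ) ^ 2 + Complex.I *
          (2 * ((deriv R x : ℝ) : ℂ) * ((deriv φ x : ℝ) : ℂ) + (R x : ℂ) * ((deriv (deriv φ) x : ℝ) : ℂ))) * E x) x := by
      refine (((hR1 x).ofReal_comp.add (((hR0 x).ofReal_comp.const_mul Complex.I).mul
        (hφ1 x).ofReal_comp)).mul (hEd x)).congr_deriv ?_
      simp only [Pi.add_apply, Pi.mul_apply]
      linear_combination ((R x : ℂ) * ((deriv φ x : ℝ) : ℂ) ^ 2 * E x) * Complex.I_sq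
    have hxx : iteratedDeriv 2 (fun y => field ω R φ y t) x = deriv (fun y => (((deriv R y : ℝ) : ℂ)
        + Complex.I * (R y : ℂ) * ((deriv φ y : ℝ) : ℂ)) * E y) x := by
      rw [iteratedDeriv_succ, iteratedDeriv_one, show deriv (fun y => field ω R φ y t)
        = fun y => (((deriv R y : ℝ) : ℂ) + Complex.I * (R y : ℂ) * ((deriv φ y : ℝ) : ℂ)) * E y from
        funext fun y => (hA1 y).deriv]
    have ht : deriv (fun s => field ω R φ x s) t = -(Complex.I * ω) * ((R x : ℂ) * E x) := by
      have h1 : HasDerivAt (fun s : ℝ => (s : ℂ)) 1 t := Complex.ofRealCLM.hasDerivAt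
      have h2 := (((h1.const_mul (Complex.I * (ω : ℂ))).const_sub
        (Complex.I * (φ x : ℂ))).cexp).const_mul (R x : ℂ)
      refine h2.deriv.trans ?_
      simp only [hE]
      ring
    have hnorm : ‖field ω R φ x t‖ = R x := by
      have : Complex.I * (φ x : ℂ) - Complex.I * (ω : ℂ) * (t : ℂ)
          = ((φ x - ω * t : ℝ) : ℂ) * Complex.I := by
        push_cast; ring
      rw [field, this, norm_mul, Complex.norm_exp_ofReal_mul_I, mul_one, Complex.norm_real,
        Real.norm_of_nonneg (hpos x).le]
    rw [ht, hxx, hA2.deriv, hnorm, show field ω R φ x t = (R x : ℂ) * E x from rfl]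
    obtain ⟨e1, e2⟩ := heq x
    have hGd : deriv (angMom R φ) x
        = deriv (deriv φ) x * R x ^ 2 + deriv φ x * (2 * R x * deriv R x) := by
      have := ((hφ1 x).mul ((hR0 x).pow 2)).deriv
      refine this.trans ?_
      simp
    have hRxx : iteratedDeriv 2 R x = deriv (deriv R) x := by
      rw [iteratedDeriv_succ, iteratedDeriv_one]
    rw [hGd] at e1
    rw [hRxx, angMom] at e2
    have hRx := (hpos x).ne'
    generalize deriv (deriv R) x = R2 at *
    generalize deriv (deriv φ) x = φ2 at *
    generalize deriv R x = R1 at *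
    generalize deriv φ x = φ1 at *
    generalize R x = r at *
    have hm := (one_add_sq_pos α).ne'
    -- Cancelling r here, and r³ in the next identity, gives the imaginary and the real part of the
    -- CGLe multiplied by 1 - iα.
    have f1 : (1 + α ^ 2) * (2 * R1 * φ1 + r * φ2) = (β - α) * r ^ 3 - (ω - μ * α) * r := by
      have : r * ((1 + α ^ 2) * (2 * R1 * φ1 + r * φ2)
        - ((β - α) * r ^ 3 - (ω - μ * α) * r)) = 0 := by linear_combination e1
      exact sub_eq_zero.mp ((mul_eq_zero.mp this).resolve_left hRx)
    have f2 : (1 + α ^ 2) * (R2 - r * φ1 ^ 2) = (1 + α * β) * r ^ 3 - (α * ω + μ) * r := by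
      have : r ^ 3 * ((1 + α ^ 2) * (R2 - r * φ1 ^ 2)
        - ((1 + α * β) * r ^ 3 - (α * ω + μ) * r)) = 0 := by linear_combination -e2
      exact sub_eq_zero.mp ((mul_eq_zero.mp this).resolve_left (pow_ne_zero 3 hRx))
    have hX : R2 - r * φ1 ^ 2 = ((1 + α * β) * r ^ 3 - (α * ω + μ) * r) / (1 + α ^ 2) := by
      rw [eq_div_iff hm, mul_comm, f2]
    have hZ : 2 * R1 * φ1 + r * φ2 = ((β - α) * r ^ 3 - (ω - μ * α) * r) / (1 + α ^ 2) := by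
      rw [eq_div_iff hm, mul_comm, f1]
    have hXc : (R2 : ℂ) - r * φ1 ^ 2
        = ((1 + α * β) * r ^ 3 - (α * ω + μ) * r) / (1 + α ^ 2) := by exact_mod_cast hX
    have hZc : 2 * (R1 : ℂ) * φ1 + r * φ2
        = ((β - α) * r ^ 3 - (ω - μ * α) * r) / (1 + α ^ 2) := by exact_mod_cast hZ
    rw [hXc, hZc]
    have hmc : (1 + (α : ℂ) ^ 2) ≠ 0 := by exact_mod_cast hm
    push_cast
    field_simp
    ring_nf
    simp only [Complex.I_sq]
    ring

end
end CGL

namespace CGL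
noncomputable section

open CGL.PerFun

/-! ### The periodic solutions belonging to a fixed point -/

/-- The constants of the reduced problem for the CGLe. -/
def reduced (μ α β lam a₄ : ℝ) : Reduced where
  s := 1 + α * β
  m := 1 + α ^ 2
  d := coefD α β
  lam := lam
  a := coefA α β
  μ := μ
  amp := a₄

/-- The carrier frequency of a point. -/
def Unknowns.freq (μ α β : ℝ) (z : Unknowns) : ℝ := CGL.freq μ α β (z.1 ^ 2 * z.2.2.2.2)

/-- The vector `X = (x₁, x₂, z₁, z₂)`, as functions of the angle `Ωτ`. -/
def Reduced.profile (c : Reduced) (ρ Ω : ℝ) (z : Unknowns) : Fin 4 → PerFun :=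
  ![Ω⁻¹ • c.n z + (c.k z * Ω / c.W z) • c.q z,
    (ρ / (c.lam * c.W z)) • c.h z,
    (c.p z - (z.1 / (c.lam * c.W z)) • c.h z) * sinC + c.q z * cosC,
    (c.p z - (z.1 / (c.lam * c.W z)) • c.h z) * cosC - c.q z * sinC]

/-- The vector `X` at the point `τ`. -/
def Reduced.solution (c : Reduced) (ρ Ω : ℝ) (z : Unknowns) (τ : ℝ) : Fin 4 → ℝ :=
  fun i => c.profile ρ Ω z i ((Ω * τ : ℝ) : AddCircle (2 * Real.pi))

section

variable {μ α β lam a₄ : ℝ} {z : Unknowns} {ρ Ω : ℝ}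

theorem coefE_point (h : β - α ≠ 0) :
    coefE μ α β (z.freq μ α β) = (reduced μ α β lam a₄).e z := coefE_freq h μ _

theorem eTilde_point (h : β - α ≠ 0) :
    eTilde μ α β lam (z.freq μ α β) = lam * (reduced μ α β lam a₄).W z := by
  rw [Unknowns.freq, eTilde_freq h, coefE_freq h]
  simp only [Reduced.W, Reduced.e, reduced]
  ring

theorem coefK_point (h : β - α ≠ 0) :
    coefK μ α β lam (z.freq μ α β) = (reduced μ α β lam a₄).k z := by
  rw [coefK, coefE_point h (lam := lam) (a₄ := a₄), eTilde_point h (a₄ := a₄)]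
  rfl

theorem spatialFreq_point (h : β - α ≠ 0) (hl : lam ≠ 0) (hz : z.1 = ρ ^ 2) :
    spatialFreq μ α β lam (z.freq μ α β) ρ z.2.2.2.1
      = Real.sqrt ((reduced μ α β lam a₄).V z) := by
  rw [spatialFreq, eTilde_point h (a₄ := a₄), mul_div_cancel_left₀ _ hl, Reduced.V, hz]

theorem hasDerivAt_comp_mul {f : PerFun} {f' : ℝ → ℝ}
    (h : ∀ θ : ℝ, HasDerivAt (fun θ : ℝ => f (θ : AddCircle (2 * Real.pi))) (f' θ) θ) (Ω τ : ℝ) :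
    HasDerivAt (fun τ => f ((Ω * τ : ℝ) : AddCircle (2 * Real.pi))) (f' (Ω * τ) * Ω) τ := by
  have h1 : HasDerivAt (fun τ : ℝ => Ω * τ) Ω τ := by
    simpa using (hasDerivAt_id τ).const_mul Ω
  exact (h (Ω * τ)).comp τ h1

/-- Apart from explicit sines and cosines, z₁ and z₂ enter only through z̃ and w̃/Ω, which are the
quantities known along a fixed point. -/
theorem rescaledVF_eq {ω γ τ A q : ℝ} {v : Fin 4 → ℝ}
    (hA : v 2 * Real.sin (Ω * τ) + v 3 * Real.cos (Ω * τ) = A)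
    (hq : v 2 * Real.cos (Ω * τ) - v 3 * Real.sin (Ω * τ) = q) :
    rescaledVF μ α β lam ω ρ γ Ω τ v =
      ![ρ * lam * coefE μ α β ω / coefA α β * v 1
          - ρ ^ 2 * coefK μ α β lam ω * (coefD α β / eTilde μ α β lam ω) * (ρ * v 1 + A) ^ 2,
        ρ / eTilde μ α β lam ω
          * (v 0 - coefK μ α β lam ω * (Ω * lam / eTilde μ α β lam ω) * q) * (ρ * v 1 + A),
        ρ ^ 2 / Ω * (-coefD α β / lam * (ρ * v 1 + A) ^ 2 * Real.cos (Ω * τ)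
          + γ * A * Real.cos (Ω * τ) - Ω / eTilde μ α β lam ω
          * (v 0 - coefK μ α β lam ω * (Ω * lam / eTilde μ α β lam ω) * q)
            * (ρ * v 1 + A) * Real.sin (Ω * τ)),
        ρ ^ 2 / Ω * (coefD α β / lam * (ρ * v 1 + A) ^ 2 * Real.sin (Ω * τ)
          - γ * A * Real.sin (Ω * τ) - Ω / eTilde μ α β lam ω
          * (v 0 - coefK μ α β lam ω * (Ω * lam / eTilde μ α β lam ω) * q)
            * (ρ * v 1 + A) * Real.cos (Ω * τ))] := by
  simp only [rescaledVF]
  rw [hA, hq]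

/-- `z̃` in terms of the profile. -/
theorem solution_sin_add_cos (c : Reduced) (τ : ℝ) :
    c.solution ρ Ω z τ 2 * Real.sin (Ω * τ) + c.solution ρ Ω z τ 3 * Real.cos (Ω * τ)
      = c.p z ((Ω * τ : ℝ) : AddCircle (2 * Real.pi))
        - z.1 / (c.lam * c.W z) * c.h z ((Ω * τ : ℝ) : AddCircle (2 * Real.pi)) := by
  simp only [Reduced.solution, Reduced.profile, Matrix.cons_val, ContinuousMap.add_apply,
    ContinuousMap.sub_apply, ContinuousMap.mul_apply, ContinuousMap.smul_apply, smul_eq_mul,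
    sinC_coe, cosC_coe]
  linear_combination (c.p z ((Ω * τ : ℝ) : AddCircle (2 * Real.pi))
    - z.1 / (c.lam * c.W z) * c.h z ((Ω * τ : ℝ) : AddCircle (2 * Real.pi)))
    * Real.sin_sq_add_cos_sq (Ω * τ)

theorem solution_cos_sub_sin (c : Reduced) (τ : ℝ) :
    c.solution ρ Ω z τ 2 * Real.cos (Ω * τ) - c.solution ρ Ω z τ 3 * Real.sin (Ω * τ)
      = c.q z ((Ω * τ : ℝ) : AddCircle (2 * Real.pi)) := by
  simp only [Reduced.solution, Reduced.profile, Matrix.cons_val, ContinuousMap.add_apply,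
    ContinuousMap.sub_apply, ContinuousMap.mul_apply, ContinuousMap.smul_apply, smul_eq_mul,
    sinC_coe, cosC_coe]
  linear_combination (c.q z ((Ω * τ : ℝ) : AddCircle (2 * Real.pi)))
    * Real.sin_sq_add_cos_sq (Ω * τ)

theorem solution_zero (c : Reduced) (τ : ℝ) : c.solution ρ Ω z τ 0
    = Ω⁻¹ * c.n z ((Ω * τ : ℝ) : AddCircle (2 * Real.pi))
      + c.k z * Ω / c.W z * c.q z ((Ω * τ : ℝ) : AddCircle (2 * Real.pi)) := rfl

theorem solution_one (c : Reduced) (τ : ℝ) : c.solution ρ Ω z τ 1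
    = ρ / (c.lam * c.W z) * c.h z ((Ω * τ : ℝ) : AddCircle (2 * Real.pi)) := rfl

theorem hasDerivAt_solution (h : β - α ≠ 0) (H : (reduced μ α β lam a₄).IsFixed z)
    (hz : z.1 = ρ ^ 2) (hΩ : 0 < Ω) (hΩsq : Ω ^ 2 = (reduced μ α β lam a₄).V z) (τ : ℝ) :
    HasDerivAt ((reduced μ α β lam a₄).solution ρ Ω z)
      (rescaledVF μ α β lam (z.freq μ α β) ρ z.2.2.2.1 Ω τ
        ((reduced μ α β lam a₄).solution ρ Ω z τ)) τ := by
  have hl : lam ≠ 0 := H.nondeg.lam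
  have ha : coefA α β ≠ 0 := H.nondeg.a
  set c := reduced μ α β lam a₄ with hc
  have hp := hasDerivAt_comp_mul H.hasDerivAt_p Ω τ
  have hq := hasDerivAt_comp_mul H.hasDerivAt_q Ω τ
  have hh := hasDerivAt_comp_mul H.hasDerivAt_h Ω τ
  have hn := hasDerivAt_comp_mul H.hasDerivAt_n Ω τ
  have hC := hasDerivAt_comp_mul hasDerivAt_cosC Ω τ
  have hS := hasDerivAt_comp_mul hasDerivAt_sinC Ω τ
  have hW := H.W
  have hVW : c.W z = Ω ^ 2 - ρ ^ 2 * z.2.2.2.1 := by rw [hΩsq, Reduced.V, hz]; ring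
  have hquad : ∀ x, c.quad z x = c.h z x - coefD α β * c.p z x ^ 2 := fun x => by
    rw [pow_two]; rfl
  have hk : c.k z = lam / coefA α β * (c.e z - lam * c.W z) := rfl
  have hlam : c.lam = lam := rfl
  have haa : c.a = coefA α β := rfl
  have hΩ0 := hΩ.ne'
  have hA := hp.sub (hh.const_mul (z.1 / (c.lam * c.W z)))
  rw [rescaledVF_eq (solution_sin_add_cos c τ) (solution_cos_sub_sin c τ),
    coefE_point h (lam := lam) (a₄ := a₄), eTilde_point h (a₄ := a₄), coefK_point h (a₄ := a₄),
    solution_zero, solution_one, ← hc]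
  simp only [← H.γ_eq, hquad, hz, hlam, haa, ← hΩsq] at hp hq hh hn hA ⊢
  refine hasDerivAt_pi.mpr fun i => ?_
  fin_cases i
  · refine ((hn.const_mul Ω⁻¹).add (hq.const_mul (c.k z * Ω / c.W z))).congr_deriv ?_
    simp only [Fin.zero_eta, Matrix.cons_val_zero]
    rw [hk]
    -- Replacing W by Ω² - ρ²γ makes the identity rational in Ω.
    generalize c.W z = W at *
    subst hVW
    field_simp
    ring
  · refine (hh.const_mul (ρ / (c.lam * c.W z))).congr_deriv ?_
    simp only [Fin.mk_one, Matrix.cons_val_one, Matrix.cons_val_zero, hlam]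
    field_simp
    ring
  · have hd := (hA.mul hS).add (hq.mul hC)
    simp only [← hlam, ← hz] at hd
    refine hd.congr_deriv ?_
    simp only [Fin.reduceFinMk, Matrix.cons_val, hlam, hz, cosC_coe, sinC_coe, Pi.sub_apply]
    generalize c.W z = W at *
    subst hVW
    field_simp
    ring
  · have hd := (hA.mul hC).sub (hq.mul hS)
    simp only [← hlam, ← hz] at hd
    refine hd.congr_deriv ?_
    simp only [Fin.reduceFinMk, Matrix.cons_val, hlam, hz, cosC_coe, sinC_coe, Pi.sub_apply]
    generalize c.W z = W at *
    subst hVW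
    field_simp
    ring

end
end
end CGL

namespace CGL
noncomputable section

open CGL.PerFun

/-! ### The physical variables: parity, means and the consistency condition -/

section

variable {μ α β lam a₄ : ℝ} {z : Unknowns} {ρ Ω : ℝ}

/-- `profile` was obtained by inverting the change of variables. This lets parity, periodicity and
size of (M̃, Ñ, P, Q) be read off from h, n, p and q. -/
theorem physical_solution (h : β - α ≠ 0) (H : (reduced μ α β lam a₄).IsFixed z)
    (hz : z.1 = ρ ^ 2) (hΩ : 0 < Ω) (τ : ℝ) :
    physical μ α β lam (z.freq μ α β) ρ Ω τ ((reduced μ α β lam a₄).solution ρ Ω z τ)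
      = ![z.1 ^ 2 * (reduced μ α β lam a₄).h z ((Ω * τ : ℝ) : AddCircle (2 * Real.pi)),
          z.1 * (Ω⁻¹ * (reduced μ α β lam a₄).n z ((Ω * τ : ℝ) : AddCircle (2 * Real.pi))),
          z.1 * (reduced μ α β lam a₄).p z ((Ω * τ : ℝ) : AddCircle (2 * Real.pi)),
          z.1 * (Ω * (reduced μ α β lam a₄).q z ((Ω * τ : ℝ) : AddCircle (2 * Real.pi)))] := by
  have hl : lam ≠ 0 := H.nondeg.lam
  set c := reduced μ α β lam a₄ with hc
  have hW := H.W
  have hq : Ω * c.solution ρ Ω z τ 2 * Real.cos (Ω * τ) - Ω * c.solution ρ Ω z τ 3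
      * Real.sin (Ω * τ) = Ω * c.q z ((Ω * τ : ℝ) : AddCircle (2 * Real.pi)) := by
    linear_combination Ω * solution_cos_sub_sin (ρ := ρ) (Ω := Ω) (z := z) c τ
  have hlam : c.lam = lam := rfl
  rw [physical_eq, hq, solution_sin_add_cos, eTilde_point h (a₄ := a₄), coefK_point h (a₄ := a₄),
    solution_zero, solution_one, ← hc, hlam, hz]
  have hΩ0 := hΩ.ne'
  funext i
  fin_cases i
  · simp only [Fin.zero_eta, Matrix.cons_val_zero]
    field_simp
  · simp only [Fin.mk_one, Matrix.cons_val_one, Matrix.cons_val_zero]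
    field_simp
    ring
  · simp only [Fin.reduceFinMk, Matrix.cons_val]
    field_simp
    ring
  · simp only [Fin.reduceFinMk, Matrix.cons_val]

theorem hasDerivAt_physical (h : β - α ≠ 0) (H : (reduced μ α β lam a₄).IsFixed z)
    (hz : z.1 = ρ ^ 2) (hΩ : 0 < Ω) (hΩsq : Ω ^ 2 = (reduced μ α β lam a₄).V z) (τ : ℝ) :
    HasDerivAt (fun τ => physical μ α β lam (z.freq μ α β) ρ Ω τ
        ((reduced μ α β lam a₄).solution ρ Ω z τ))
      (vf4 μ α β lam (z.freq μ α β) (physical μ α β lam (z.freq μ α β) ρ Ω τ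
        ((reduced μ α β lam a₄).solution ρ Ω z τ))) τ := by
  simp only [physical_solution h H hz hΩ]
  have hl : lam ≠ 0 := H.nondeg.lam
  have ha : coefA α β ≠ 0 := H.nondeg.a
  set c := reduced μ α β lam a₄ with hc
  have hp := hasDerivAt_comp_mul H.hasDerivAt_p Ω τ
  have hq := hasDerivAt_comp_mul H.hasDerivAt_q Ω τ
  have hh := hasDerivAt_comp_mul H.hasDerivAt_h Ω τ
  have hn := hasDerivAt_comp_mul H.hasDerivAt_n Ω τ
  have hVW : c.W z = Ω ^ 2 - z.1 * z.2.2.2.1 := by rw [hΩsq, Reduced.V]; ring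
  have hquad : ∀ x, c.quad z x = c.h z x - coefD α β * c.p z x ^ 2 := fun x => by
    rw [pow_two]; rfl
  have hlam : c.lam = lam := rfl
  have haa : c.a = coefA α β := rfl
  have hΩ0 := hΩ.ne'
  simp only [← H.γ_eq, hquad, hlam, haa, ← hΩsq] at hp hq hh hn
  rw [vf4, eTilde_point h (a₄ := a₄), coefK_point h (a₄ := a₄), ← hc, hVW]
  simp only [Matrix.cons_val]
  refine hasDerivAt_pi.mpr fun i => ?_
  fin_cases i
  · refine (hh.const_mul (z.1 ^ 2)).congr_deriv ?_
    simp only [Fin.zero_eta, Matrix.cons_val_zero]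
    field_simp
  · refine ((hn.const_mul Ω⁻¹).const_mul z.1).congr_deriv ?_
    simp only [Fin.mk_one, Matrix.cons_val_one, Matrix.cons_val_zero]
    field_simp
  · refine (hp.const_mul z.1).congr_deriv ?_
    simp only [Fin.reduceFinMk, Matrix.cons_val]
    ring
  · refine ((hq.const_mul Ω).const_mul z.1).congr_deriv ?_
    simp only [Fin.reduceFinMk, Matrix.cons_val]
    field_simp
    ring

theorem coe_mul_neg (Ω τ : ℝ) : ((Ω * -τ : ℝ) : AddCircle (2 * Real.pi))
    = -((Ω * τ : ℝ) : AddCircle (2 * Real.pi)) := by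
  rw [mul_neg, AddCircle.coe_neg]

theorem coe_mul_add_period {Ω : ℝ} (hΩ : 0 < Ω) (τ : ℝ) :
    ((Ω * (τ + 2 * Real.pi / Ω) : ℝ) : AddCircle (2 * Real.pi))
      = ((Ω * τ : ℝ) : AddCircle (2 * Real.pi)) := by
  rw [mul_add, mul_div_cancel₀ _ hΩ.ne', AddCircle.coe_add_period]

theorem periodic_solution (c : Reduced) (hΩ : 0 < Ω) :
    Function.Periodic (c.solution ρ Ω z) (2 * Real.pi / Ω) := by
  intro τ
  funext i
  simp only [Reduced.solution, coe_mul_add_period hΩ]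

theorem reflQ_solution {c : Reduced} (H : c.IsFixed z) (τ : ℝ) :
    reflQ.mulVec (c.solution ρ Ω z (-τ)) = c.solution ρ Ω z τ := by
  have hh := Reduced.IsFixed.isEven_h c z
  have hn := Reduced.IsFixed.isOdd_n c z
  have hq := Reduced.IsFixed.isOdd_q c z
  have hp := H.isEven_p
  have hA : ∀ t : ℝ, IsEven (c.p z - t • c.h z) := fun t => hp.sub (hh.smul t)
  funext i
  rw [reflQ, Matrix.mulVec_diagonal]
  simp only [Reduced.solution, coe_mul_neg]
  fin_cases i
  · simp only [Fin.zero_eta, Matrix.cons_val_zero, Reduced.profile]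
    rw [((hn.smul _).add (hq.smul _)) _]
    ring
  · simp only [Fin.mk_one, Matrix.cons_val_one, Matrix.cons_val_zero, Reduced.profile]
    rw [(hh.smul _) _]
    ring
  · simp only [Fin.reduceFinMk, Matrix.cons_val, Reduced.profile]
    rw [(((hA _).mul_isOdd isOdd_sinC).add (hq.mul_isEven isEven_cosC)) _]
    ring
  · simp only [Fin.reduceFinMk, Matrix.cons_val, Reduced.profile]
    rw [(((hA _).mul isEven_cosC).sub (hq.mul isOdd_sinC)) _]
    ring

/-- The means of x₁ and z₁ vanish by oddness, that of x₂ will serve as the definition of a₂₂, and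
that of z₂ is the normalization achieved by `κ`. -/
theorem mean_solution {c : Reduced} (H : c.IsFixed z) (hΩ : 0 < Ω) (i : Fin 4) :
    mean (2 * Real.pi / Ω) (fun τ => c.solution ρ Ω z τ i)
      = ![0, ρ * (c.hMean z / (c.lam * c.W z)), 0, c.amp] i := by
  have hh := Reduced.IsFixed.isEven_h c z
  have hn := Reduced.IsFixed.isOdd_n c z
  have hq := Reduced.IsFixed.isOdd_q c z
  have hp := H.isEven_p
  have hA : ∀ t : ℝ, IsEven (c.p z - t • c.h z) := fun t => hp.sub (hh.smul t)
  refine (mean_comp_mul hΩ (c.profile ρ Ω z i)).trans ?_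
  fin_cases i
  · exact ((hn.smul _).add (hq.smul _)).avg_eq_zero
  · change avg ((ρ / (c.lam * c.W z)) • c.h z) = ρ * (c.hMean z / (c.lam * c.W z))
    rw [map_smul, Reduced.IsFixed.avg_h, smul_eq_mul]
    ring
  · exact (((hA _).mul_isOdd isOdd_sinC).add (hq.mul_isEven isEven_cosC)).avg_eq_zero
  · change avg ((c.p z - (z.1 / (c.lam * c.W z)) • c.h z) * cosC - c.q z * sinC) = c.amp
    rw [mul_comm _ cosC, mul_comm _ sinC, map_sub, mul_sub, map_sub, mul_smul_comm, map_smul,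
      H.avg_sinC_mul_q, smul_eq_mul]
    linear_combination H.avg_normalized

theorem physical_neg (h : β - α ≠ 0) (H : (reduced μ α β lam a₄).IsFixed z)
    (hz : z.1 = ρ ^ 2) (hΩ : 0 < Ω) {Y : ℝ → Fin 4 → ℝ}
    (hY : ∀ τ, Y τ = physical μ α β lam (z.freq μ α β) ρ Ω τ
      ((reduced μ α β lam a₄).solution ρ Ω z τ)) (τ : ℝ) :
    Y (-τ) = ![Y τ 0, -(Y τ 1), Y τ 2, -(Y τ 3)] := by
  simp only [hY, physical_solution h H hz hΩ, coe_mul_neg]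
  rw [Reduced.IsFixed.isEven_h _ _ _, Reduced.IsFixed.isOdd_n _ _ _, H.isEven_p _,
    Reduced.IsFixed.isOdd_q _ _ _]
  simp

/-- At θ = 0 the odd quantities Ñ and Q vanish. What is left is (1+α²)M, and the equation for σ
annihilates its nontrivial factor. -/
theorem consistencyDefect_physical_zero (h : β - α ≠ 0) (H : (reduced μ α β lam a₄).IsFixed z)
    (hz : z.1 = ρ ^ 2) (hΩ : 0 < Ω) :
    consistencyDefect μ α β lam (z.freq μ α β) (physical μ α β lam (z.freq μ α β) ρ Ω 0
      ((reduced μ α β lam a₄).solution ρ Ω z 0)) = 0 := by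
  have hl : lam ≠ 0 := H.nondeg.lam
  rw [physical_solution h H hz hΩ, mul_zero, AddCircle.coe_zero,
    (Reduced.IsFixed.isOdd_n _ _).apply_zero, (Reduced.IsFixed.isOdd_q _ _).apply_zero]
  set c := reduced μ α β lam a₄ with hc
  have h1 := bigM_freq h hl μ z.1 z.2.2.2.2 (c.h z 0) (c.p z 0)
    ![z.1 ^ 2 * c.h z 0, z.1 * (Ω⁻¹ * 0), z.1 * c.p z 0, z.1 * (Ω * 0)] rfl rfl
  have h2 : (1 + α * β) * c.σ z * (c.e z - z.1 * coefD α β * c.p z 0)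
      = coefD α β * (1 + α ^ 2) / (2 * lam) * (c.h z 0 - coefD α β * c.p z 0 ^ 2)
        - (1 + α * β) * coefD α β ^ 2 * c.p z 0 ^ 2 := H.consistency_zero
  have h3 : coefE μ α β (freq μ α β (z.1 ^ 2 * z.2.2.2.2)) = c.e z := coefE_freq h μ _
  rw [h3] at h1
  rw [consistencyDefect, Unknowns.freq, h1]
  rw [H.σ_eq]
  simp only [Matrix.cons_val]
  linear_combination (-(1 + α ^ 2) * z.1 ^ 2 * (coefD α β * (z.1 * c.p z 0) + c.e z)) * h2

end

/-! ### Phase and amplitude of symmetric periodic solutions -/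

section

variable {μ α β lam ω : ℝ} {Y : ℝ → Fin 4 → ℝ} {T : ℝ}

theorem phaseGrad_neg (hsym : ∀ τ, Y (-τ) = ![Y τ 0, -(Y τ 1), Y τ 2, -(Y τ 3)]) (x : ℝ) :
    phaseGrad μ α β lam ω Y (-x) = -phaseGrad μ α β lam ω Y x := by
  simp only [phaseGrad, hsym x, Matrix.cons_val]
  ring

theorem phase_neg (hsym : ∀ τ, Y (-τ) = ![Y τ 0, -(Y τ 1), Y τ 2, -(Y τ 3)]) (x : ℝ) :
    phase μ α β lam ω Y (-x) = phase μ α β lam ω Y x := by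
  change ∫ s in (0 : ℝ)..(-x), phaseGrad μ α β lam ω Y s
    = ∫ s in (0 : ℝ)..x, phaseGrad μ α β lam ω Y s
  have := intervalIntegral.integral_comp_neg (a := 0) (b := x) (phaseGrad μ α β lam ω Y)
  rw [neg_zero] at this
  rw [intervalIntegral.integral_symm, ← this, ← intervalIntegral.integral_neg]
  simp only [phaseGrad_neg hsym, neg_neg]

theorem amplitude_neg (hsym : ∀ τ, Y (-τ) = ![Y τ 0, -(Y τ 1), Y τ 2, -(Y τ 3)]) (x : ℝ) :
    amplitude μ α β ω Y (-x) = amplitude μ α β ω Y x := by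
  simp only [amplitude, hsym x, Matrix.cons_val]

theorem periodic_phaseGrad (hper : Function.Periodic Y T) :
    Function.Periodic (phaseGrad μ α β lam ω Y) T := by
  intro x
  simp only [phaseGrad, hper x]

/-- The phase gradient is odd and periodic, so its integral over a period is zero and the phase has
no drift. -/
theorem periodic_phase (hY : ∀ τ, HasDerivAt Y (vf4 μ α β lam ω (Y τ)) τ)
    (hpos : ∀ x, 0 < coefD α β * Y x 2 + coefE μ α β ω) (hper : Function.Periodic Y T)
    (hsym : ∀ τ, Y (-τ) = ![Y τ 0, -(Y τ 1), Y τ 2, -(Y τ 3)]) :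
    Function.Periodic (phase μ α β lam ω Y) T := by
  intro x
  have hc := (contDiff_phaseGrad (lam := lam) hY hpos).continuous
  have h1 := (periodic_phaseGrad (μ := μ) (α := α) (β := β) (lam := lam) (ω := ω)
    hper).intervalIntegral_add_eq (-(T / 2)) 0
  have h2 : ∫ s in (-(T / 2))..(T / 2), phaseGrad μ α β lam ω Y s = 0 := by
    have := intervalIntegral.integral_comp_neg (a := -(T / 2)) (b := T / 2)
      (phaseGrad μ α β lam ω Y)
    simp only [phaseGrad_neg hsym, neg_neg, intervalIntegral.integral_neg] at this
    linarith
  have h3 := (periodic_phaseGrad (μ := μ) (α := α) (β := β) (lam := lam) (ω := ω)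
    hper).intervalIntegral_add_eq x 0
  rw [show -(T / 2) + T = T / 2 by ring, h2] at h1
  rw [← h1] at h3
  change ∫ s in (0 : ℝ)..(x + T), phaseGrad μ α β lam ω Y s
    = ∫ s in (0 : ℝ)..x, phaseGrad μ α β lam ω Y s
  rw [← intervalIntegral.integral_add_adjacent_intervals (hc.intervalIntegrable 0 x)
    (hc.intervalIntegrable x (x + T)), h3, add_zero]

/-- A bound for the phase by a bound for its gradient. -/
theorem abs_phase_le (hT : 0 < T) (hφ : Function.Periodic (phase μ α β lam ω Y) T) {K : ℝ}
    (hK : ∀ x, |phaseGrad μ α β lam ω Y x| ≤ K) (x : ℝ) :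
    |phase μ α β lam ω Y x| ≤ K * T := by
  obtain ⟨y, hy, hxy⟩ := hφ.exists_mem_Ico₀ hT x
  rw [hxy]
  have h1 := intervalIntegral.norm_integral_le_of_norm_le_const (a := 0) (b := y)
    (f := phaseGrad μ α β lam ω Y) (C := K) (fun t _ => hK t)
  rw [sub_zero, abs_of_nonneg hy.1] at h1
  have hK0 : 0 ≤ K := (abs_nonneg _).trans (hK 0)
  exact h1.trans (mul_le_mul_of_nonneg_left hy.2.le hK0)

theorem isStationaryMAW (h : β - α ≠ 0) (hl : lam ≠ 0) (hT : 0 < T)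
    (hY : ∀ τ, HasDerivAt Y (vf4 μ α β lam ω (Y τ)) τ)
    (hpos : ∀ x, 0 < coefD α β * Y x 2 + coefE μ α β ω)
    (hdef : ∀ τ, consistencyDefect μ α β lam ω (Y τ) = 0) (hper : Function.Periodic Y T)
    (hsym : ∀ τ, Y (-τ) = ![Y τ 0, -(Y τ 1), Y τ 2, -(Y τ 3)])
    {x₁ x₂ : ℝ} (hne : Y x₁ 2 ≠ Y x₂ 2) :
    IsStationaryMAW μ α β T ω (amplitude μ α β ω Y) (phase μ α β lam ω Y) := by
  have hR : Function.Periodic (amplitude μ α β ω Y) T := fun x => by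
    simp only [amplitude, hper x]
  have hφ := periodic_phase (lam := lam) hY hpos hper hsym
  have hRpos : ∀ x, 0 < amplitude μ α β ω Y x := fun x => Real.sqrt_pos.mpr (hpos x)
  have hS := solvesAmplitudePhase h hl hY hpos hdef
  refine ⟨hT, hS.1, hS.2.1, hRpos, hR, ?_, ?_, solvesCGL_field hRpos hS⟩
  · rintro ⟨r, hr⟩
    apply hne
    have h1 := (hr x₁).trans (hr x₂).symm
    rw [amplitude, amplitude, Real.sqrt_inj (hpos x₁).le (hpos x₂).le] at h1
    have h2 : coefD α β * (Y x₁ 2 - Y x₂ 2) = 0 := by linarith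
    exact sub_eq_zero.mp ((mul_eq_zero.mp h2).resolve_left (coefD_ne_zero h))
  · intro t x
    simp only [field, hR x, hφ x]

end
end
end CGL

namespace CGL
noncomputable section

open CGL.PerFun

/-! ### Continuity and limits along the branch -/

theorem continuousAt_profile {c : Reduced} {Ω : ℝ → ℝ} {z : ℝ → Unknowns} {ρ : ℝ}
    (hl : c.lam ≠ 0) (he : c.e (z ρ) ≠ 0) (hV : c.V (z ρ) ≠ 0) (hW : c.W (z ρ) ≠ 0)
    (hΩ0 : Ω ρ ≠ 0) (hΩ : ContinuousAt Ω ρ) (hz : ContinuousAt z ρ) (i : Fin 4) :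
    ContinuousAt (fun ρ => c.profile ρ (Ω ρ) (z ρ) i) ρ := by
  have h1 : ContinuousAt (fun ρ => c.p (z ρ)) ρ :=
    (Reduced.contDiff_p (c := c)).continuous.continuousAt.comp hz
  have h2 : ContinuousAt (fun ρ => c.n (z ρ)) ρ :=
    (Reduced.contDiff_n (c := c)).continuous.continuousAt.comp hz
  have h3 : ContinuousAt (fun ρ => c.h (z ρ)) ρ :=
    (Reduced.contDiffAt_h hl he hV).continuousAt.comp hz
  have h4 : ContinuousAt (fun ρ => c.q (z ρ)) ρ :=
    (Reduced.contDiffAt_q hl he hV hW).continuousAt.comp hz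
  have h5 : ContinuousAt (fun ρ => c.k (z ρ)) ρ :=
    (Reduced.contDiff_k (c := c)).continuous.continuousAt.comp hz
  have h6 : ContinuousAt (fun ρ => c.W (z ρ)) ρ :=
    (Reduced.contDiff_W (c := c)).continuous.continuousAt.comp hz
  have hlW : c.lam * c.W (z ρ) ≠ 0 := mul_ne_zero hl hW
  fin_cases i
  · change ContinuousAt (fun ρ => (Ω ρ)⁻¹ • c.n (z ρ)
      + (c.k (z ρ) * Ω ρ / c.W (z ρ)) • c.q (z ρ)) ρ
    fun_prop (disch := assumption)
  · change ContinuousAt (fun ρ => (ρ / (c.lam * c.W (z ρ))) • c.h (z ρ)) ρ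
    fun_prop (disch := assumption)
  · change ContinuousAt (fun ρ => (c.p (z ρ) - ((z ρ).1 / (c.lam * c.W (z ρ))) • c.h (z ρ)) * sinC
      + c.q (z ρ) * cosC) ρ
    fun_prop (disch := assumption)
  · change ContinuousAt (fun ρ => (c.p (z ρ) - ((z ρ).1 / (c.lam * c.W (z ρ))) • c.h (z ρ)) * cosC
      - c.q (z ρ) * sinC) ρ
    fun_prop (disch := assumption)

/-- At ε = 0 one has n = k a₄ sin, p = a₄ cos and q = -a₄ sin. The two parts of x₁ cancel because Ω²
= W, and rotating (p, q) back gives the constant pair (0, a₄). -/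
theorem profile_base {c : Reduced} {Ω : ℝ} (u : PerFun × PerFun × ℝ × ℝ)
    (hΩ : Ω ≠ 0) (hΩsq : Ω ^ 2 = c.V (0, u)) (i : Fin 4) :
    c.profile 0 Ω (0, u) i = (![0, 0, 0, c.amp] : Fin 4 → ℝ) i • (1 : PerFun) := by
  have hVW : Ω ^ 2 = c.W (0, u) := by rw [hΩsq, Reduced.V_zero, Reduced.W_zero]
  fin_cases i
  · simp only [Reduced.profile, Fin.zero_eta, Matrix.cons_val_zero, Reduced.n_zero,
      Reduced.q_zero, zero_smul, ← hVW]
    rw [smul_neg, smul_smul, smul_smul, ← sub_eq_add_neg, ← sub_smul]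
    convert zero_smul ℝ sinC
    field_simp
    ring
  · simp [Reduced.profile]
  · simp only [Reduced.profile, Fin.reduceFinMk, Matrix.cons_val, Reduced.p_zero,
      Reduced.q_zero, zero_div, zero_smul, sub_zero]
    rw [smul_mul_assoc, neg_mul, smul_mul_assoc, mul_comm cosC, add_neg_cancel]
  · simp only [Reduced.profile, Fin.reduceFinMk, Matrix.cons_val, Reduced.p_zero,
      Reduced.q_zero, zero_div, zero_smul, sub_zero]
    rw [smul_mul_assoc, neg_mul, smul_mul_assoc, sub_neg_eq_add, ← smul_add, cosC_sq_add_sinC_sq]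

theorem tendstoUniformly_of_abs_sub_le {F : ℝ → ℝ → ℝ} {a : ℝ} {B : ℝ → ℝ}
    {l : Filter ℝ} (hB : Filter.Tendsto B l (nhds 0))
    (h : ∀ᶠ ρ in l, ∀ x, |F ρ x - a| ≤ B ρ) : TendstoUniformly F (fun _ => a) l := by
  rw [Metric.tendstoUniformly_iff]
  intro ε hε
  filter_upwards [h, hB.eventually_lt_const hε] with ρ h1 h2 x
  rw [dist_comm, Real.dist_eq]
  exact (h1 x).trans_lt h2

theorem abs_sqrt_sub_sqrt_le {a b : ℝ} (ha : 0 ≤ a) (hb : 0 < b) :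
    |Real.sqrt a - Real.sqrt b| ≤ |a - b| / Real.sqrt b := by
  have h1 := Real.sqrt_pos.mpr hb
  have h2 := Real.sqrt_nonneg a
  rw [le_div_iff₀ h1]
  have h3 : a - b = (Real.sqrt a - Real.sqrt b) * (Real.sqrt a + Real.sqrt b) := by
    nlinarith [Real.sq_sqrt ha, Real.sq_sqrt hb.le]
  rw [h3, abs_mul, abs_of_nonneg (add_nonneg h2 h1.le)]
  exact mul_le_mul_of_nonneg_left (by linarith) (abs_nonneg _)

/-- The determining equations hold at the bifurcation point. -/
theorem determiningMap_base {μ α β lam a₄ : ℝ} (hμ : 0 < μ) (hs : 1 + α * β < 0)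
    (hlam : lam ^ 2 + coefC α β * lam - 2 * coefA α β * coefD α β = 0)
    (u : PerFun × PerFun × ℝ × ℝ) :
    determiningMap μ α β lam a₄
      ![(reduced μ α β lam a₄).hMean (0, u) / (lam * (reduced μ α β lam a₄).W (0, u)),
        (reduced μ α β lam a₄).γ (0, u),
        (reduced μ α β lam a₄).σ (0, u) + coefD α β
          * ((reduced μ α β lam a₄).hMean (0, u) / (lam * (reduced μ α β lam a₄).W (0, u)))]
      = 0 := by
  have h := beta_sub_alpha_ne_zero hs
  have hl := root_ne_zero h hlam
  have hsq := root_sq hlam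
  have hd := coefD_ne_zero h
  have hm := (one_add_sq_pos α).ne'
  have hs' := hs.ne
  have hμ' := hμ.ne'
  have hA := coefA_eq α β
  rw [Reduced.σ_zero, Reduced.γ_zero, Reduced.hMean_zero, Reduced.W_zero, Reduced.V_zero,
    Reduced.k_zero]
  simp only [reduced, determiningMap, coefK, coefE_base h, eTilde_base h, hA]
  generalize coefD α β = d at *
  have hsl : lam * α * β = lam * (1 + α * β) - lam := by ring
  rw [hsl]
  generalize 1 + α * β = s at *
  generalize 1 + α ^ 2 = m at *
  funext i
  fin_cases i
  · simp
    field_simp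
    ring
  · simp
  · simp
    field_simp
    -- Here σ comes from the condition at θ = 0, while the determining equation comes from the mean
    -- defect on the starting vector; the two agree modulo the quadratic for λ.
    linear_combination 8 * s * a₄ ^ 2 * hsq

end
end CGL

/-! ### Squared amplitude, momentum and wave points -/

namespace CGL
noncomputable section

open CGL.PerFun

/-- `R²` as a function of the angle. -/
def Reduced.sqAmp (c : Reduced) (z : Unknowns) : PerFun :=
  (c.d * z.1) • c.p z + c.e z • (1 : PerFun)

/-- `(1 + α²) G` as a function of the angle. -/
def Reduced.momentum (c : Reduced) (Ω : ℝ) (z : Unknowns) : PerFun :=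
  z.1 • ((c.a / c.lam * Ω⁻¹) • c.n z - (c.lam * Ω) • c.q z)

theorem nondeg_reduced {μ α β lam a₄ : ℝ} (hμ : 0 < μ) (hs : 1 + α * β < 0) (hl : lam ≠ 0)
    (ha₄ : a₄ ≠ 0) : (reduced μ α β lam a₄).Nondeg where
  s := hs.ne
  m := (one_add_sq_pos α).ne'
  lam := hl
  a := coefA_ne_zero (beta_sub_alpha_ne_zero hs)
  μ := hμ.ne'
  amp := ha₄

theorem continuous_sqAmp (c : Reduced) : Continuous c.sqAmp := by
  have h1 := (Reduced.contDiff_p (c := c)).continuous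
  have h2 := (Reduced.contDiff_e (c := c)).continuous
  unfold Reduced.sqAmp
  fun_prop

theorem continuousAt_momentum {c : Reduced} {Ω : ℝ → ℝ} {z : ℝ → Unknowns} {ρ : ℝ}
    (hl : c.lam ≠ 0) (he : c.e (z ρ) ≠ 0) (hV : c.V (z ρ) ≠ 0) (hW : c.W (z ρ) ≠ 0)
    (hΩ0 : Ω ρ ≠ 0) (hΩ : ContinuousAt Ω ρ) (hz : ContinuousAt z ρ) :
    ContinuousAt (fun ρ => c.momentum (Ω ρ) (z ρ)) ρ := by
  have h2 : ContinuousAt (fun ρ => c.n (z ρ)) ρ :=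
    (Reduced.contDiff_n (c := c)).continuous.continuousAt.comp hz
  have h4 : ContinuousAt (fun ρ => c.q (z ρ)) ρ :=
    (Reduced.contDiffAt_q hl he hV hW).continuousAt.comp hz
  unfold Reduced.momentum
  fun_prop (disch := assumption)

/-- The points of the branch at which the wave exists. -/
structure IsWavePoint (μ α β lam a₄ : ℝ) (z : Unknowns) : Prop where
  fixed : (reduced μ α β lam a₄).IsFixed z
  W_pos : 0 < (reduced μ α β lam a₄).W z
  V_pos : 0 < (reduced μ α β lam a₄).V z
  sqAmp_near : ‖(reduced μ α β lam a₄).sqAmp z - μ • (1 : PerFun)‖ < μ / 2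
  p_near : ‖(reduced μ α β lam a₄).p z - a₄ • cosC‖ < |a₄|

section

variable {μ α β lam a₄ ρ : ℝ} {z : Unknowns} {Y : ℝ → Fin 4 → ℝ}

theorem sqAmp_eq (h : β - α ≠ 0) (H : (reduced μ α β lam a₄).IsFixed z)
    (hz : z.1 = ρ ^ 2) {Ω : ℝ} (hΩ : 0 < Ω)
    (hY : ∀ τ, Y τ = physical μ α β lam (z.freq μ α β) ρ Ω τ
      ((reduced μ α β lam a₄).solution ρ Ω z τ)) (x : ℝ) :
    coefD α β * Y x 2 + coefE μ α β (z.freq μ α β)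
      = (reduced μ α β lam a₄).sqAmp z ((Ω * x : ℝ) : AddCircle (2 * Real.pi)) := by
  rw [hY, physical_solution h H hz hΩ, coefE_point h (lam := lam) (a₄ := a₄)]
  simp only [Matrix.cons_val, Reduced.sqAmp, ContinuousMap.add_apply, ContinuousMap.smul_apply,
    ContinuousMap.one_apply, smul_eq_mul, mul_one]
  rw [show (reduced μ α β lam a₄).d = coefD α β from rfl]
  ring

theorem momentum_eq (h : β - α ≠ 0) (H : (reduced μ α β lam a₄).IsFixed z)
    (hz : z.1 = ρ ^ 2) {Ω : ℝ} (hΩ : 0 < Ω)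
    (hY : ∀ τ, Y τ = physical μ α β lam (z.freq μ α β) ρ Ω τ
      ((reduced μ α β lam a₄).solution ρ Ω z τ)) (x : ℝ) :
    coefA α β / lam * Y x 1 - lam * Y x 3
      = (reduced μ α β lam a₄).momentum Ω z ((Ω * x : ℝ) : AddCircle (2 * Real.pi)) := by
  rw [hY, physical_solution h H hz hΩ]
  simp only [Matrix.cons_val, Reduced.momentum, ContinuousMap.sub_apply, ContinuousMap.smul_apply,
    smul_eq_mul]
  rw [show (reduced μ α β lam a₄).a = coefA α β from rfl,
    show (reduced μ α β lam a₄).lam = lam from rfl]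
  ring

theorem abs_apply_sub_le (f : PerFun) (a : ℝ) (x : AddCircle (2 * Real.pi)) :
    |f x - a| ≤ ‖f - a • (1 : PerFun)‖ := by
  simpa using (f - a • (1 : PerFun)).norm_coe_le_norm x

theorem IsWavePoint.half_lt (H : IsWavePoint μ α β lam a₄ z) (x : AddCircle (2 * Real.pi)) :
    μ / 2 < (reduced μ α β lam a₄).sqAmp z x := by
  have h1 := (abs_apply_sub_le ((reduced μ α β lam a₄).sqAmp z) μ x).trans_lt H.sqAmp_near
  linarith [(abs_lt.mp h1).1]

/-- The values of a₄ cos at 0 and π differ by 2|a₄|, and a perturbation smaller than |a₄| at each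
point cannot close this gap. -/
theorem IsWavePoint.p_ne (H : IsWavePoint μ α β lam a₄ z) :
    (reduced μ α β lam a₄).p z 0
      ≠ (reduced μ α β lam a₄).p z ((Real.pi : ℝ) : AddCircle (2 * Real.pi)) := by
  set p := (reduced μ α β lam a₄).p z with hp
  intro heq
  have h1 := ((p - a₄ • cosC).norm_coe_le_norm 0).trans_lt H.p_near
  have h2 := ((p - a₄ • cosC).norm_coe_le_norm
    ((Real.pi : ℝ) : AddCircle (2 * Real.pi))).trans_lt H.p_near
  simp only [ContinuousMap.sub_apply, ContinuousMap.smul_apply, cosC_zero, cosC_coe, Real.cos_pi,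
    smul_eq_mul, Real.norm_eq_abs] at h1 h2
  rw [← heq] at h2
  have h3 : |2 * a₄| ≤ |p 0 - a₄ * 1| + |p 0 - a₄ * -1| := by
    have := abs_sub (p 0 - a₄ * -1) (p 0 - a₄ * 1)
    rw [show p 0 - a₄ * -1 - (p 0 - a₄ * 1) = 2 * a₄ by ring] at this
    linarith
  rw [abs_mul, abs_two] at h3
  linarith

theorem IsWavePoint.abs_phaseGrad_le (hμ : 0 < μ) (h : β - α ≠ 0)
    (H : IsWavePoint μ α β lam a₄ z) (hz : z.1 = ρ ^ 2) {Ω : ℝ} (hΩ : 0 < Ω)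
    (hY : ∀ τ, Y τ = physical μ α β lam (z.freq μ α β) ρ Ω τ
      ((reduced μ α β lam a₄).solution ρ Ω z τ)) (x : ℝ) :
    |phaseGrad μ α β lam (z.freq μ α β) Y x|
      ≤ ‖(reduced μ α β lam a₄).momentum Ω z‖ / (1 + α ^ 2) / (μ / 2) := by
  have hm := one_add_sq_pos α
  have h1 := H.half_lt ((Ω * x : ℝ) : AddCircle (2 * Real.pi))
  have h2 := ((reduced μ α β lam a₄).momentum Ω z).norm_coe_le_norm
    ((Ω * x : ℝ) : AddCircle (2 * Real.pi))
  rw [phaseGrad, sqAmp_eq h H.fixed hz hΩ hY, momentum_eq h H.fixed hz hΩ hY, abs_div, abs_div,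
    abs_of_pos hm, abs_of_pos ((half_pos hμ).trans h1)]
  rw [Real.norm_eq_abs] at h2
  gcongr

end

end
end CGL

/-! ### The branch consists of wave points near ε = 0 -/

namespace CGL
noncomputable section

open CGL.PerFun

/-- Apart from the fixed-point equation, the requirements are strict inequalities between continuous
functions of ε that hold at ε = 0. -/
theorem exists_wavePoint_branch {μ α β lam a₄ : ℝ} (hμ : 0 < μ) (hs : 1 + α * β < 0)
    (hl : lam ≠ 0) (ha₄ : a₄ ≠ 0) :
    ∃ u : ℝ → PerFun × PerFun × ℝ × ℝ, ∀ᶠ ε in nhds (0 : ℝ),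
      ContinuousAt u ε ∧ IsWavePoint μ α β lam a₄ (ε, u ε) := by
  set c := reduced μ α β lam a₄ with hc
  have hnd : c.Nondeg := nondeg_reduced hμ hs hl ha₄
  obtain ⟨u, hu⟩ := Reduced.exists_branch hnd
  refine ⟨u, ?_⟩
  have hz : ContinuousAt (fun ε : ℝ => ((ε, u ε) : Unknowns)) 0 :=
    continuousAt_id.prodMk hu.self_of_nhds.1
  have hWpos : 0 < c.W (0, u 0) := by
    rw [Reduced.W_zero]
    exact base_freq_sq_pos hμ hs
  have he : ContinuousAt (fun ε => c.e (ε, u ε)) 0 :=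
    (Reduced.contDiff_e (c := c)).continuous.continuousAt.comp hz
  have hW : ContinuousAt (fun ε => c.W (ε, u ε)) 0 :=
    (Reduced.contDiff_W (c := c)).continuous.continuousAt.comp hz
  have hV : ContinuousAt (fun ε => c.V (ε, u ε)) 0 :=
    (Reduced.contDiff_V (c := c)).continuous.continuousAt.comp hz
  have hp : ContinuousAt (fun ε => ‖c.p (ε, u ε) - a₄ • cosC‖) 0 :=
    (((Reduced.contDiff_p (c := c)).continuous.continuousAt.comp hz).sub continuousAt_const).norm
  have hU : ContinuousAt (fun ε => ‖c.sqAmp (ε, u ε) - μ • (1 : PerFun)‖) 0 :=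
    (((continuous_sqAmp c).continuousAt.comp hz).sub continuousAt_const).norm
  have e1 := he.eventually_const_lt (u := 0) (by
    change 0 < c.e (0, u 0)
    rw [Reduced.e_zero]
    exact hμ)
  have e2 := hW.eventually_const_lt hWpos
  have e3 := hV.eventually_const_lt (u := 0) (by
    change 0 < c.V (0, u 0)
    rwa [Reduced.V_zero, ← Reduced.W_zero (u 0)])
  have e4 := hp.eventually_lt_const (u := |a₄|) (by
    change ‖c.p (0, u 0) - a₄ • cosC‖ < |a₄|
    rw [Reduced.p_zero, show c.amp = a₄ from rfl, sub_self, norm_zero]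
    exact abs_pos.mpr ha₄)
  have e5 := hU.eventually_lt_const (u := μ / 2) (by
    change ‖c.sqAmp (0, u 0) - μ • (1 : PerFun)‖ < μ / 2
    rw [Reduced.sqAmp, Reduced.e_zero, show c.μ = μ from rfl]
    simp [hμ])
  filter_upwards [hu, e1, e2, e3, e4, e5] with ε h0 h1 h2 h3 h4 h5
  exact ⟨h0.1, ⟨hnd, h1.ne', h2.ne', h3.ne', h0.2⟩, h2, h3, h5, h4⟩

end
end CGL

/-! ### The main theorem -/

set_option maxRecDepth 4000 in
theorem mainTheorem2 (μ α β lam a₄ : ℝ) (hμ : 0 < μ) (hBFN : 1 + α * β < 0)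
    (hlam : lam ^ 2 + CGL.coefC α β * lam - 2 * CGL.coefA α β * CGL.coefD α β = 0)
    (ha₄ : a₄ ≠ 0) :
    -- the linear part at `ω = μβ`: eigenvalues `0, 0, ±iω₁`, one eigenvector for `0`
    (0 < CGL.eTilde μ α β lam (μ * β) / lam ∧
      (CGL.linPart μ α β lam (μ * β)).charpoly =
        Polynomial.X ^ 2 *
          (Polynomial.X ^ 2 + Polynomial.C (CGL.eTilde μ α β lam (μ * β) / lam)) ∧
      Module.finrank ℝ (Module.End.eigenspace
        (Matrix.toLin' (CGL.linPart μ α β lam (μ * β))) 0) = 1) ∧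
    -- the determining equations, their Jacobian and their simple zero
    ((∀ p : Fin 3 → ℝ, Filter.Tendsto (fun ρ => CGL.startingMap μ α β lam a₄ ρ p)
        (nhdsWithin 0 {0}ᶜ) (nhds (CGL.determiningMap μ α β lam a₄ p))) ∧
      (∀ p : Fin 3 → ℝ,
        DifferentiableAt ℝ (CGL.determiningMap μ α β lam a₄) p ∧
        (fderiv ℝ (CGL.determiningMap μ α β lam a₄) p).det =
          4 * (1 + α * β) ^ 2 * lam ^ 2 * μ * CGL.coefE μ α β (μ * β) / CGL.coefA α β) ∧
      4 * (1 + α * β) ^ 2 * lam ^ 2 * μ * CGL.coefE μ α β (μ * β) / CGL.coefA α β ≠ 0 ∧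
      ∃! p : Fin 3 → ℝ, CGL.determiningMap μ α β lam a₄ p = 0) ∧
    -- the branch of symmetric periodic solutions and of stationary MAWs
    ∃ ρ₀ : ℝ, 0 < ρ₀ ∧
    ∃ (a₂₂ γ ω₃ ω Ω : ℝ → ℝ) (X Y : ℝ → ℝ → Fin 4 → ℝ) (R φ : ℝ → ℝ → ℝ),
      (∀ ρ, ω ρ = CGL.carrierFreq μ α β ρ (a₂₂ ρ) (ω₃ ρ)) ∧
      (∀ ρ, Ω ρ = CGL.spatialFreq μ α β lam (ω ρ) ρ (γ ρ)) ∧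
      (∀ ρ τ, Y ρ τ = CGL.physical μ α β lam (ω ρ) ρ (Ω ρ) τ (X ρ τ)) ∧
      (∀ ρ, R ρ = CGL.amplitude μ α β (ω ρ) (Y ρ)) ∧
      (∀ ρ, φ ρ = CGL.phase μ α β lam (ω ρ) (Y ρ)) ∧
      ContinuousOn a₂₂ (Set.Ioo (-ρ₀) ρ₀) ∧
      ContinuousOn γ (Set.Ioo (-ρ₀) ρ₀) ∧
      ContinuousOn ω₃ (Set.Ioo (-ρ₀) ρ₀) ∧
      ContinuousOn (fun q : ℝ × ℝ => X q.1 q.2) (Set.Ioo (-ρ₀) ρ₀ ×ˢ Set.univ) ∧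
      CGL.determiningMap μ α β lam a₄ ![a₂₂ 0, γ 0, ω₃ 0] = 0 ∧
      (∀ ρ ∈ Set.Ioo (-ρ₀) ρ₀,
        -- frequencies and linear part at `ω ρ`
        CGL.coefE μ α β (ω ρ) = (α * ω ρ + μ) / (1 + α * β)
          + ρ ^ 2 * (ρ ^ 2 * ω₃ ρ - ρ * CGL.coefD α β * (ρ * a₂₂ ρ)) ∧
        0 < CGL.eTilde μ α β lam (ω ρ) / lam ∧
        0 < Ω ρ ∧
        Ω ρ ^ 2 = CGL.eTilde μ α β lam (ω ρ) / lam + ρ ^ 2 * γ ρ ∧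
        Module.finrank ℝ (Module.End.eigenspace
          (Matrix.toLin' (CGL.linPart μ α β lam (ω ρ))) 0) = 1 ∧
        -- symmetric periodic solution of the rescaled system
        (∀ τ, HasDerivAt (X ρ)
          (CGL.rescaledVF μ α β lam (ω ρ) ρ (γ ρ) (Ω ρ) τ (X ρ τ)) τ) ∧
        Function.Periodic (X ρ) (2 * Real.pi / Ω ρ) ∧
        (∀ τ, CGL.reflQ.mulVec (X ρ (-τ)) = X ρ τ) ∧
        (∀ i, CGL.mean (2 * Real.pi / Ω ρ) (fun τ => X ρ τ i) = ![0, ρ * a₂₂ ρ, 0, a₄] i) ∧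
        -- symmetric periodic solution of the 4-D system, with the consistency condition
        (∀ τ, HasDerivAt (Y ρ) (CGL.vf4 μ α β lam (ω ρ) (Y ρ τ)) τ) ∧
        Function.Periodic (Y ρ) (2 * Real.pi / Ω ρ) ∧
        (∀ τ, Y ρ (-τ) = ![Y ρ τ 0, -(Y ρ τ 1), Y ρ τ 2, -(Y ρ τ 3)]) ∧
        (∀ τ, CGL.consistencyDefect μ α β lam (ω ρ) (Y ρ τ) = 0) ∧
        -- amplitude and phase
        (∀ x, 0 < CGL.coefD α β * Y ρ x 2 + CGL.coefE μ α β (ω ρ)) ∧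
        CGL.SolvesAmplitudePhase μ α β (ω ρ) (R ρ) (φ ρ) ∧
        (∀ x, R ρ (-x) = R ρ x ∧ φ ρ (-x) = φ ρ x) ∧
        Function.Periodic (φ ρ) (2 * Real.pi / Ω ρ) ∧
        -- stationary MAW of the CGLe
        (ρ ≠ 0 → CGL.IsStationaryMAW μ α β (2 * Real.pi / Ω ρ) (ω ρ) (R ρ) (φ ρ))) ∧
      -- bifurcation from the homogeneously oscillating state `√μ exp(-iμβt)`
      TendstoUniformly X (fun _ => ![0, 0, 0, a₄]) (nhds 0) ∧
      Filter.Tendsto ω (nhds 0) (nhds (μ * β)) ∧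
      Filter.Tendsto (fun ρ => CGL.coefE μ α β (ω ρ)) (nhds 0) (nhds μ) ∧
      Filter.Tendsto Ω (nhds 0)
        (nhds (Real.sqrt (-(2 * μ * (1 + α * β)) / (1 + α ^ 2)))) ∧
      TendstoUniformly R (fun _ => Real.sqrt μ) (nhds 0) ∧
      TendstoUniformly φ (fun _ => 0) (nhds 0) ∧
      TendstoUniformly (fun ρ => deriv (φ ρ)) (fun _ => 0) (nhds 0) := by
  have h := CGL.beta_sub_alpha_ne_zero hBFN
  have hl := CGL.root_ne_zero h hlam
  have hA := CGL.coefA_ne_zero h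
  have he0 := CGL.coefE_base h μ
  have hW0 : CGL.eTilde μ α β lam (μ * β) / lam = -(2 * (1 + α * β) / (1 + α ^ 2)) * μ := by
    rw [CGL.eTilde_base h, mul_div_cancel_left₀ _ hl]
  refine ⟨⟨?_, CGL.charpoly_linPart μ α β lam (μ * β),
    CGL.finrank_eigenspace_linPart hl hA (by rw [he0]; exact hμ.ne')⟩,
    ⟨CGL.tendsto_startingMap hμ hBFN hl ha₄,
      fun p => ⟨(CGL.hasFDerivAt_determiningMap μ α β lam a₄ p).differentiableAt,
        CGL.det_fderiv_determiningMap μ α β lam a₄ p⟩, ?_, ?_⟩, ?_⟩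
  · rw [hW0]
    exact CGL.base_freq_sq_pos hμ hBFN
  · rw [he0]
    have := hBFN.ne
    have := hμ.ne'
    positivity
  · refine CGL.existsUnique_determiningMap a₄ fun i => ?_
    have h1 := hBFN.ne
    have h2 := hμ.ne'
    fin_cases i
    · simp [CGL.determiningDiag, he0, hl, h2, hA]
    · simp [CGL.determiningDiag]
    · simp [CGL.determiningDiag, h1, hl, h2]
  obtain ⟨u, hu⟩ := CGL.exists_wavePoint_branch (μ := μ) (α := α) (β := β) (lam := lam) hμ hBFN hl ha₄
  set c := CGL.reduced μ α β lam a₄ with hc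
  -- The reduced problem depends on ρ only through ε = ρ²; a bare ρ reappears only in x₂ = ρ h/(λW).
  set z : ℝ → CGL.Unknowns := fun ρ => (ρ ^ 2, u (ρ ^ 2))
  have hz1 : ∀ ρ, (z ρ).1 = ρ ^ 2 := fun _ => rfl
  have hz0 : z 0 = (0, u 0) := by simp [z]
  have hgood : ∀ᶠ ρ in nhds (0 : ℝ), ContinuousAt z ρ ∧ CGL.IsWavePoint μ α β lam a₄ (z ρ) := by
    have hsq : Filter.Tendsto (fun ρ : ℝ => ρ ^ 2) (nhds 0) (nhds 0) := by
      have : ContinuousAt (fun ρ : ℝ => ρ ^ 2) 0 := by fun_prop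
      simpa [ContinuousAt] using this
    filter_upwards [hsq.eventually hu] with ρ hρ
    have h1 : ContinuousAt (fun ρ : ℝ => ρ ^ 2) ρ := by fun_prop
    exact ⟨h1.prodMk (ContinuousAt.comp (g := u) hρ.1 h1), hρ.2⟩
  clear_value z
  obtain ⟨ρ₀, hρ₀, hball⟩ := Metric.eventually_nhds_iff_ball.mp hgood
  rw [Real.ball_eq_Ioo, zero_sub, zero_add] at hball
  obtain ⟨a₂₂, ha₂₂⟩ : ∃ f : ℝ → ℝ, ∀ ρ, f ρ = c.hMean (z ρ) / (lam * c.W (z ρ)) :=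
    ⟨_, fun _ => rfl⟩
  obtain ⟨γ, hγ⟩ : ∃ f : ℝ → ℝ, ∀ ρ, f ρ = (z ρ).2.2.2.1 := ⟨_, fun _ => rfl⟩
  -- The frequency depends on a₂₂ and ω₃ only through σ = ω₃ - d a₂₂, so ω₃ is recovered once a₂₂ is
  -- known.
  obtain ⟨ω₃, hω₃⟩ : ∃ f : ℝ → ℝ, ∀ ρ, f ρ = (z ρ).2.2.2.2 + CGL.coefD α β * a₂₂ ρ :=
    ⟨_, fun _ => rfl⟩
  obtain ⟨ω, hω⟩ : ∃ f : ℝ → ℝ, ∀ ρ, f ρ = CGL.carrierFreq μ α β ρ (a₂₂ ρ) (ω₃ ρ) :=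
    ⟨_, fun _ => rfl⟩
  obtain ⟨Ω, hΩ⟩ : ∃ f : ℝ → ℝ, ∀ ρ, f ρ = CGL.spatialFreq μ α β lam (ω ρ) ρ (γ ρ) :=
    ⟨_, fun _ => rfl⟩
  obtain ⟨X, hX⟩ : ∃ f : ℝ → ℝ → Fin 4 → ℝ, ∀ ρ, f ρ = c.solution ρ (Ω ρ) (z ρ) :=
    ⟨_, fun _ => rfl⟩
  obtain ⟨Y, hY⟩ : ∃ f : ℝ → ℝ → Fin 4 → ℝ,
      ∀ ρ τ, f ρ τ = CGL.physical μ α β lam (ω ρ) ρ (Ω ρ) τ (X ρ τ) := ⟨_, fun _ _ => rfl⟩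
  have hωz : ∀ ρ, ω ρ = (z ρ).freq μ α β := fun ρ => by
    simp only [hω ρ, CGL.carrierFreq_eq_freq, CGL.Unknowns.freq, hω₃, hz1]
    congr 1
    ring
  have hΩz : ∀ ρ, Ω ρ = Real.sqrt (c.V (z ρ)) := fun ρ => by
    rw [hΩ, hωz, hγ]
    exact CGL.spatialFreq_point h hl (hz1 ρ)
  have hYz : ∀ ρ τ, Y ρ τ = CGL.physical μ α β lam ((z ρ).freq μ α β) ρ (Ω ρ) τ
      (c.solution ρ (Ω ρ) (z ρ) τ) := fun ρ τ => by
    rw [hY, hX, hωz]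
  have hΩcont : ∀ ρ, ContinuousAt z ρ → ContinuousAt Ω ρ := fun ρ hρ => by
    rw [show Ω = fun ρ => Real.sqrt (c.V (z ρ)) from funext hΩz]
    exact ((CGL.Reduced.contDiff_V (c := c)).continuous.continuousAt.comp hρ).sqrt
  have hΩpos : ∀ ρ, CGL.IsWavePoint μ α β lam a₄ (z ρ) → 0 < Ω ρ := fun ρ hρ => by
    rw [hΩz]
    exact Real.sqrt_pos.mpr hρ.V_pos
  have hΩsq : ∀ ρ, CGL.IsWavePoint μ α β lam a₄ (z ρ) → Ω ρ ^ 2 = c.V (z ρ) := fun ρ hρ => by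
    rw [hΩz, Real.sq_sqrt hρ.V_pos.le]
  have hcont22 : ∀ ρ ∈ Set.Ioo (-ρ₀) ρ₀, ContinuousAt a₂₂ ρ := fun ρ hρ => by
    obtain ⟨hcz, hw⟩ := hball ρ hρ
    rw [show a₂₂ = _ from funext ha₂₂]
    exact ((CGL.Reduced.contDiffAt_hMean hl hw.fixed.e).continuousAt.comp hcz).div
      (continuousAt_const.mul ((CGL.Reduced.contDiff_W (c := c)).continuous.continuousAt.comp hcz))
      (mul_ne_zero hl hw.fixed.W)
  have hprof : ∀ ρ ∈ Set.Ioo (-ρ₀) ρ₀, ∀ i,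
      ContinuousAt (fun ρ => c.profile ρ (Ω ρ) (z ρ) i) ρ := fun ρ hρ i => by
    obtain ⟨hcz, hw⟩ := hball ρ hρ
    exact CGL.continuousAt_profile hl hw.fixed.e hw.fixed.V hw.fixed.W (hΩpos ρ hw).ne'
      (hΩcont ρ hcz) hcz i
  have h0mem : (0 : ℝ) ∈ Set.Ioo (-ρ₀) ρ₀ := ⟨by linarith, hρ₀⟩
  obtain ⟨hcz0, hw0⟩ := hball 0 h0mem
  have hYode : ∀ ρ, CGL.IsWavePoint μ α β lam a₄ (z ρ) →
      ∀ τ, HasDerivAt (Y ρ) (CGL.vf4 μ α β lam (ω ρ) (Y ρ τ)) τ := fun ρ hw τ => by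
    have := CGL.hasDerivAt_physical h hw.fixed (hz1 ρ) (hΩpos ρ hw) (hΩsq ρ hw) τ
    rw [hωz, show Y ρ = _ from funext (hYz ρ)]
    exact this
  have hYper : ∀ ρ, CGL.IsWavePoint μ α β lam a₄ (z ρ) →
      Function.Periodic (Y ρ) (2 * Real.pi / Ω ρ) := fun ρ hw τ => by
    rw [hYz, hYz, CGL.physical_solution h hw.fixed (hz1 ρ) (hΩpos ρ hw),
      CGL.physical_solution h hw.fixed (hz1 ρ) (hΩpos ρ hw), CGL.coe_mul_add_period (hΩpos ρ hw)]
  have hYsym : ∀ ρ, CGL.IsWavePoint μ α β lam a₄ (z ρ) →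
      ∀ τ, Y ρ (-τ) = ![Y ρ τ 0, -(Y ρ τ 1), Y ρ τ 2, -(Y ρ τ 3)] := fun ρ hw =>
    CGL.physical_neg h hw.fixed (hz1 ρ) (hΩpos ρ hw) (hYz ρ)
  have hYsq : ∀ ρ, CGL.IsWavePoint μ α β lam a₄ (z ρ) → ∀ x,
      CGL.coefD α β * Y ρ x 2 + CGL.coefE μ α β (ω ρ)
        = c.sqAmp (z ρ) ((Ω ρ * x : ℝ) : AddCircle (2 * Real.pi)) := fun ρ hw x => by
    rw [hωz]
    exact CGL.sqAmp_eq h hw.fixed (hz1 ρ) (hΩpos ρ hw) (hYz ρ) x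
  have hYpos : ∀ ρ, CGL.IsWavePoint μ α β lam a₄ (z ρ) → ∀ x,
      0 < CGL.coefD α β * Y ρ x 2 + CGL.coefE μ α β (ω ρ) := fun ρ hw x => by
    rw [hYsq ρ hw]
    exact (half_pos hμ).trans (hw.half_lt _)
  have hYdef : ∀ ρ, CGL.IsWavePoint μ α β lam a₄ (z ρ) →
      ∀ τ, CGL.consistencyDefect μ α β lam (ω ρ) (Y ρ τ) = 0 := fun ρ hw τ => by
    -- The defect is constant along the solution, so its value at τ = 0 decides.
    rw [CGL.consistencyDefect_eq h hlam (hYode ρ hw) τ 0, hωz, hYz]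
    exact CGL.consistencyDefect_physical_zero h hw.fixed (hz1 ρ) (hΩpos ρ hw)
  have hTpos : ∀ ρ, CGL.IsWavePoint μ α β lam a₄ (z ρ) → 0 < 2 * Real.pi / Ω ρ := fun ρ hw =>
    div_pos Real.two_pi_pos (hΩpos ρ hw)
  have hgrad : ∀ ρ, CGL.IsWavePoint μ α β lam a₄ (z ρ) → ∀ x,
      |CGL.phaseGrad μ α β lam (ω ρ) (Y ρ) x|
        ≤ ‖c.momentum (Ω ρ) (z ρ)‖ / (1 + α ^ 2) / (μ / 2) := fun ρ hw x => by
    rw [hωz]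
    exact hw.abs_phaseGrad_le hμ h (hz1 ρ) (hΩpos ρ hw) (hYz ρ) x
  have hgradlim : Filter.Tendsto (fun ρ => ‖c.momentum (Ω ρ) (z ρ)‖ / (1 + α ^ 2) / (μ / 2))
      (nhds 0) (nhds 0) := by
    have h1 := (((CGL.continuousAt_momentum hl hw0.fixed.e hw0.fixed.V hw0.fixed.W
      (hΩpos 0 hw0).ne' (hΩcont 0 hcz0) hcz0).norm.div_const (1 + α ^ 2)).div_const (μ / 2))
    -- The momentum carries an overall factor ε, which makes the phase gradient vanish in the limit.
    have h2 : c.momentum (Ω 0) (z 0) = 0 := by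
      rw [CGL.Reduced.momentum, hz0, zero_smul]
    have h3 : ‖c.momentum (Ω 0) (z 0)‖ / (1 + α ^ 2) / (μ / 2) = 0 := by
      rw [h2, norm_zero, zero_div, zero_div]
    exact h1.tendsto.mono_right (le_of_eq (congrArg nhds h3))
  have hΩcont0 := hΩcont 0 hcz0
  have hωlim : Filter.Tendsto ω (nhds 0) (nhds (μ * β)) := by
    have h1 : ContinuousAt (fun ρ => CGL.freq μ α β ((z ρ).1 ^ 2 * (z ρ).2.2.2.2)) 0 := by
      unfold CGL.freq
      fun_prop
    have h2 : CGL.freq μ α β ((z 0).1 ^ 2 * (z 0).2.2.2.2) = μ * β := by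
      rw [hz1, zero_pow two_ne_zero, zero_pow two_ne_zero, zero_mul, CGL.freq_zero]
    rw [show ω = fun ρ => CGL.freq μ α β ((z ρ).1 ^ 2 * (z ρ).2.2.2.2) from funext hωz]
    exact h1.tendsto.mono_right (le_of_eq (congrArg nhds h2))
  have helim : Filter.Tendsto (fun ρ => CGL.coefE μ α β (ω ρ)) (nhds 0) (nhds μ) := by
    have h1 : Continuous (CGL.coefE μ α β) := by
      unfold CGL.coefE
      fun_prop
    have := (h1.tendsto (μ * β)).comp hωlim
    rwa [he0] at this
  refine ⟨ρ₀, hρ₀, a₂₂, γ, ω₃, ω, Ω, X, Y, fun ρ => CGL.amplitude μ α β (ω ρ) (Y ρ),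
    fun ρ => CGL.phase μ α β lam (ω ρ) (Y ρ), hω, hΩ, hY,
    fun _ => rfl, fun _ => rfl, fun ρ hρ => (hcont22 ρ hρ).continuousWithinAt, ?_, ?_, ?_, ?_, ?_,
    ?_, hωlim, helim, ?_, ?_, ?_, ?_⟩
  · intro ρ hρ
    have hcz := (hball ρ hρ).1
    have : ContinuousAt γ ρ := by
      rw [show γ = _ from funext hγ]
      fun_prop
    exact this.continuousWithinAt
  · intro ρ hρ
    have hcz := (hball ρ hρ).1
    have h1 := hcont22 ρ hρ
    have : ContinuousAt ω₃ ρ := by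
      rw [show ω₃ = _ from funext hω₃]
      fun_prop
    exact this.continuousWithinAt
  · rintro ⟨ρ, τ⟩ ⟨hρ, -⟩
    refine ContinuousAt.continuousWithinAt (continuousAt_pi.mpr fun i => ?_)
    have hcz := (hball ρ hρ).1
    simp only [hX]
    -- Joint continuity in (ρ, τ): the profile depends continuously on ρ in the sup norm, and
    -- evaluation is jointly continuous.
    have h1 : ContinuousAt (fun q : ℝ × ℝ => c.profile q.1 (Ω q.1) (z q.1) i) (ρ, τ) :=
      ContinuousAt.comp (f := fun q : ℝ × ℝ => q.1) (g := fun ρ => c.profile ρ (Ω ρ) (z ρ) i)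
        (hprof ρ hρ i) continuousAt_fst
    have h2 : ContinuousAt (fun q : ℝ × ℝ => Ω q.1 * q.2) (ρ, τ) :=
      (ContinuousAt.comp (f := fun q : ℝ × ℝ => q.1) (g := Ω) (hΩcont ρ hcz)
        continuousAt_fst).mul continuousAt_snd
    have h3 : ContinuousAt (fun q : ℝ × ℝ => ((Ω q.1 * q.2 : ℝ) : AddCircle (2 * Real.pi)))
        (ρ, τ) :=
      ContinuousAt.comp (g := fun t : ℝ => (t : AddCircle (2 * Real.pi)))
        (AddCircle.continuous_mk' _).continuousAt h2
    exact h1.eval h3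
  · have h1 := CGL.determiningMap_base (a₄ := a₄) hμ hBFN hlam (u 0)
    have h2 : γ 0 = c.γ (0, u 0) := by
      rw [← hz0, hγ]
      exact hw0.fixed.γ_eq
    have h3 : (z 0).2.2.2.2 = c.σ (0, u 0) := by
      rw [← hz0]
      exact hw0.fixed.σ_eq
    simp only [hω₃, ha₂₂, h2, h3]
    rw [hz0]
    exact h1
  · intro ρ hρ
    obtain ⟨hcz, hw⟩ := hball ρ hρ
    have hVeq : CGL.eTilde μ α β lam (ω ρ) / lam = c.W (z ρ) := by
      rw [hωz, CGL.eTilde_point h (a₄ := a₄), mul_div_cancel_left₀ _ hl]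
    have hRsol := CGL.solvesAmplitudePhase h hl (hYode ρ hw) (hYpos ρ hw) (hYdef ρ hw)
    refine ⟨(CGL.coefE_eq_iff h hBFN.ne).mpr (hω ρ), ?_, hΩpos ρ hw, ?_, ?_, ?_,
      ?_, ?_, ?_, hYode ρ hw, hYper ρ hw, hYsym ρ hw, hYdef ρ hw,
      hYpos ρ hw, hRsol, fun x => ⟨CGL.amplitude_neg (hYsym ρ hw) x, CGL.phase_neg (hYsym ρ hw) x⟩,
      CGL.periodic_phase (hYode ρ hw) (hYpos ρ hw) (hYper ρ hw) (hYsym ρ hw), ?_⟩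
    · rw [hVeq]
      exact hw.W_pos
    · rw [hVeq, hΩsq ρ hw, CGL.Reduced.V, hz1, hγ]
    · refine CGL.finrank_eigenspace_linPart hl hA ?_
      rw [hωz, CGL.coefE_point h (lam := lam) (a₄ := a₄)]
      exact hw.fixed.e
    · intro τ
      rw [hωz, hX, hγ]
      exact CGL.hasDerivAt_solution h hw.fixed (hz1 ρ) (hΩpos ρ hw) (hΩsq ρ hw) τ
    · rw [hX]
      exact CGL.periodic_solution c (hΩpos ρ hw)
    · rw [hX]
      exact CGL.reflQ_solution hw.fixed
    · rw [hX, ha₂₂]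
      exact CGL.mean_solution hw.fixed (hΩpos ρ hw)
    · intro hρ0
      -- The points 0 and π/Ω, half a period apart, are the extrema of the leading mode a₄ cos Ωx.
      -- The factor ρ² ≠ 0 is what makes P differ there.
      refine CGL.isStationaryMAW h hl (hTpos ρ hw) (hYode ρ hw) (hYpos ρ hw) (hYdef ρ hw)
        (hYper ρ hw) (hYsym ρ hw) (x₁ := 0) (x₂ := Real.pi / Ω ρ) ?_
      rw [hYz, hYz, CGL.physical_solution h hw.fixed (hz1 ρ) (hΩpos ρ hw),
        CGL.physical_solution h hw.fixed (hz1 ρ) (hΩpos ρ hw)]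
      simp only [Matrix.cons_val, mul_zero, AddCircle.coe_zero,
        mul_div_cancel₀ _ (hΩpos ρ hw).ne', hz1]
      intro heq
      exact hw.p_ne (mul_left_cancel₀ (pow_ne_zero 2 hρ0) heq)
  · have hlim : ∀ i, Filter.Tendsto (fun ρ => ‖c.profile ρ (Ω ρ) (z ρ) i
        - (![0, 0, 0, a₄] : Fin 4 → ℝ) i • (1 : CGL.PerFun)‖) (nhds 0) (nhds 0) := fun i => by
      have h1 := ((hprof 0 h0mem i).sub (continuousAt_const
        (y := (![0, 0, 0, a₄] : Fin 4 → ℝ) i • (1 : CGL.PerFun)))).norm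
      have h2 : c.profile 0 (Ω 0) (z 0) i
          = (![0, 0, 0, a₄] : Fin 4 → ℝ) i • (1 : CGL.PerFun) := by
        rw [hz0]
        exact CGL.profile_base (u 0) (hΩpos 0 hw0).ne' (by rw [← hz0]; exact hΩsq 0 hw0) i
      have h3 : ‖c.profile 0 (Ω 0) (z 0) i
          - (![0, 0, 0, a₄] : Fin 4 → ℝ) i • (1 : CGL.PerFun)‖ = 0 := by
        rw [h2, sub_self, norm_zero]
      exact h1.tendsto.mono_right (le_of_eq (congrArg nhds h3))
    rw [Metric.tendstoUniformly_iff]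
    intro ε hε
    have hall : ∀ᶠ ρ in nhds (0 : ℝ), ∀ i, ‖c.profile ρ (Ω ρ) (z ρ) i
        - (![0, 0, 0, a₄] : Fin 4 → ℝ) i • (1 : CGL.PerFun)‖ < ε :=
      Filter.eventually_all.mpr fun i => (hlim i).eventually_lt_const hε
    filter_upwards [hall] with ρ hρ τ
    rw [dist_comm, dist_pi_lt_iff hε]
    intro i
    rw [Real.dist_eq, hX]
    exact (CGL.abs_apply_sub_le _ _ _).trans_lt (hρ i)
  · have h1 : Real.sqrt (-(2 * μ * (1 + α * β)) / (1 + α ^ 2)) = Ω 0 := by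
      rw [hΩz, hz0, CGL.Reduced.V_zero]
      congr 1
      simp only [hc, CGL.reduced]
      ring
    rw [h1]
    exact hΩcont0
  · refine CGL.tendstoUniformly_of_abs_sub_le
      (B := fun ρ => ‖c.sqAmp (z ρ) - μ • (1 : CGL.PerFun)‖ / Real.sqrt μ) ?_ ?_
    · have h1 : ContinuousAt (fun ρ => ‖c.sqAmp (z ρ) - μ • (1 : CGL.PerFun)‖ / Real.sqrt μ) 0 :=
        ((((CGL.continuous_sqAmp c).continuousAt.comp hcz0).sub continuousAt_const).norm).div_const _
      have h2 : c.sqAmp (z 0) = μ • (1 : CGL.PerFun) := by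
        rw [hz0, CGL.Reduced.sqAmp, CGL.Reduced.e_zero]
        simp [hc, CGL.reduced]
      have h3 : ‖c.sqAmp (z 0) - μ • (1 : CGL.PerFun)‖ / Real.sqrt μ = 0 := by
        rw [h2, sub_self, norm_zero, zero_div]
      exact h1.tendsto.mono_right (le_of_eq (congrArg nhds h3))
    · filter_upwards [hgood] with ρ hρ x
      refine (CGL.abs_sqrt_sub_sqrt_le (hYpos ρ hρ.2 x).le hμ).trans ?_
      rw [hYsq ρ hρ.2]
      have := CGL.abs_apply_sub_le (c.sqAmp (z ρ)) μ ((Ω ρ * x : ℝ) : AddCircle (2 * Real.pi))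
      gcongr
  · refine CGL.tendstoUniformly_of_abs_sub_le (B := fun ρ =>
      ‖c.momentum (Ω ρ) (z ρ)‖ / (1 + α ^ 2) / (μ / 2) * (2 * Real.pi / Ω ρ)) ?_ ?_
    · have h1 : Filter.Tendsto (fun ρ => 2 * Real.pi / Ω ρ) (nhds 0) (nhds (2 * Real.pi / Ω 0)) :=
        tendsto_const_nhds.div hΩcont0 (hΩpos 0 hw0).ne'
      simpa using hgradlim.mul h1
    · filter_upwards [hgood] with ρ hρ x
      rw [sub_zero]
      exact CGL.abs_phase_le (hTpos ρ hρ.2) (CGL.periodic_phase (hYode ρ hρ.2) (hYpos ρ hρ.2)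
        (hYper ρ hρ.2) (hYsym ρ hρ.2)) (hgrad ρ hρ.2) x
  · refine CGL.tendstoUniformly_of_abs_sub_le hgradlim ?_
    filter_upwards [hgood] with ρ hρ x
    rw [sub_zero, (CGL.hasDerivAt_phase (hYode ρ hρ.2) (hYpos ρ hρ.2) x).deriv]
    exact hgrad ρ hρ.2 x
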